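/- For $n\in\mathbb N$ let $X_1(0),\dots,X_n(0)\in\mathbb R$ be deterministic points (depending on $n$), $\mu_n=\frac1n\sum_{j=1}^n\delta_{X_j(0)}$, and let $\mu$ be a probability measure on $\mathbb R$, $x^*\in\mathbb R$ and $\kappa>2$. Let $F_n,F$ be the distribution functions of $\mu_n,\mu$. Assume: 1. All $\mu_n$ are supported in a fixed bounded set, $\mu_n\to\mu$ weakly, and $\mu$ has a Lebesgue density $\psi$ that is continuous as a function on the support of $\mu$ and satisfies $\psi(x)\sim c|x-x^*|^{\kappa}$ as $x\to x^*$ for some $c>0$. 2. There are $M_0>0$ and $n_0$ with $|F_n(x)-F(x)|\le M_0/n$ for all $n\ge n_0$ and $x\in\mathbb R$. 3. There are $m>0$ and $n_0$ such that for $n\ge n_0$ no point $X_j(0)$ lies in $[x^*-mn^{-1/(\kappa+1)},\,x^*+mn^{-1/(\kappa+1)}]$. Write $G_\mu^{(j)}(x^*)=(-1)^jj!\int\frac{d\mu(s)}{(x^*-s)^{j+1}}$ for $j=0,1,2$ (these integrals converge), $t_{\rm cr}=\bigl(\int\frac{d\mu(s)}{(x^*-s)^2}\bigr)^{-1}$,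 and assume $G_\mu''(x^*)>0$. Put $$c_2=\frac{2^{1/3}}{G_\mu''(x^*)^{1/3}t_{\rm cr}},\quad t_n^{\rm Ai}(\tau)=t_{\rm cr}+\frac{2\tau}{c_2^2n^{1/3}},\quad x_n^{\rm Ai}(\tau)=x^*+t_n^{\rm Ai}(\tau)G_\mu(x^*),\quad f_n(s,x)=-nG_\mu(x^*)x+\tfrac n2G_\mu(x^*)^2s .$$ Let $K_{n,s,t}$ ($s,t>0$) be the correlation kernel of $n$ non-intersecting Brownian motions with diffusion coefficient $n^{-1/2}$ started at the $X_j(0)$, $$K_{n,s,t}(x,y)=\frac{n}{(2\pi i)^2\sqrt{st}}\int_{x_0+i\mathbb R}dz\int_\Gamma dw\,\frac{\exp\left(\frac n{2t}[(z-y)^2+2tg_{\mu_n}(z)]-\frac n{2s}[(w-x)^2+2sg_{\mu_n}(w)]\right)}{z-w}-1(s>t)\sqrt{\tfrac{n}{2\pi(s-t)}}\,e^{-\frac{n(x-y)^2}{2(s-t)}},$$ where $g_{\mu_n}(z)=\int\log(z-s)\,d\mu_n(s)$ (principal branch), $x_0\in\mathbb R$ is arbitrary, and $\Gamma$ is any finite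 union of piecewise $C^1$ closed curves that avoids $x_0+i\mathbb R$ and all $X_j(0)$ and has winding number $1$ around each $X_j(0)$. Let $\tilde K_{n,s,t}(x,y)=K_{n,s,t}(x,y)\,e^{f_n(t,y)-f_n(s,x)}$. The extended Airy kernel is $$\mathbb K^{\rm Ai}_{\tau_1,\tau_2}(u,v)=\frac1{(2\pi i)^2}\int_{\Sigma^{\rm Ai}}d\zeta\int_{\Gamma^{\rm Ai}}d\omega\,\frac{\exp\left(\frac{\zeta^3}3-\zeta v-\tau_2\zeta^2-\frac{\omega^3}3+\omega u+\tau_1\omega^2\right)}{\zeta-\omega}-\frac{1(\tau_1>\tau_2)}{\sqrt{4\pi(\tau_1-\tau_2)}}\,e^{-\frac{(u-v)^2}{4(\tau_1-\tau_2)}},$$ where $\Sigma^{\rm Ai}$ consists of the rays from $\infty e^{-i\pi/3}$ to $0$ and from $0$ to $\infty e^{i\pi/3}$, and $\Gamma^{\rm Ai}$ of the rays from $\infty e^{-2i\pi/3}$ to $0$ and from $0$ to $\infty e^{2i\pi/3}$. Then for every $\sigma>0$ and every $0<\epsilon<\min\left(\frac{\kappa-2}{6(\kappa+1)},\frac1{15}\right)$,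 as $n\to\infty$, $$\frac1{c_2n^{2/3}}\tilde K_{n,t_n^{\rm Ai}(\tau_1),t_n^{\rm Ai}(\tau_2)}\left(x_n^{\rm Ai}(\tau_1)+\frac u{c_2n^{2/3}},\,x_n^{\rm Ai}(\tau_2)+\frac v{c_2n^{2/3}}\right)=\mathbb K^{\rm Ai}_{\tau_1,\tau_2}(u,v)+O\left(\frac{e^{-\sigma(u+v)}}{n^{\epsilon}}\right),$$ uniformly for $\tau_1,\tau_2$ in any compact subset of $\mathbb R$ and $u,v\in[-M,Mn^{\epsilon}]$, for any constant $M>0$. -/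

import Mathlib

open MeasureTheory Set Filter Topology Asymptotics

namespace NIBM

noncomputable section

/-- The empirical measure `(1/n) ∑ⱼ δ_{Xⱼ}` of a configuration of `n` points. -/
def empiricalMeasure {n : ℕ} (X : Fin n → ℝ) : Measure ℝ :=
  (n : ENNReal)⁻¹ • ∑ j, Measure.dirac (X j)

/-- The initial configurations `X n` stay in a fixed bounded set, their empirical measures converge
weakly to `μ`, and `μ` has a Lebesgue density `ψ`, continuous on the support of `μ`, such that
`ψ(x) ~ c |x - xstar| ^ κ` as `x → xstar`, for some `c > 0`, where `κ > 2`. -/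
structure HasVanishingLimitDensity (X : (n : ℕ) → Fin n → ℝ) (μ : Measure ℝ) (xstar κ : ℝ) :
    Prop where
  bounded : ∃ R : ℝ, ∀ (n : ℕ) (j : Fin n), |X n j| ≤ R
  weakly_converges : ∀ f : BoundedContinuousFunction ℝ ℝ,
    Tendsto (fun n : ℕ => ∫ x, f x ∂(empiricalMeasure (X n))) atTop (𝓝 (∫ x, f x ∂μ))
  two_lt : 2 < κ
  density : ∃ ψ : ℝ → ℝ, Measurable ψ ∧ (∀ x, 0 ≤ ψ x) ∧
    μ = volume.withDensity (fun x => ENNReal.ofReal (ψ x)) ∧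
    ContinuousOn ψ μ.support ∧
    ∃ c : ℝ, 0 < c ∧ ψ ~[𝓝[≠] xstar] (fun x => c * |x - xstar| ^ κ)

/-- Rigidity of the initial points: the distribution functions of the empirical measures and
of `μ` differ by at most `M / n`, uniformly on the line, for all large `n`. -/
def IsRigid (X : (n : ℕ) → Fin n → ℝ) (μ : Measure ℝ) : Prop :=
  ∃ M : ℝ, 0 < M ∧ ∃ n₀ : ℕ, ∀ n : ℕ, n₀ ≤ n → 0 < n → ∀ x : ℝ,
    |(empiricalMeasure (X n)).real (Iic x) - μ.real (Iic x)| ≤ M / n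

/-- For all large `n` there is no initial point in
`[xstar - m n^{-1/(κ+1)}, xstar + m n^{-1/(κ+1)}]`. -/
def HasInitialGap (X : (n : ℕ) → Fin n → ℝ) (xstar κ : ℝ) : Prop :=
  ∃ m : ℝ, 0 < m ∧ ∃ n₀ : ℕ, ∀ n : ℕ, n₀ ≤ n → 0 < n → ∀ j : Fin n,
    X n j ∉ Icc (xstar - m * (n : ℝ) ^ (-(1 / (κ + 1)))) (xstar + m * (n : ℝ) ^ (-(1 / (κ + 1))))

/-- The `j`-th derivative at the real point `x` of the Stieltjes transform
`G_μ(z) = ∫ μ(ds) / (z - s)`, that is `(-1)^j j! ∫ μ(ds) / (x - s)^(j+1)`. -/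
def stieltjesDeriv (μ : Measure ℝ) (j : ℕ) (x : ℝ) : ℝ :=
  (-1) ^ j * (j.factorial : ℝ) * ∫ s, 1 / (x - s) ^ (j + 1) ∂μ

/-- The critical time `(∫ μ(ds) / (x - s)²)⁻¹`. -/
def criticalTime (μ : Measure ℝ) (x : ℝ) : ℝ :=
  (∫ s, 1 / (x - s) ^ 2 ∂μ)⁻¹

/-- The constant `c₂ = 2^{1/3} / (G_μ''(xstar)^{1/3} t_cr)`. -/
def airyScale (μ : Measure ℝ) (xstar : ℝ) : ℝ :=
  2 ^ (1 / 3 : ℝ) / (stieltjesDeriv μ 2 xstar ^ (1 / 3 : ℝ) * criticalTime μ xstar)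

/-- The rescaled time `t_cr + 2 τ / (c₂² n^{1/3})`. -/
def airyTime (μ : Measure ℝ) (xstar : ℝ) (n : ℕ) (τ : ℝ) : ℝ :=
  criticalTime μ xstar + 2 * τ / (airyScale μ xstar ^ 2 * (n : ℝ) ^ (1 / 3 : ℝ))

/-- The rescaling centre `xstar + t_n(τ) G_μ(xstar)`. -/
def airyCentre (μ : Measure ℝ) (xstar : ℝ) (n : ℕ) (τ : ℝ) : ℝ :=
  xstar + airyTime μ xstar n τ * stieltjesDeriv μ 0 xstar

/-- The logarithmic potential `g(z) = ∫ log (z - s) dμ_n(s)` (principal branch) of the empirical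
measure of `X`. -/
def logPotential {n : ℕ} (X : Fin n → ℝ) (z : ℂ) : ℂ :=
  ∫ s : ℝ, Complex.log (z - (s : ℂ)) ∂(empiricalMeasure X)

/-- A closed curve, parametrized by `[0, 1]`, with a bounded derivative that exists and is
continuous off a finite set. Every piecewise `C¹` closed curve is of this kind. -/
structure IsClosedCurve (γ : ℝ → ℂ) : Prop where
  continuousOn : ContinuousOn γ (Icc 0 1)
  closed : γ 0 = γ 1
  piecewise : ∃ S : Finset ℝ,
    (∀ t ∈ Ioo (0 : ℝ) 1 \ (S : Set ℝ), DifferentiableAt ℝ γ t) ∧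
    ContinuousOn (deriv γ) (Ioo (0 : ℝ) 1 \ (S : Set ℝ)) ∧
    ∃ B : ℝ, ∀ t ∈ Ioo (0 : ℝ) 1 \ (S : Set ℝ), ‖deriv γ t‖ ≤ B

/-- The contour integral `∫_Γ f(w) dw` over a finite union `Γ` of curves. -/
def contourIntegral {m : ℕ} (Γ : Fin m → ℝ → ℂ) (f : ℂ → ℂ) : ℂ :=
  ∑ k, ∫ t in (0 : ℝ)..1, f (Γ k t) * deriv (Γ k) t

/-- Admissible contours for the kernel: `Γ` is a finite union of closed curves that avoids the line
`x₀ + iℝ` and the points `Xⱼ`, and has winding number `1` around each `Xⱼ`. -/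
structure IsAdmissible {n : ℕ} (X : Fin n → ℝ) (x₀ : ℝ) {m : ℕ} (Γ : Fin m → ℝ → ℂ) : Prop where
  curves : ∀ k, IsClosedCurve (Γ k)
  avoids_line : ∀ k, ∀ t ∈ Icc (0 : ℝ) 1, (Γ k t).re ≠ x₀
  avoids_points : ∀ k, ∀ t ∈ Icc (0 : ℝ) 1, ∀ j, Γ k t ≠ (X j : ℂ)
  winding : ∀ j, contourIntegral Γ (fun w => 1 / (w - (X j : ℂ))) = 2 * Real.pi * Complex.I

/-- The correlation kernel `K_{n,s,t}(x, y)` of `n` non-intersecting Brownian motions (with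
diffusion coefficient `n^{-1/2}`) started at the points `Xⱼ`, as a double contour integral
over `z ∈ x₀ + iℝ` (upwards) and `w ∈ Γ`, minus the heat kernel if `s > t`. -/
def kernel {n : ℕ} (X : Fin n → ℝ) (x₀ : ℝ) {m : ℕ} (Γ : Fin m → ℝ → ℂ) (s t x y : ℝ) : ℂ :=
  (n : ℂ) / ((2 * Real.pi * Complex.I) ^ 2 * (Real.sqrt (s * t) : ℂ)) *
      (∫ η : ℝ, (fun z : ℂ => contourIntegral Γ (fun w : ℂ =>
        Complex.exp
          ((n : ℂ) / (2 * t) * ((z - y) ^ 2 + 2 * t * logPotential X z)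
            - (n : ℂ) / (2 * s) * ((w - x) ^ 2 + 2 * s * logPotential X w)) / (z - w)))
        ((x₀ : ℂ) + η * Complex.I) * Complex.I)
    - (if t < s then
        ((Real.sqrt n / Real.sqrt (2 * Real.pi * (s - t))
          * Real.exp (-((n : ℝ) / (2 * (s - t)) * (x - y) ^ 2)) : ℝ) : ℂ)
      else 0)

/-- The gauge factor `f_n(s, x) = -n G_μ(xstar) x + n G_μ(xstar)² s / 2`. -/
def gauge (μ : Measure ℝ) (xstar : ℝ) (n : ℕ) (s x : ℝ) : ℝ :=
  -(n * stieltjesDeriv μ 0 xstar * x) + n * stieltjesDeriv μ 0 xstar ^ 2 * s / 2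

/-- The conjugated kernel `K_{n,s,t}(x, y) exp (f_n(t, y) - f_n(s, x))`. -/
def gaugedKernel (μ : Measure ℝ) (xstar : ℝ) {n : ℕ} (X : Fin n → ℝ) (x₀ : ℝ) {m : ℕ}
    (Γ : Fin m → ℝ → ℂ) (s t x y : ℝ) : ℂ :=
  kernel X x₀ Γ s t x y * (Real.exp (gauge μ xstar n t y - gauge μ xstar n s x) : ℂ)

/-- The integral of `f` along the ray from `0` to `∞ e^{iθ}`. -/
def rayIntegral (θ : ℝ) (f : ℂ → ℂ) : ℂ :=
  ∫ r in Ioi (0 : ℝ), f (r * Complex.exp (θ * Complex.I)) * Complex.exp (θ * Complex.I)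

/-- The integral of `f` along the ray from `∞ e^{-iθ}` to `0` followed by the ray from `0` to
`∞ e^{iθ}`. -/
def wedgeIntegral (θ : ℝ) (f : ℂ → ℂ) : ℂ :=
  rayIntegral θ f - rayIntegral (-θ) f

/-- The extended Airy kernel. -/
def airyKernel (τ₁ τ₂ u v : ℝ) : ℂ :=
  1 / (2 * Real.pi * Complex.I) ^ 2 *
      wedgeIntegral (Real.pi / 3) (fun ζ => wedgeIntegral (2 * Real.pi / 3) (fun ω =>
        Complex.exp (ζ ^ 3 / 3 - ζ * v - τ₂ * ζ ^ 2 - ω ^ 3 / 3 + ω * u + τ₁ * ω ^ 2) / (ζ - ω)))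
    - (if τ₂ < τ₁ then
        ((1 / Real.sqrt (4 * Real.pi * (τ₁ - τ₂))
          * Real.exp (-((u - v) ^ 2 / (4 * (τ₁ - τ₂)))) : ℝ) : ℂ)
      else 0)

/-- Admissible contours exist for every configuration: a large circle to the left of the line. -/
theorem exists_isAdmissible {n : ℕ} (X : Fin n → ℝ) :
    ∃ (x₀ : ℝ) (Γ : Fin 1 → ℝ → ℂ), IsAdmissible X x₀ Γ := by
  obtain ⟨R, hR0, hR⟩ : ∃ R : ℝ, 0 < R ∧ ∀ j, |X j| < R := by
    refine ⟨1 + ∑ j, |X j|, ?_, fun j => ?_⟩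
    · have := Finset.sum_nonneg (s := Finset.univ) (fun j _ => abs_nonneg (X j))
      linarith
    · have := Finset.single_le_sum (f := fun j => |X j|) (fun j _ => abs_nonneg (X j))
        (Finset.mem_univ j)
      linarith
  have hd : ∀ t : ℝ, HasDerivAt (fun t : ℝ => circleMap 0 R (2 * Real.pi * t))
      (deriv (circleMap 0 R) (2 * Real.pi * t) * (2 * Real.pi : ℝ)) t := by
    intro t
    have h1 : HasDerivAt (fun t : ℝ => 2 * Real.pi * t) (2 * Real.pi) t := by
      simpa using (hasDerivAt_id t).const_mul (2 * Real.pi)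
    have h2 := (differentiable_circleMap 0 R (2 * Real.pi * t)).hasDerivAt
    have h3 := h2.scomp t h1
    have e : deriv (circleMap 0 R) (2 * Real.pi * t) * ((2 * Real.pi : ℝ) : ℂ)
        = (2 * Real.pi : ℝ) • deriv (circleMap 0 R) (2 * Real.pi * t) := by
      rw [Complex.real_smul, mul_comm]
    rw [e]
    exact h3
  have hnorm : ∀ t : ℝ, ‖circleMap 0 R (2 * Real.pi * t)‖ = R := by
    intro t
    simp [abs_of_pos hR0]
  have hderiv : deriv (fun t : ℝ => circleMap 0 R (2 * Real.pi * t)) =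
      fun t => deriv (circleMap 0 R) (2 * Real.pi * t) * (2 * Real.pi : ℝ) :=
    funext fun t => (hd t).deriv
  refine ⟨2 * R, fun _ t => circleMap 0 R (2 * Real.pi * t), ⟨fun _ => ⟨?_, ?_, ∅, ?_, ?_, ?_⟩,
    ?_, ?_, ?_⟩⟩
  · exact fun t _ => (hd t).continuousAt.continuousWithinAt
  · simp [circleMap]
  · exact fun t _ => (hd t).differentiableAt
  · rw [hderiv]
    simp only [deriv_circleMap]
    fun_prop
  · refine ⟨R * (2 * Real.pi), fun t _ => ?_⟩
    rw [hderiv]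
    simp [deriv_circleMap, abs_of_pos hR0, abs_of_pos Real.pi_pos]
  · intro _ t _ h
    have h1 := Complex.abs_re_le_norm (circleMap 0 R (2 * Real.pi * t))
    rw [hnorm, h, abs_of_pos (by linarith)] at h1
    linarith
  · intro _ t _ j h
    have h1 := hnorm t
    rw [h, Complex.norm_real, Real.norm_eq_abs] at h1
    linarith [hR j]
  · intro j
    have h1 := circleIntegral.integral_sub_inv_of_mem_ball (c := 0) (w := (X j : ℂ)) (R := R)
      (by simpa using hR j)
    rw [circleIntegral] at h1
    simp only [contourIntegral, Finset.univ_unique, Finset.sum_singleton, hderiv]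
    have h2 := intervalIntegral.smul_integral_comp_mul_left (a := 0) (b := 1)
      (fun θ => deriv (circleMap 0 R) θ • (circleMap 0 R θ - (X j : ℂ))⁻¹) (2 * Real.pi)
    simp only [mul_zero, mul_one] at h2
    rw [h1, ← intervalIntegral.integral_smul] at h2
    rw [← h2]
    congr 1
    ext t
    simp only [Complex.real_smul, smul_eq_mul]
    ring

end

end NIBM

namespace NIBM

noncomputable section

/-! Put `ζ = l (z - x*)` with `l = c₁ n^{1/3}` and `c₁³ = ∫ μ(ds)/(x*-s)³`. Then `exp (n g)` is a
polynomial with roots `l (X_j - x*)`. Up to constants that cancel against the gauge and the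
prefactor, the double integrand becomes `F(ζ) / (F'(ω) (ζ - ω))`, where `F` and `F'` have the form
`exp (k₀ + k₁ ζ + k₂ ζ²) ∏ (1 + b_j ζ)` with `b_j = -1/(l (X_j - x*))`. The power sums of the `b_j`
are scaled empirical inverse moments. The scaling is made so that, near the critical time, `log F =
ζ³/3 - τ ζ² - v ζ` with an error `200 K (1+|ζ|)⁴`, where `K` is of order `n^{-2ε}`
(`CubicApprox.exists_eq_mul_exp`). Replacing `F` by the pure cubic exponential yields the Airy
kernel.

The size of `K` comes from the initial data (`exists_abs_mean_sidePow_sub_le`,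
`cubicApprox_of_moments`). Cut at the gap radius `n^{-1/(κ+1)}`: outside, rigidity compares the
inverse moments of order `j ≤ 3`; inside, the vanishing density makes the contribution of `μ` small.
Both errors are of order `n^{-1+j/(κ+1)}`.

The contours are arbitrary, so they are first normalised. An integral along closed curves is treated
as a linear functional that kills derivatives (`IsLoop`). Such a functional is determined on
rational-type integrands by its winding numbers (`IsLoop.eq_zero_of_residues`). The `ω`-loop may
then be replaced by two unbounded graphs, one around the points left of `x*` and one around those to
the right (`IsLoop.eq_fullInt_sub`). A divided difference of the polynomial shows that the inner
integral contributes only a polynomial in `ζ`, so the `ζ`-line can be moved to `Re ζ = R` without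
residues (`IsLoop.integral_line_eq`).

On these contours the line `Re ζ = R` and the left graph, which stays in `Re ω ≤ -R`, produce the
factor `exp (-R (u+v))`. The right graph crosses the axis at `r = n^ε` and contributes only `exp
(-r³/6)`. Far from the origin the cubic approximation is too weak. There the decay comes from an
exact lower bound for `log |F|` along rays, with nonnegative slope and uniformly positive curvature
(`CubicApprox.le_norm_ray`). Combining these bounds gives `CubicApprox.norm_double_integral_sub_le`.
The Airy wedges are moved to the same contours by `airy_double_integral_eq`, and the heat kernel
parts agree exactly (`gauged_heat_eq`). -/

/-! ### Loop functionals and a residue theorem for them. -/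

/-- A functional on functions on the set `K` that behaves like the integral along a closed curve
in `K`: it is linear on continuous functions and kills derivatives. -/
structure IsLoop (J : (ℂ → ℂ) → ℂ) (K : Set ℂ) : Prop where
  add : ∀ f g : ℂ → ℂ, ContinuousOn f K → ContinuousOn g K →
    J (fun w => f w + g w) = J f + J g
  smul : ∀ (c : ℂ) (f : ℂ → ℂ), ContinuousOn f K → J (fun w => c * f w) = c * J f
  congr : ∀ f g : ℂ → ℂ, EqOn f g K → J f = J g
  exact : ∀ f F : ℂ → ℂ, ContinuousOn f K → (∀ z ∈ K, HasDerivAt F (f z) z) → J f = 0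

theorem IsLoop.sub {J₁ J₂ : (ℂ → ℂ) → ℂ} {K₁ K₂ : Set ℂ} (h₁ : IsLoop J₁ K₁)
    (h₂ : IsLoop J₂ K₂) : IsLoop (fun f => J₁ f - J₂ f) (K₁ ∪ K₂) where
  add f g hf hg := by
    rw [h₁.add f g (hf.mono subset_union_left) (hg.mono subset_union_left),
      h₂.add f g (hf.mono subset_union_right) (hg.mono subset_union_right)]
    ring
  smul c f hf := by
    rw [h₁.smul c f (hf.mono subset_union_left), h₂.smul c f (hf.mono subset_union_right)]
    ring
  congr f g h := by
    rw [h₁.congr f g (h.mono subset_union_left), h₂.congr f g (h.mono subset_union_right)]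
  exact f F hf hF := by
    rw [h₁.exact f F (hf.mono subset_union_left) fun z hz => hF z (Or.inl hz),
      h₂.exact f F (hf.mono subset_union_right) fun z hz => hF z (Or.inr hz), sub_zero]

/-- The leading factor `l` is the Jacobian; it makes the chain rule carry primitives to primitives.
This passes from the original coordinates to the Airy scaling. -/
theorem IsLoop.comp_affine {J : (ℂ → ℂ) → ℂ} {K : Set ℂ} (h : IsLoop J K) (l x : ℂ) :
    IsLoop (fun f => J (fun w => l * f (l * (w - x)))) ((fun w => l * (w - x)) '' K) := by
  have hc : ContinuousOn (fun w : ℂ => l * (w - x)) K := by fun_prop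
  have hm : MapsTo (fun w : ℂ => l * (w - x)) K ((fun w => l * (w - x)) '' K) := mapsTo_image _ _
  have hcomp : ∀ f : ℂ → ℂ, ContinuousOn f ((fun w => l * (w - x)) '' K) →
      ContinuousOn (fun w => l * f (l * (w - x))) K := fun f hf =>
    continuousOn_const.mul (hf.comp hc hm)
  refine ⟨fun f g hf hg => ?_, fun c f hf => ?_, fun f g hfg => ?_, fun f F hf hF => ?_⟩
  · rw [← h.add _ _ (hcomp f hf) (hcomp g hg)]
    congr 1; ext w; ring
  · rw [← h.smul _ _ (hcomp f hf)]
    congr 1; ext w; ring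
  · exact h.congr _ _ fun w hw => by simp only [hfg (hm hw)]
  · refine h.exact _ (fun w => F (l * (w - x))) (hcomp f hf) fun z hz => ?_
    have h1 : HasDerivAt (fun w : ℂ => l * (w - x)) l z := by
      simpa using ((hasDerivAt_id z).sub_const x).const_mul l
    rw [mul_comm]
    exact (hF _ (hm hz)).comp z h1

/-- The monic polynomial function with the given list of roots. -/
def rootProd (l : List ℂ) (w : ℂ) : ℂ := (l.map fun a => w - a).prod

theorem rootProd_cons (a : ℂ) (l : List ℂ) (w : ℂ) :
    rootProd (a :: l) w = (w - a) * rootProd l w := by simp [rootProd]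

theorem differentiable_rootProd (l : List ℂ) : Differentiable ℂ (rootProd l) := by
  induction l with
  | nil =>
    have : rootProd [] = fun _ => 1 := by ext; simp [rootProd]
    rw [this]
    exact differentiable_const 1
  | cons a l ih =>
    have : rootProd (a :: l) = fun w => (w - a) * rootProd l w := funext (rootProd_cons a l)
    rw [this]
    exact (differentiable_id.sub_const a).mul ih

theorem rootProd_ne_zero {l : List ℂ} {w : ℂ} (h : w ∉ l) : rootProd l w ≠ 0 := by
  rw [rootProd, Ne, List.prod_eq_zero_iff]
  simp only [List.mem_map, not_exists, not_and]
  intro a ha h0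
  exact h (by rwa [sub_eq_zero.1 h0])

theorem rootProd_eq_pow_mul (a : ℂ) (l : List ℂ) : ∃ k : ℕ, ∀ w : ℂ,
    rootProd l w = (w - a) ^ k * rootProd (l.filter (· ≠ a)) w := by
  induction l with
  | nil => exact ⟨0, fun w => by simp⟩
  | cons b l ih =>
    obtain ⟨k, hk⟩ := ih
    by_cases hb : b = a
    · refine ⟨k + 1, fun w => ?_⟩
      rw [rootProd_cons, hk w, hb, List.filter_cons_of_neg (by simp)]
      ring
    · refine ⟨k, fun w => ?_⟩
      rw [rootProd_cons, hk w, List.filter_cons_of_pos (by simpa using hb), rootProd_cons]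
      ring

/-- Every pole of order at least two has a single-valued primitive, so only the simple pole needs
the hypothesis. -/
theorem IsLoop.inv_pow_eq_zero {J : (ℂ → ℂ) → ℂ} {K : Set ℂ} (h : IsLoop J K) {a : ℂ}
    (ha : a ∉ K) (h1 : J (fun w => (w - a)⁻¹) = 0) (k : ℕ) :
    J (fun w => ((w - a) ^ (k + 1))⁻¹) = 0 := by
  rcases k with _ | k
  · simpa using h1
  · have hne : ∀ z ∈ K, z - a ≠ 0 := fun z hz h0 => ha (by rwa [← sub_eq_zero.1 h0])
    refine h.exact _ (fun w => -((k : ℂ) + 1)⁻¹ * ((w - a) ^ (k + 1))⁻¹) ?_ fun z hz => ?_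
    · exact ContinuousOn.inv₀ (by fun_prop) fun z hz => pow_ne_zero _ (hne z hz)
    · have h2 : HasDerivAt (fun w : ℂ => (w - a) ^ (k + 1)) (((k + 1 : ℕ) : ℂ) *
          (z - a) ^ k * 1) z := by
        simpa using ((hasDerivAt_id z).sub_const a).fun_pow (k + 1)
      have h3 := (h2.fun_inv (pow_ne_zero _ (hne z hz))).const_mul (-((k : ℂ) + 1)⁻¹)
      refine h3.congr_deriv ?_
      have hk : ((k : ℂ) + 1) ≠ 0 := by exact_mod_cast Nat.succ_ne_zero k
      have := hne z hz
      push_cast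
      field_simp
      ring

/-- Partial fractions, one root at a time: writing `g = g(a) + (w - a) · dslope g a` cancels a root
in the second term, so modulo the induction hypothesis only the value `g(a)` matters. Roots may be
repeated, since nothing forces the starting points to be distinct. -/
theorem IsLoop.eq_zero_of_residues {J : (ℂ → ℂ) → ℂ} {K : Set ℂ} (h : IsLoop J K) (l : List ℂ)
    (hl : ∀ a ∈ l, a ∉ K) (h1 : ∀ a ∈ l, J (fun w => (w - a)⁻¹) = 0) (f : ℂ → ℂ)
    (hf : Differentiable ℂ f) : J (fun w => f w * (rootProd l w)⁻¹) = 0 := by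
  induction l generalizing f with
  | nil =>
    obtain ⟨F, hF⟩ := hf.isExactOn_univ
    refine h.exact _ F ?_ fun z _ => ?_
    · simpa [rootProd] using hf.continuous.continuousOn
    · simpa [rootProd] using hF z (mem_univ z)
  | cons a l ih =>
    have ih := ih (fun b hb => hl b (List.mem_cons_of_mem _ hb))
      (fun b hb => h1 b (List.mem_cons_of_mem _ hb))
    have hne : ∀ l' : List ℂ, (∀ b ∈ l', b ∈ a :: l) → ∀ w ∈ K, rootProd l' w ≠ 0 :=
      fun l' hl' w hw => rootProd_ne_zero fun hwl => hl w (hl' w hwl) hw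
    have hd : ∀ g : ℂ → ℂ, Differentiable ℂ g → Differentiable ℂ (dslope g a) := fun g hg => by
      rw [← differentiableOn_univ] at hg ⊢
      exact (Complex.differentiableOn_dslope univ_mem).2 hg
    have hc : ∀ l' : List ℂ, (∀ b ∈ l', b ∈ a :: l) →
        ContinuousOn (fun w => (rootProd l' w)⁻¹) K := fun l' hl' =>
      (differentiable_rootProd l').continuous.continuousOn.inv₀ (hne l' hl')
    have key : ∀ g : ℂ → ℂ, Differentiable ℂ g →
        J (fun w => g w * (rootProd (a :: l) w)⁻¹)
          = g a * J (fun w => (rootProd (a :: l) w)⁻¹) := by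
      intro g hg
      rw [← add_zero (g a * _), ← ih _ (hd g hg), ← h.smul _ _ (hc _ fun b hb => hb), ← h.add]
      · refine h.congr _ _ fun w hw => ?_
        have h2 : w - a ≠ 0 := fun h0 => hl a List.mem_cons_self (by rwa [← sub_eq_zero.1 h0])
        have h3 := hne l (fun b hb => List.mem_cons_of_mem _ hb) w hw
        have h4 := sub_smul_dslope g a w
        rw [smul_eq_mul] at h4
        have h5 : g w = g a + (w - a) * dslope g a w := by rw [h4]; ring
        simp only [rootProd_cons]
        rw [h5]
        field_simp
      · exact continuousOn_const.mul (hc _ fun b hb => hb)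
      · exact ((hd g hg).continuous.continuousOn).mul
          (hc _ fun b hb => List.mem_cons_of_mem _ hb)
    obtain ⟨k, hk⟩ := rootProd_eq_pow_mul a l
    have hsub : ∀ b ∈ l.filter (· ≠ a), b ∈ a :: l := fun b hb =>
      List.mem_cons_of_mem _ (List.mem_of_mem_filter hb)
    -- Testing with the product over the roots different from `a` leaves a pure power of `(w -
    -- a)⁻¹`, on which the functional vanishes. Since that product is nonzero at `a`, the functional
    -- vanishes on the reciprocal of the full product.
    have h0 := key _ (differentiable_rootProd (l.filter (· ≠ a)))
    rw [h.congr _ (fun w => ((w - a) ^ (k + 1))⁻¹), h.inv_pow_eq_zero (hl a List.mem_cons_self)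
      (h1 a List.mem_cons_self)] at h0
    · have h2 : rootProd (l.filter (· ≠ a)) a ≠ 0 := rootProd_ne_zero (by simp)
      rw [key f hf, (mul_eq_zero.1 h0.symm).resolve_left h2, mul_zero]
    · intro w hw
      have h3 := hne _ hsub w hw
      simp only
      rw [rootProd_cons, hk w]
      have h2 : w - a ≠ 0 := fun h0 => hl a List.mem_cons_self (by rwa [← sub_eq_zero.1 h0])
      field_simp
      ring

/-! ### Divided differences of polynomials. -/

/-- The divided difference `(Q z - Q w) / (z - w)` of the polynomial with the given roots. -/
def rootProdDiv : List ℂ → ℂ → ℂ → ℂ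
  | [], _, _ => 0
  | a :: l, z, w => (z - a) * rootProdDiv l z w + rootProd l w

theorem rootProdDiv_mul_sub (l : List ℂ) (z w : ℂ) :
    rootProdDiv l z w * (z - w) = rootProd l z - rootProd l w := by
  induction l with
  | nil => simp [rootProdDiv, rootProd]
  | cons a l ih =>
    rw [rootProd_cons, rootProd_cons, rootProdDiv, add_mul, mul_assoc, ih]
    ring

theorem differentiable_rootProdDiv (l : List ℂ) (z : ℂ) :
    Differentiable ℂ (rootProdDiv l z) := by
  induction l with
  | nil => exact differentiable_const (0 : ℂ)
  | cons a l ih =>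
    have : rootProdDiv (a :: l) z = fun w => (z - a) * rootProdDiv l z w + rootProd l w := rfl
    rw [this]
    exact (ih.const_mul _).add (differentiable_rootProd l)

/-- The recursion for `rootProdDiv` multiplies by `z - a` and adds a term free of `z`, so the loop
integrals enter only as coefficients. This is what later lets the `z`-line cross the loop. -/
theorem IsLoop.exists_polynomial {J : (ℂ → ℂ) → ℂ} {K : Set ℂ} (h : IsLoop J K) (l : List ℂ)
    (H : ℂ → ℂ) (hH : ContinuousOn H K) :
    ∃ p : Polynomial ℂ, ∀ z, J (fun w => H w * rootProdDiv l z w) = p.eval z := by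
  induction l with
  | nil =>
    refine ⟨0, fun z => ?_⟩
    have := h.smul 0 H hH
    simpa [rootProdDiv] using this
  | cons a l ih =>
    obtain ⟨p, hp⟩ := ih
    refine ⟨(Polynomial.X - Polynomial.C a) * p +
      Polynomial.C (J fun w => H w * rootProd l w), fun z => ?_⟩
    have hc1 : ContinuousOn (fun w => H w * rootProdDiv l z w) K :=
      hH.mul (differentiable_rootProdDiv l z).continuous.continuousOn
    have hc2 : ContinuousOn (fun w => H w * rootProd l w) K :=
      hH.mul (differentiable_rootProd l).continuous.continuousOn
    simp only [Polynomial.eval_add, Polynomial.eval_mul, Polynomial.eval_sub, Polynomial.eval_X,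
      Polynomial.eval_C]
    rw [← hp, ← h.smul _ _ hc1, ← h.add (fun w => (z - a) * (H w * rootProdDiv l z w)) _
      (continuousOn_const.mul hc1) hc2]
    refine h.congr _ _ fun w _ => ?_
    simp only [rootProdDiv]
    ring

/-! ### Primitives on half-planes. -/

/-- Discs tangent to the boundary line at `c` exhaust the half-plane, and holomorphic functions on a
disc have primitives. The disc of radius `R` is `‖w - c‖² < 2R (Re w - c)`, so `R` only has to beat
the ratio of the largest `‖w - c‖²` to the smallest `Re w - c` on the compact set. -/
theorem exists_primitive_of_isCompact_of_lt_re {f : ℂ → ℂ} {c : ℝ}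
    (hf : DifferentiableOn ℂ f {w | c < w.re}) {K : Set ℂ} (hK : IsCompact K)
    (hKc : ∀ w ∈ K, c < w.re) : ∃ F : ℂ → ℂ, ∀ z ∈ K, HasDerivAt F (f z) z := by
  rcases K.eq_empty_or_nonempty with rfl | hne
  · exact ⟨0, fun z hz => hz.elim⟩
  obtain ⟨w₀, hw₀, hmin⟩ := hK.exists_isMinOn hne Complex.continuous_re.continuousOn
  obtain ⟨M, hM⟩ := (hK.image (f := fun w : ℂ => ‖w - c‖ ^ 2) (by fun_prop)).bddAbove
  set d := w₀.re - c with hd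
  have hd0 : 0 < d := sub_pos.2 (hKc _ hw₀)
  set R := (|M| + 1) / d with hR
  have hR0 : 0 < R := by positivity
  have hball : ∀ w : ℂ, w ∈ Metric.ball ((c + R : ℝ) : ℂ) R ↔
      ‖w - c‖ ^ 2 < 2 * R * (w.re - c) := by
    intro w
    rw [mem_ball_iff_norm, ← sq_lt_sq₀ (norm_nonneg _) hR0.le, ← Complex.normSq_eq_norm_sq,
      ← Complex.normSq_eq_norm_sq, Complex.normSq_apply, Complex.normSq_apply]
    simp only [Complex.sub_re, Complex.sub_im, Complex.ofReal_re, Complex.ofReal_im]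
    constructor <;> intro h <;> nlinarith
  have hsub : Metric.ball ((c + R : ℝ) : ℂ) R ⊆ {w | c < w.re} := by
    intro w hw
    rw [hball] at hw
    have : 0 < 2 * R * (w.re - c) := lt_of_le_of_lt (by positivity) hw
    have := (mul_pos_iff_of_pos_left (by positivity)).1 this
    show c < w.re
    linarith
  obtain ⟨F, hF⟩ := (hf.mono hsub).isExactOn_ball
  refine ⟨F, fun z hz => hF z ?_⟩
  rw [hball]
  have h1 : ‖z - c‖ ^ 2 ≤ M := hM ⟨z, hz, rfl⟩
  have h2 : d ≤ z.re - c := sub_le_sub_right (hmin hz) _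
  have h3 : R * d = |M| + 1 := by rw [hR]; field_simp
  nlinarith [le_abs_self M, abs_nonneg M, mul_le_mul_of_nonneg_left h2 hR0.le]

theorem exists_primitive_of_isCompact_of_re_lt {f : ℂ → ℂ} {c : ℝ}
    (hf : DifferentiableOn ℂ f {w | w.re < c}) {K : Set ℂ} (hK : IsCompact K)
    (hKc : ∀ w ∈ K, w.re < c) : ∃ F : ℂ → ℂ, ∀ z ∈ K, HasDerivAt F (f z) z := by
  obtain ⟨F, hF⟩ := exists_primitive_of_isCompact_of_lt_re (f := fun w => f (-w)) (c := -c)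
    (K := (fun w => -w) '' K)
    (hf.comp differentiable_id.neg.differentiableOn fun w (hw : -c < w.re) => by
      show (-w).re < c
      rw [Complex.neg_re]; linarith)
    (hK.image continuous_neg) (by
      rintro _ ⟨w, hw, rfl⟩
      simpa using hKc w hw)
  refine ⟨fun w => -F (-w), fun z hz => ?_⟩
  have h1 := ((hF (-z) ⟨z, hz, rfl⟩).comp z (hasDerivAt_neg z)).fun_neg
  simpa [Function.comp_def] using h1


/-! ### Paths and contour integrals as loop functionals. -/

/-- A path on `[a, b]` with velocity `γ'` off a countable set. -/
structure IsPath (γ γ' : ℝ → ℂ) (a b : ℝ) : Prop where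
  le : a ≤ b
  continuousOn : ContinuousOn γ (Icc a b)
  measurable : Measurable γ'
  piecewise : ∃ S : Set ℝ, S.Countable ∧ (∀ t ∈ Ioo a b \ S, HasDerivAt γ (γ' t) t) ∧
    ∃ B : ℝ, ∀ t ∈ Ioo a b \ S, ‖γ' t‖ ≤ B

theorem IsPath.intervalIntegrable {γ γ' : ℝ → ℂ} {a b : ℝ} (h : IsPath γ γ' a b) {f : ℂ → ℂ}
    (hf : ContinuousOn f (γ '' Icc a b)) :
    IntervalIntegrable (fun t => f (γ t) * γ' t) volume a b := by
  obtain ⟨S, hS, -, B, hB⟩ := h.piecewise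
  have hc : ContinuousOn (fun t => f (γ t)) (Icc a b) :=
    hf.comp h.continuousOn (mapsTo_image _ _)
  rw [intervalIntegrable_iff_integrableOn_Ioo_of_le h.le]
  have h1 : IntegrableOn (fun t => f (γ t)) (Ioo a b) :=
    (hc.integrableOn_Icc).mono_set Ioo_subset_Icc_self
  refine Integrable.mul_bdd (c := B) h1 h.measurable.aestronglyMeasurable ?_
  have h2 : ∀ᵐ t ∂(volume.restrict (Ioo a b)), t ∉ S :=
    ae_restrict_of_ae (hS.ae_notMem _)
  filter_upwards [h2, ae_restrict_mem measurableSet_Ioo] with t ht ht'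
  exact hB t ⟨ht', ht⟩

theorem IsPath.integral_eq_sub {γ γ' : ℝ → ℂ} {a b : ℝ} (h : IsPath γ γ' a b) {f F : ℂ → ℂ}
    (hf : ContinuousOn f (γ '' Icc a b)) (hF : ∀ z ∈ γ '' Icc a b, HasDerivAt F (f z) z) :
    ∫ t in a..b, f (γ t) * γ' t = F (γ b) - F (γ a) := by
  obtain ⟨S, hS, hd, -⟩ := h.piecewise
  refine integral_eq_of_hasDerivAt_off_countable_of_le (fun t => F (γ t)) _ h.le hS ?_ ?_
    (h.intervalIntegrable hf)
  · intro t ht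
    exact (hF _ ⟨t, ht, rfl⟩).continuousAt.comp_continuousWithinAt (h.continuousOn t ht)
  · intro t ht
    exact (hF _ ⟨t, Ioo_subset_Icc_self ht.1, rfl⟩).comp t (hd t ht)

theorem IsPath.add {γ γ' : ℝ → ℂ} {a b : ℝ} (h : IsPath γ γ' a b) {f g : ℂ → ℂ}
    (hf : ContinuousOn f (γ '' Icc a b)) (hg : ContinuousOn g (γ '' Icc a b)) :
    ∫ t in a..b, (f (γ t) + g (γ t)) * γ' t
      = (∫ t in a..b, f (γ t) * γ' t) + ∫ t in a..b, g (γ t) * γ' t := by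
  rw [← intervalIntegral.integral_add (h.intervalIntegrable hf) (h.intervalIntegrable hg)]
  simp only [add_mul]

theorem IsPath.congr {γ γ' : ℝ → ℂ} {a b : ℝ} (h : IsPath γ γ' a b) {f g : ℂ → ℂ}
    (hfg : EqOn f g (γ '' Icc a b)) :
    ∫ t in a..b, f (γ t) * γ' t = ∫ t in a..b, g (γ t) * γ' t := by
  refine intervalIntegral.integral_congr fun t ht => ?_
  rw [uIcc_of_le h.le] at ht
  simp only [hfg ⟨t, ht, rfl⟩]

theorem isLoop_of_isPath {γ γ' : ℝ → ℂ} {a b : ℝ} (h : IsPath γ γ' a b) (hc : γ a = γ b) :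
    IsLoop (fun f => ∫ t in a..b, f (γ t) * γ' t) (γ '' Icc a b) where
  add _ _ hf hg := h.add hf hg
  smul c f _ := by simp only [mul_assoc, intervalIntegral.integral_const_mul]
  congr _ _ hfg := h.congr hfg
  exact f F hf hF := by rw [h.integral_eq_sub hf hF, hc, sub_self]

theorem isLoop_sub_of_isPath {γ γ' η η' : ℝ → ℂ} {a b c d : ℝ} (h : IsPath γ γ' a b)
    (k : IsPath η η' c d) (ha : γ a = η c) (hb : γ b = η d) :
    IsLoop (fun f => (∫ t in a..b, f (γ t) * γ' t) - ∫ t in c..d, f (η t) * η' t)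
      (γ '' Icc a b ∪ η '' Icc c d) where
  add f g hf hg := by
    rw [h.add (hf.mono subset_union_left) (hg.mono subset_union_left),
      k.add (hf.mono subset_union_right) (hg.mono subset_union_right)]
    ring
  smul c f _ := by
    simp only [mul_assoc, intervalIntegral.integral_const_mul]
    ring
  congr f g hfg := by
    rw [h.congr (hfg.mono subset_union_left), k.congr (hfg.mono subset_union_right)]
  exact f F hf hF := by
    rw [h.integral_eq_sub (hf.mono subset_union_left) fun z hz => hF z (Or.inl hz),
      k.integral_eq_sub (hf.mono subset_union_right) fun z hz => hF z (Or.inr hz), ha, hb,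
      sub_self]

theorem isLoop_sum {m : ℕ} {J : Fin m → (ℂ → ℂ) → ℂ} {K : Fin m → Set ℂ}
    (h : ∀ k, IsLoop (J k) (K k)) : IsLoop (fun f => ∑ k, J k f) (⋃ k, K k) where
  add f g hf hg := by
    rw [← Finset.sum_add_distrib]
    exact Finset.sum_congr rfl fun k _ =>
      (h k).add f g (hf.mono (subset_iUnion K k)) (hg.mono (subset_iUnion K k))
  smul c f hf := by
    rw [Finset.mul_sum]
    exact Finset.sum_congr rfl fun k _ => (h k).smul c f (hf.mono (subset_iUnion K k))
  congr f g hfg := Finset.sum_congr rfl fun k _ => (h k).congr f g (hfg.mono (subset_iUnion K k))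
  exact f F hf hF := Finset.sum_eq_zero fun k _ =>
    (h k).exact f F (hf.mono (subset_iUnion K k)) fun z hz => hF z (mem_iUnion_of_mem k hz)

theorem IsClosedCurve.isPath {γ : ℝ → ℂ} (h : IsClosedCurve γ) : IsPath γ (deriv γ) 0 1 := by
  obtain ⟨S, hd, -, hB⟩ := h.piecewise
  exact ⟨zero_le_one, h.continuousOn, measurable_deriv γ, S, S.countable_toSet,
    fun t ht => (hd t ht).hasDerivAt, hB⟩

/-- The union of the traces of the curves. -/
def trace {m : ℕ} (Γ : Fin m → ℝ → ℂ) : Set ℂ := ⋃ k, Γ k '' Icc 0 1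

theorem isLoop_contourIntegral {m : ℕ} {Γ : Fin m → ℝ → ℂ} (h : ∀ k, IsClosedCurve (Γ k)) :
    IsLoop (contourIntegral Γ) (trace Γ) :=
  isLoop_sum fun k => isLoop_of_isPath (h k).isPath (h k).closed

/-- The integral of a function that is holomorphic off a vertical line, along closed curves
that avoid the line, vanishes. -/
theorem contourIntegral_eq_zero_of_differentiableOn {m : ℕ} {Γ : Fin m → ℝ → ℂ}
    (h : ∀ k, IsClosedCurve (Γ k)) {x₀ : ℝ} (hx : ∀ k, ∀ t ∈ Icc (0 : ℝ) 1, (Γ k t).re ≠ x₀)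
    {f : ℂ → ℂ} (hf : ∀ w : ℂ, w.re ≠ x₀ → DifferentiableAt ℂ f w) :
    contourIntegral Γ f = 0 := by
  refine Finset.sum_eq_zero fun k _ => ?_
  have hK : IsCompact (Γ k '' Icc 0 1) := isCompact_Icc.image_of_continuousOn (h k).continuousOn
  have hfc : ContinuousOn f (Γ k '' Icc 0 1) := by
    rintro _ ⟨t, ht, rfl⟩
    exact (hf _ (hx k t ht)).continuousAt.continuousWithinAt
  have hre : ContinuousOn (fun t => (Γ k t).re) (Icc 0 1) :=
    Complex.continuous_re.comp_continuousOn (h k).continuousOn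
  have hside : (∀ t ∈ Icc (0 : ℝ) 1, x₀ < (Γ k t).re) ∨ ∀ t ∈ Icc (0 : ℝ) 1, (Γ k t).re < x₀ := by
    by_contra! hcon
    obtain ⟨⟨t, ht, h1⟩, ⟨s, hs, h2⟩⟩ := hcon
    obtain ⟨r, hr, h3⟩ := isPreconnected_Icc.intermediate_value ht hs hre ⟨h1, h2⟩
    exact hx k r hr h3
  obtain ⟨F, hF⟩ : ∃ F : ℂ → ℂ, ∀ z ∈ Γ k '' Icc 0 1, HasDerivAt F (f z) z := by
    rcases hside with hs | hs
    · refine exists_primitive_of_isCompact_of_lt_re (c := x₀)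
        (fun w hw => (hf w (ne_of_gt hw)).differentiableWithinAt) hK ?_
      rintro _ ⟨t, ht, rfl⟩
      exact hs t ht
    · refine exists_primitive_of_isCompact_of_re_lt (c := x₀)
        (fun w hw => (hf w (ne_of_lt hw)).differentiableWithinAt) hK ?_
      rintro _ ⟨t, ht, rfl⟩
      exact hs t ht
  exact (isLoop_of_isPath (h k).isPath (h k).closed).exact f F hfc hF

/-! ### Unbounded contours as graphs over the imaginary axis. -/

/-- A graph over the imaginary axis, symmetric about the real axis: the vertical line through `a`
for `|Im| ≤ y₀`, continued by straight rays of slope `m`. -/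
structure VGraph where
  /-- the intersection with the real axis -/
  a : ℝ
  /-- the slope of the rays -/
  m : ℝ
  /-- the height at which the rays start -/
  y₀ : ℝ
  nonneg : 0 ≤ y₀

namespace VGraph

variable (g : VGraph)

/-- The real part at height `y`. -/
def x (y : ℝ) : ℝ := g.a + g.m * max (|y| - g.y₀) 0

/-- The curve. -/
def curve (y : ℝ) : ℂ := (g.x y : ℂ) + (y : ℂ) * Complex.I

/-- The derivative of the real part. -/
def dx (y : ℝ) : ℝ := if g.y₀ < y then g.m else if y < -g.y₀ then -g.m else 0

/-- The velocity of the curve. -/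
def vel (y : ℝ) : ℂ := (g.dx y : ℂ) + Complex.I

@[simp] theorem curve_re (y : ℝ) : (g.curve y).re = g.x y := by simp [curve]

@[simp] theorem curve_im (y : ℝ) : (g.curve y).im = y := by simp [curve]

@[simp] theorem x_neg (y : ℝ) : g.x (-y) = g.x y := by simp [x]

@[simp] theorem x_zero : g.x 0 = g.a := by
  have := g.nonneg
  simp [x, this]

theorem continuous_x : Continuous g.x := by unfold x; fun_prop

theorem continuous_curve : Continuous g.curve := by
  have := g.continuous_x
  unfold curve; fun_prop

theorem measurable_vel : Measurable g.vel := by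
  have : Measurable g.dx :=
    Measurable.ite measurableSet_Ioi measurable_const
      (Measurable.ite measurableSet_Iio measurable_const measurable_const)
  unfold vel; fun_prop

theorem norm_vel_le (y : ℝ) : ‖g.vel y‖ ≤ |g.m| + 1 := by
  refine (norm_add_le _ _).trans ?_
  have : |g.dx y| ≤ |g.m| := by
    unfold dx
    split_ifs
    · rfl
    · rw [abs_neg]
    · rw [abs_zero]; exact abs_nonneg _
  rw [Complex.norm_I, Complex.norm_real, Real.norm_eq_abs]
  gcongr

theorem hasDerivAt_x {y : ℝ} (h1 : y ≠ g.y₀) (h2 : y ≠ -g.y₀) : HasDerivAt g.x (g.dx y) y := by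
  have h0 := g.nonneg
  unfold dx
  rcases lt_or_gt_of_ne h1 with h1 | h1
  · rw [if_neg h1.not_gt]
    rcases lt_or_gt_of_ne h2 with h2 | h2
    · rw [if_pos h2]
      have : HasDerivAt (fun y : ℝ => g.a + g.m * (-y - g.y₀)) (-g.m) y := by
        simpa using (((hasDerivAt_id y).neg.sub_const g.y₀).const_mul g.m).const_add g.a
      refine this.congr_of_eventuallyEq ?_
      filter_upwards [Iio_mem_nhds h2] with z hz
      have hz : z < -g.y₀ := hz
      rw [x, abs_of_neg (by linarith), max_eq_left (by linarith)]
    · rw [if_neg h2.not_gt]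
      refine (hasDerivAt_const y g.a).congr_of_eventuallyEq ?_
      filter_upwards [Ioo_mem_nhds h2 h1] with z hz
      have : |z| < g.y₀ := abs_lt.2 hz
      rw [x, max_eq_right (by linarith), mul_zero, add_zero]
  · rw [if_pos h1]
    have : HasDerivAt (fun y : ℝ => g.a + g.m * (y - g.y₀)) g.m y := by
      simpa using (((hasDerivAt_id y).sub_const g.y₀).const_mul g.m).const_add g.a
    refine this.congr_of_eventuallyEq ?_
    filter_upwards [Ioi_mem_nhds h1] with z hz
    have hz : g.y₀ < z := hz
    rw [x, abs_of_pos (by linarith), max_eq_left (by linarith)]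

theorem hasDerivAt_curve {y : ℝ} (h1 : y ≠ g.y₀) (h2 : y ≠ -g.y₀) :
    HasDerivAt g.curve (g.vel y) y := by
  have h := (g.hasDerivAt_x h1 h2).ofReal_comp
  have h' := (hasDerivAt_id y).ofReal_comp.mul_const Complex.I
  have h3 := h.add h'
  simp only [id, Complex.ofReal_one, one_mul] at h3
  exact h3

theorem isPath {S : ℝ} (hS : 0 ≤ S) : IsPath g.curve g.vel (-S) S :=
  ⟨by linarith, g.continuous_curve.continuousOn, g.measurable_vel, {g.y₀, -g.y₀},
    (countable_singleton _).insert _, fun t ht => g.hasDerivAt_curve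
      (fun h => ht.2 (Or.inl h)) (fun h => ht.2 (Or.inr h)), _, fun t _ => g.norm_vel_le t⟩

/-- The integral along the part of the graph with imaginary part in `[-S, S]`, upwards. -/
def partialInt (S : ℝ) (f : ℂ → ℂ) : ℂ := ∫ y in (-S)..S, f (g.curve y) * g.vel y

/-- The integral along the graph, upwards. -/
def fullInt (f : ℂ → ℂ) : ℂ := ∫ y : ℝ, f (g.curve y) * g.vel y

/-- The truncated trace of the graph. -/
def part (S : ℝ) : Set ℂ := g.curve '' Icc (-S) S

theorem isCompact_part (S : ℝ) : IsCompact (g.part S) :=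
  isCompact_Icc.image g.continuous_curve

theorem partialInt_eq_sub {S : ℝ} (hS : 0 ≤ S) {f F : ℂ → ℂ} (hf : ContinuousOn f (g.part S))
    (hF : ∀ z ∈ g.part S, HasDerivAt F (f z) z) :
    g.partialInt S f = F (g.curve S) - F (g.curve (-S)) :=
  (g.isPath hS).integral_eq_sub hf hF

/-- The vertical line through `c`. -/
def vline (c : ℝ) : VGraph := ⟨c, 0, 0, le_rfl⟩

@[simp] theorem vline_x (c y : ℝ) : (vline c).x y = c := by simp [vline, x]

@[simp] theorem vline_vel (c y : ℝ) : (vline c).vel y = Complex.I := by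
  simp [vline, vel, dx]

theorem curve_eq_of_x_eq {g k : VGraph} {y : ℝ} (h : g.x y = k.x y) : g.curve y = k.curve y := by
  simp [curve, h]

theorem isLoop_sub {g k : VGraph} {S : ℝ} (hS : 0 ≤ S) (h : g.x S = k.x S) :
    IsLoop (fun f => g.partialInt S f - k.partialInt S f) (g.part S ∪ k.part S) :=
  isLoop_sub_of_isPath (g.isPath hS) (k.isPath hS) (curve_eq_of_x_eq (by simpa using h))
    (curve_eq_of_x_eq h)

theorem mem_part {S : ℝ} {z : ℂ} : z ∈ g.part S ↔ z.im ∈ Icc (-S) S ∧ z.re = g.x z.im := by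
  constructor
  · rintro ⟨y, hy, rfl⟩
    simpa using hy
  · rintro ⟨h1, h2⟩
    exact ⟨z.im, h1, Complex.ext (by simp [h2]) (by simp)⟩

theorem ofReal_notMem_part {b S : ℝ} (hb : b ≠ g.a) : (b : ℂ) ∉ g.part S := by
  rw [mem_part]
  rintro ⟨-, h⟩
  simp at h
  exact hb h

/-- The graph meets the real axis only at `g.a`, hence misses the ray `(-∞, b]`, and the principal
logarithm of `w - b` is a primitive along it. When `b` lies on the other side, `log (b - w)` plays
this role. -/
theorem partialInt_inv_sub_of_lt {b S : ℝ} (hS : 0 ≤ S) (hb : b < g.a) :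
    g.partialInt S (fun w => (w - b)⁻¹)
      = Complex.log (g.curve S - b) - Complex.log (g.curve (-S) - b) := by
  have hne : ∀ z ∈ g.part S, z - b ∈ Complex.slitPlane := by
    intro z hz
    rw [Complex.mem_slitPlane_iff]
    by_cases h : (z - b).im = 0
    · left
      have him : z.im = 0 := by simpa using h
      have := ((g.mem_part).1 hz).2
      rw [him, x_zero] at this
      simp [this, hb]
    · exact Or.inr h
  refine g.partialInt_eq_sub (F := fun w => Complex.log (w - b)) hS ?_ fun z hz => ?_
  · exact ContinuousOn.inv₀ (by fun_prop) fun z hz => Complex.slitPlane_ne_zero (hne z hz)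
  · simpa using ((hasDerivAt_id z).sub_const (b : ℂ)).clog (hne z hz)

theorem partialInt_inv_sub_of_gt {b S : ℝ} (hS : 0 ≤ S) (hb : g.a < b) :
    g.partialInt S (fun w => (w - b)⁻¹)
      = Complex.log (b - g.curve S) - Complex.log (b - g.curve (-S)) := by
  have hne : ∀ z ∈ g.part S, b - z ∈ Complex.slitPlane := by
    intro z hz
    rw [Complex.mem_slitPlane_iff]
    by_cases h : (b - z).im = 0
    · left
      have him : z.im = 0 := by simpa using h
      have := ((g.mem_part).1 hz).2
      rw [him, x_zero] at this
      simp [this, hb]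
    · exact Or.inr h
  have hne' : ∀ z ∈ g.part S, z - b ≠ 0 := fun z hz h0 =>
    Complex.slitPlane_ne_zero (hne z hz) (by rw [← neg_sub, h0, neg_zero])
  refine g.partialInt_eq_sub (F := fun w => Complex.log (b - w)) hS ?_ fun z hz => ?_
  · exact ContinuousOn.inv₀ (by fun_prop) hne'
  · refine (((hasDerivAt_id z).const_sub (b : ℂ)).clog (hne z hz)).congr_deriv ?_
    have h1 := hne' z hz
    have h2 := Complex.slitPlane_ne_zero (hne z hz)
    simp only [id]
    field_simp
    ring

theorem log_sub_log_neg {z : ℂ} (h : 0 < z.im) :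
    Complex.log z - Complex.log (-z) = Real.pi * Complex.I := by
  have h1 : Complex.arg (-z) = Complex.arg z - Real.pi := Complex.arg_neg_eq_arg_sub_pi_of_im_pos h
  rw [Complex.log, Complex.log, h1, norm_neg]
  push_cast
  ring

/-- The winding number of the loop between two graphs around a real point. -/
theorem loop_inv_sub {g k : VGraph} {S : ℝ} (hS : 0 < S) (h : g.x S = k.x S) {b : ℝ}
    (hg : b < g.a) (hk : k.a < b) :
    g.partialInt S (fun w => (w - b)⁻¹) - k.partialInt S (fun w => (w - b)⁻¹)
      = 2 * Real.pi * Complex.I := by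
  rw [partialInt_inv_sub_of_lt g hS.le hg, partialInt_inv_sub_of_gt k hS.le hk,
    ← curve_eq_of_x_eq h,
    ← (curve_eq_of_x_eq (by simp [h]) : g.curve (-S) = k.curve (-S))]
  -- The two branches `log (w - b)` and `log (b - w)` differ by `±πi` at the upper and lower
  -- endpoint; together this is the winding `2πi`.
  have h1 := log_sub_log_neg (z := g.curve S - b) (by simpa using hS)
  have h2 := log_sub_log_neg (z := b - g.curve (-S)) (by simpa using hS)
  rw [neg_sub] at h1 h2
  linear_combination h1 + h2

theorem loop_inv_sub_eq_zero {g k : VGraph} {S : ℝ} (hS : 0 < S) (h : g.x S = k.x S) {b : ℝ}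
    (hb : (b < g.a ∧ b < k.a) ∨ (g.a < b ∧ k.a < b)) :
    g.partialInt S (fun w => (w - b)⁻¹) - k.partialInt S (fun w => (w - b)⁻¹) = 0 := by
  have e1 := curve_eq_of_x_eq h
  have e2 := curve_eq_of_x_eq (y := -S) (g := g) (k := k) (by simpa using h)
  rcases hb with ⟨hg, hk⟩ | ⟨hg, hk⟩
  · rw [partialInt_inv_sub_of_lt g hS.le hg, partialInt_inv_sub_of_lt k hS.le hk, e1, e2, sub_self]
  · rw [partialInt_inv_sub_of_gt g hS.le hg, partialInt_inv_sub_of_gt k hS.le hk, e1, e2, sub_self]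

theorem integrable_of_bound {f : ℂ → ℂ} {b : ℝ → ℝ} (hf : Continuous fun y => f (g.curve y))
    (hb : Integrable b) (hfb : ∀ y, ‖f (g.curve y)‖ ≤ b y) :
    Integrable (fun y => f (g.curve y) * g.vel y) := by
  refine Integrable.mul_bdd (c := |g.m| + 1)
    (hb.mono' hf.aestronglyMeasurable (Eventually.of_forall hfb))
    g.measurable_vel.aestronglyMeasurable (Eventually.of_forall g.norm_vel_le)

theorem tendsto_partialInt {f : ℂ → ℂ} (hf : Integrable (fun y => f (g.curve y) * g.vel y)) :
    Tendsto (fun S => g.partialInt S f) atTop (𝓝 (g.fullInt f)) :=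
  intervalIntegral_tendsto_integral hf tendsto_neg_atTop_atBot tendsto_id

end VGraph


/-! ### Gaussian exponentials: shifting vertical lines and decay along graphs. -/

/-- The exponential of a real quadratic polynomial. -/
def quadExp (k₀ k₁ k₂ : ℝ) (w : ℂ) : ℂ := Complex.exp (k₀ + k₁ * w + k₂ * w ^ 2)

theorem differentiable_quadExp (k₀ k₁ k₂ : ℝ) : Differentiable ℂ (quadExp k₀ k₁ k₂) := by
  unfold quadExp; fun_prop

theorem norm_quadExp (k₀ k₁ k₂ : ℝ) (w : ℂ) :
    ‖quadExp k₀ k₁ k₂ w‖ = Real.exp (k₀ + k₁ * w.re + k₂ * (w.re ^ 2 - w.im ^ 2)) := by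
  rw [quadExp, Complex.norm_exp]
  congr 1
  simp [pow_two]

theorem quadExp_ne_zero (k₀ k₁ k₂ : ℝ) (w : ℂ) : quadExp k₀ k₁ k₂ w ≠ 0 := Complex.exp_ne_zero _

theorem quadExp_neg (k₀ k₁ k₂ : ℝ) (w : ℂ) :
    quadExp (-k₀) (-k₁) (-k₂) w = (quadExp k₀ k₁ k₂ w)⁻¹ := by
  rw [quadExp, quadExp, ← Complex.exp_neg]
  congr 1
  push_cast
  ring

theorem quadratic_ge {a : ℝ} (ha : 0 < a) (b c t : ℝ) :
    c - b ^ 2 / (4 * a) ≤ a * t ^ 2 + b * t + c := by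
  have h : a * t ^ 2 + b * t + c - (c - b ^ 2 / (4 * a)) = a * (t + b / (2 * a)) ^ 2 := by
    field_simp
    ring
  have := mul_nonneg ha.le (sq_nonneg (t + b / (2 * a)))
  linarith

theorem integral_vertical_line_eq {f : ℂ → ℂ} (hf : Differentiable ℂ f) {a b C c : ℝ} (hc : 0 < c)
    (hbd : ∀ x ∈ uIcc a b, ∀ y : ℝ, ‖f (x + y * Complex.I)‖ ≤ C * Real.exp (-c * y ^ 2)) :
    ∫ y : ℝ, f (a + y * Complex.I) = ∫ y : ℝ, f (b + y * Complex.I) := by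
  have hint : ∀ x ∈ uIcc a b, Integrable (fun y : ℝ => f (x + y * Complex.I)) := fun x hx =>
    ((integrable_exp_neg_mul_sq hc).const_mul C).mono'
      ((hf.continuous.comp (by fun_prop)).aestronglyMeasurable)
      (Eventually.of_forall (hbd x hx))
  have hlim : ∀ x ∈ uIcc a b, Tendsto (fun S : ℝ => ∫ y in (-S)..S, f (x + y * Complex.I)) atTop
      (𝓝 (∫ y : ℝ, f (x + y * Complex.I))) := fun x hx =>
    intervalIntegral_tendsto_integral (hint x hx) tendsto_neg_atTop_atBot tendsto_id
  have hedge : ∀ s : ℝ, s ^ 2 = 1 →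
      Tendsto (fun S : ℝ => ∫ x in a..b, f (x + (s * S : ℝ) * Complex.I)) atTop (𝓝 0) := by
    intro s hs
    have h0 : Tendsto (fun S : ℝ => C * Real.exp (-c * S ^ 2) * |b - a|) atTop
        (𝓝 (C * 0 * |b - a|)) := by
      refine ((Real.tendsto_exp_atBot.comp ?_).const_mul C).mul_const _
      exact (tendsto_pow_atTop two_ne_zero).const_mul_atTop_of_neg (by linarith)
    rw [mul_zero, zero_mul] at h0
    refine squeeze_zero_norm (fun S => ?_) h0
    refine intervalIntegral.norm_integral_le_of_norm_le_const fun x hx => ?_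
    refine (hbd x (uIoc_subset_uIcc hx) _).trans (le_of_eq ?_)
    rw [mul_pow, hs, one_mul]
  have hrect : ∀ S : ℝ, (∫ x in a..b, f (x + (-1 * S : ℝ) * Complex.I))
      - (∫ x in a..b, f (x + (1 * S : ℝ) * Complex.I))
      = Complex.I * (∫ y in (-S)..S, f (a + y * Complex.I))
        - Complex.I * (∫ y in (-S)..S, f (b + y * Complex.I)) := by
    intro S
    have h := Complex.integral_boundary_rect_eq_zero_of_differentiableOn f
      (a + (-S : ℝ) * Complex.I) (b + (S : ℝ) * Complex.I) hf.differentiableOn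
    simp only [Complex.add_re, Complex.ofReal_re, Complex.mul_re, Complex.I_re, mul_zero,
      Complex.ofReal_im, Complex.I_im, mul_one, sub_self, add_zero, Complex.add_im, Complex.mul_im,
      zero_add, smul_eq_mul] at h
    rw [neg_one_mul, one_mul]
    linear_combination h
  have h1 := (hedge (-1) (by norm_num)).sub (hedge 1 (by norm_num))
  simp only [hrect] at h1
  have h2 := ((hlim a left_mem_uIcc).const_mul Complex.I).sub
    ((hlim b right_mem_uIcc).const_mul Complex.I)
  have h3 := tendsto_nhds_unique h1 h2
  rw [sub_zero] at h3
  exact mul_left_cancel₀ Complex.I_ne_zero (sub_eq_zero.1 h3.symm)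

theorem exists_norm_eval_le (p : Polynomial ℂ) :
    ∃ C : ℝ, 0 ≤ C ∧ ∀ z, ‖p.eval z‖ ≤ C * Real.exp ‖z‖ := by
  refine ⟨∑ i ∈ Finset.range (p.natDegree + 1), ‖p.coeff i‖ * i.factorial,
    Finset.sum_nonneg fun i _ => by positivity, fun z => ?_⟩
  rw [Polynomial.eval_eq_sum_range, Finset.sum_mul]
  refine norm_sum_le_of_le _ fun i _ => ?_
  rw [norm_mul, norm_pow, mul_assoc]
  gcongr
  have := Real.pow_div_factorial_le_exp ‖z‖ (norm_nonneg z) i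
  rw [div_le_iff₀ (by positivity)] at this
  linarith

/-- On a vertical strip the quadratic exponential decays like `exp (-k₂ y²)`. Half of this decay
absorbs the polynomial, which is bounded by a multiple of `exp ‖z‖`, and the other half makes the
horizontal edges vanish. -/
theorem integral_quadExp_mul_eval_eq {k₀ k₁ k₂ : ℝ} (hk : 0 < k₂) (p : Polynomial ℂ) (a b : ℝ) :
    ∫ y : ℝ, quadExp k₀ k₁ k₂ (a + y * Complex.I) * p.eval (a + y * Complex.I)
      = ∫ y : ℝ, quadExp k₀ k₁ k₂ (b + y * Complex.I) * p.eval (b + y * Complex.I) := by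
  obtain ⟨C, hC, hp⟩ := exists_norm_eval_le p
  have hd : Differentiable ℂ fun z => quadExp k₀ k₁ k₂ z * p.eval z :=
    (differentiable_quadExp _ _ _).mul p.differentiable
  obtain ⟨B, hB⟩ := (isCompact_uIcc (a := a) (b := b)).bddAbove_image
    (f := fun x : ℝ => |x| + k₀ + k₁ * x + k₂ * x ^ 2) (by fun_prop)
  refine integral_vertical_line_eq (C := C * Real.exp (B + 1 / (2 * k₂))) hd (half_pos hk)
    fun x hx y => ?_
  rw [norm_mul, norm_quadExp]
  have h1 : ‖(x : ℂ) + y * Complex.I‖ ≤ |x| + |y| := by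
    refine (norm_add_le _ _).trans ?_
    simp
  have h2 : |x| + k₀ + k₁ * x + k₂ * x ^ 2 ≤ B := hB ⟨x, hx, rfl⟩
  have h3 := quadratic_ge (half_pos hk) (-1) 0 |y|
  rw [sq_abs] at h3
  have h4 : (-1 : ℝ) ^ 2 / (4 * (k₂ / 2)) = 1 / (2 * k₂) := by field_simp; norm_num
  calc _ ≤ Real.exp (k₀ + k₁ * x + k₂ * (x ^ 2 - y ^ 2)) * (C * Real.exp (|x| + |y|)) := by
        refine mul_le_mul (by simp) ((hp _).trans (by gcongr)) (norm_nonneg _) (Real.exp_pos _).le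
    _ = C * Real.exp (k₀ + k₁ * x + k₂ * (x ^ 2 - y ^ 2) + (|x| + |y|)) := by
        rw [Real.exp_add _ (|x| + |y|)]; ring
    _ ≤ C * Real.exp (B + 1 / (2 * k₂) + -(k₂ / 2) * y ^ 2) := by
        refine mul_le_mul_of_nonneg_left (Real.exp_le_exp.2 ?_) hC
        linarith
    _ = _ := by rw [Real.exp_add]; ring

namespace VGraph

variable (g : VGraph)

/-- The inverse integrand carries `exp (-k₂ w²)`, which grows on vertical lines. With slope `±√3`
the real part wins: `x² ≈ 3t²` against `y² ≈ t²`. The second height `y'` is there for the vertical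
segment through `g.x y` that closes the truncated contour. -/
theorem exists_norm_quadExp_le (hm : g.m ^ 2 = 3) (k₀ k₁ : ℝ) {k₂ : ℝ} (hk : 0 < k₂) :
    ∃ C : ℝ, 0 ≤ C ∧ ∀ y y' : ℝ, |y'| ≤ |y| →
      ‖quadExp k₀ k₁ (-k₂) (g.x y + y' * Complex.I)‖ ≤ C * Real.exp (-(k₂ / 2) * y ^ 2) := by
  set β := k₂ * (2 * g.a * g.m - 3 * g.y₀) - k₁ * g.m
  set γ := k₂ * (g.a ^ 2 - 3 / 2 * g.y₀ ^ 2) - k₁ * g.a - k₀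
  have ha : 0 < k₂ * (3 / 2) := by positivity
  refine ⟨Real.exp (-(γ - β ^ 2 / (4 * (k₂ * (3 / 2))))), (Real.exp_pos _).le, fun y y' hy => ?_⟩
  rw [norm_quadExp, ← Real.exp_add]
  simp only [Complex.add_re, Complex.ofReal_re, Complex.mul_re, Complex.I_re, mul_zero,
      Complex.ofReal_im, Complex.I_im, mul_one, sub_self, add_zero, Complex.add_im, Complex.mul_im,
      zero_add]
  refine Real.exp_le_exp.2 ?_
  set t := max (|y| - g.y₀) 0 with ht
  have hx : g.x y = g.a + g.m * t := rfl
  have h1 : |y| ≤ t + g.y₀ := by linarith [le_max_left (|y| - g.y₀) 0]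
  have h2 : y' ^ 2 ≤ y ^ 2 := sq_le_sq.2 hy
  have h3 : y ^ 2 ≤ (t + g.y₀) ^ 2 := by
    rw [← sq_abs y]
    exact pow_le_pow_left₀ (abs_nonneg y) h1 2
  have h4 := quadratic_ge ha β γ t
  have h5 : k₂ * y' ^ 2 ≤ k₂ * y ^ 2 := mul_le_mul_of_nonneg_left h2 hk.le
  have h6 : k₂ * y ^ 2 ≤ k₂ * (t + g.y₀) ^ 2 := mul_le_mul_of_nonneg_left h3 hk.le
  rw [hx]
  simp only [β, γ] at h4 ⊢
  have h7 : k₂ * (g.a + g.m * t) ^ 2 = k₂ * (g.a ^ 2 + 2 * g.a * g.m * t + 3 * t ^ 2) := by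
    rw [← hm]; ring
  nlinarith

theorem exists_le_norm_curve_sub {b : ℝ} (hb : b ≠ g.a) :
    ∃ d : ℝ, 0 < d ∧ ∀ y, d ≤ ‖g.curve y - b‖ := by
  obtain ⟨y₁, -, hmin⟩ := (isCompact_Icc (a := (-1 : ℝ)) (b := 1)).exists_isMinOn
    ⟨0, by simp⟩ (f := fun y => ‖g.curve y - b‖)
    ((g.continuous_curve.sub continuous_const).norm.continuousOn)
  have hpos : 0 < ‖g.curve y₁ - b‖ := by
    rw [norm_pos_iff, sub_ne_zero]
    intro h
    have h1 := congrArg Complex.im h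
    have h2 := congrArg Complex.re h
    simp at h1 h2
    rw [h1, x_zero] at h2
    exact hb h2.symm
  refine ⟨min ‖g.curve y₁ - b‖ 1, lt_min hpos one_pos, fun y => ?_⟩
  by_cases hy : y ∈ Icc (-1 : ℝ) 1
  · exact (min_le_left _ _).trans (hmin hy)
  · refine (min_le_right _ _).trans ?_
    have h1 : 1 ≤ |y| := by
      by_contra! h
      exact hy ⟨(abs_lt.1 h).1.le, (abs_lt.1 h).2.le⟩
    have h2 := Complex.abs_im_le_norm (g.curve y - b)
    simp at h2
    linarith

theorem exists_norm_inv_rootProd_le (ξ : List ℝ) (hξ : ∀ b ∈ ξ, b ≠ g.a) :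
    ∃ D : ℝ, 0 ≤ D ∧ ∀ y, ‖(rootProd (ξ.map (fun b : ℝ => (b : ℂ))) (g.curve y))⁻¹‖ ≤ D := by
  induction ξ with
  | nil => exact ⟨1, by norm_num, fun y => by simp [rootProd]⟩
  | cons b l ih =>
    obtain ⟨D, hD0, hD⟩ := ih fun c hc => hξ c (List.mem_cons_of_mem _ hc)
    obtain ⟨d, hd0, hd⟩ := g.exists_le_norm_curve_sub (hξ b List.mem_cons_self)
    refine ⟨d⁻¹ * D, by positivity, fun y => ?_⟩
    rw [List.map_cons, rootProd_cons, mul_inv, norm_mul, norm_inv]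
    gcongr
    · exact hd y
    · exact hD y

theorem norm_inv_rootProd_le_one (l : List ℂ) {w : ℂ} (h : ∀ a ∈ l, 1 ≤ ‖w - a‖) :
    ‖(rootProd l w)⁻¹‖ ≤ 1 := by
  induction l with
  | nil => simp [rootProd]
  | cons a l ih =>
    rw [rootProd_cons, mul_inv, norm_mul]
    refine mul_le_one₀ ?_ (norm_nonneg _) (ih fun c hc => h c (List.mem_cons_of_mem _ hc))
    rw [norm_inv]
    exact inv_le_one_of_one_le₀ (h a List.mem_cons_self)

theorem continuous_comp_curve {ξ : List ℝ} (hξ : ∀ b ∈ ξ, b ≠ g.a) {z : ℂ}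
    (hz : ∀ y, g.curve y ≠ z) (k₀ k₁ k₂ : ℝ) :
    Continuous fun y => quadExp k₀ k₁ k₂ (g.curve y)
      * (rootProd (ξ.map (fun b : ℝ => (b : ℂ))) (g.curve y))⁻¹ * (z - g.curve y)⁻¹ := by
  have hc := g.continuous_curve
  refine (((differentiable_quadExp _ _ _).continuous.comp hc).mul
    (((differentiable_rootProd _).continuous.comp hc).inv₀ fun y => ?_)).mul
    ((continuous_const.sub hc).inv₀ fun y h => hz y (sub_eq_zero.1 h).symm)
  refine rootProd_ne_zero fun h => ?_
  obtain ⟨b, hb, hbe⟩ := List.mem_map.1 h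
  have h1 := congrArg Complex.im hbe
  have h2 := congrArg Complex.re hbe
  simp at h1 h2
  rw [← h1, x_zero] at h2
  exact hξ b hb h2

/-- Quantitative decay of the integrand in the inner integral. -/
theorem exists_integrand_bound (hm : g.m ^ 2 = 3) {ξ : List ℝ} (hξ : ∀ b ∈ ξ, b ≠ g.a)
    (k₀ k₁ : ℝ) {k₂ : ℝ} (hk : 0 < k₂) {d : ℝ} (hd : 0 < d) :
    ∃ C : ℝ, 0 ≤ C ∧ ∀ z : ℂ, (∀ y, d ≤ ‖z - g.curve y‖) → ∀ y,
      ‖quadExp k₀ k₁ (-k₂) (g.curve y)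
        * (rootProd (ξ.map (fun b : ℝ => (b : ℂ))) (g.curve y))⁻¹ * (z - g.curve y)⁻¹‖
      ≤ C * Real.exp (-(k₂ / 2) * y ^ 2) := by
  obtain ⟨C, hC0, hC⟩ := g.exists_norm_quadExp_le hm k₀ k₁ hk
  obtain ⟨D, hD0, hD⟩ := g.exists_norm_inv_rootProd_le ξ hξ
  refine ⟨C * D * d⁻¹, by positivity, fun z hz y => ?_⟩
  rw [norm_mul, norm_mul, norm_inv (z - _)]
  calc _ ≤ (C * Real.exp (-(k₂ / 2) * y ^ 2)) * D * d⁻¹ := by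
        gcongr
        · exact hC y y le_rfl
        · exact hD y
        · exact hz y
    _ = _ := by ring

theorem tendsto_abs_x (hm : g.m ^ 2 = 3) : Tendsto (fun S => |g.x S|) atTop atTop := by
  have hm0 : 0 < |g.m| := abs_pos.2 fun h => by rw [h] at hm; norm_num at hm
  have h1 : Tendsto (fun S : ℝ => |g.m| * (S - g.y₀) - |g.a|) atTop atTop :=
    tendsto_atTop_add_const_right _ _
      ((tendsto_atTop_add_const_right _ _ tendsto_id).const_mul_atTop hm0)
  refine tendsto_atTop_mono' _ ?_ h1
  filter_upwards [eventually_ge_atTop g.y₀] with S hS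
  have hS0 : 0 ≤ S := g.nonneg.trans hS
  rw [x, abs_of_nonneg hS0, max_eq_left (by linarith)]
  have h2 : |g.m| * (S - g.y₀) = |g.m * (S - g.y₀)| := by
    rw [abs_mul, abs_of_nonneg (sub_nonneg.2 hS)]
  rw [h2]
  have := abs_sub_abs_le_abs_sub (g.m * (S - g.y₀)) (-g.a)
  rw [abs_neg, sub_neg_eq_add, add_comm (g.m * _)] at this
  exact this

/-- The closing segment has length `2S`, lies at distance at least one from all poles once `S` is
large, and its integrand is at most a multiple of `exp (-(k₂/2) S²)`. -/
theorem tendsto_vline_partialInt (hm : g.m ^ 2 = 3) (ξ : List ℝ) (z : ℂ) (k₀ k₁ : ℝ) {k₂ : ℝ}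
    (hk : 0 < k₂) :
    Tendsto (fun S => (vline (g.x S)).partialInt S (fun w => quadExp k₀ k₁ (-k₂) w
      * (rootProd (ξ.map (fun b : ℝ => (b : ℂ))) w)⁻¹ * (z - w)⁻¹)) atTop (𝓝 0) := by
  obtain ⟨C, hC0, hC⟩ := g.exists_norm_quadExp_le hm k₀ k₁ hk
  have hlim : Tendsto (fun S : ℝ => C * (2 * (S * Real.exp (-(k₂ / 2) * S ^ 2)))) atTop
      (𝓝 (C * (2 * 0))) := by
    refine (Tendsto.const_mul _ ?_).const_mul _
    have h1 := rexp_neg_quadratic_isLittleO_rpow_atTop (a := -(k₂ / 2)) (by linarith) 0 (-1)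
    have h2 := h1.tendsto_div_nhds_zero
    refine h2.congr' ?_
    filter_upwards [eventually_gt_atTop 0] with S hS
    rw [Real.rpow_neg_one, div_inv_eq_mul, zero_mul, add_zero, mul_comm]
  rw [mul_zero, mul_zero] at hlim
  have hfar : ∀ᶠ S in atTop, ∀ b ∈ z.re :: ξ, 1 ≤ |g.x S - b| := by
    induction z.re :: ξ with
    | nil => simp
    | cons b l ih =>
      filter_upwards [ih, (g.tendsto_abs_x hm).eventually_ge_atTop (1 + |b|)] with S h1 h2 c hc
      rcases List.mem_cons.1 hc with rfl | hc
      · linarith [abs_sub_abs_le_abs_sub (g.x S) c]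
      · exact h1 c hc
  refine squeeze_zero_norm' ?_ hlim
  filter_upwards [hfar, eventually_ge_atTop 0] with S hS hS0
  have hre : ∀ b : ℂ, ∀ y : ℝ, |g.x S - b.re| ≤ ‖(vline (g.x S)).curve y - b‖ := fun b y => by
    have := Complex.abs_re_le_norm ((vline (g.x S)).curve y - b)
    simpa using this
  have hb : ∀ y ∈ uIoc (-S) S, ‖quadExp k₀ k₁ (-k₂) ((vline (g.x S)).curve y)
      * (rootProd (ξ.map (fun b : ℝ => (b : ℂ))) ((vline (g.x S)).curve y))⁻¹
      * (z - (vline (g.x S)).curve y)⁻¹ * (vline (g.x S)).vel y‖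
      ≤ C * Real.exp (-(k₂ / 2) * S ^ 2) := by
    intro y hy
    rw [uIoc_of_le (by linarith)] at hy
    have hy' : |y| ≤ |S| := by
      rw [abs_of_nonneg hS0]
      exact abs_le.2 ⟨hy.1.le, hy.2⟩
    have e1 := hC S y hy'
    have e2 : ‖(rootProd (ξ.map (fun b : ℝ => (b : ℂ))) ((vline (g.x S)).curve y))⁻¹‖ ≤ 1 := by
      refine norm_inv_rootProd_le_one _ fun a ha => ?_
      obtain ⟨b, hb, rfl⟩ := List.mem_map.1 ha
      exact (hS b (List.mem_cons_of_mem _ hb)).trans (by simpa using hre b y)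
    have e3 : ‖(z - (vline (g.x S)).curve y)⁻¹‖ ≤ 1 := by
      rw [norm_inv, norm_sub_rev]
      exact inv_le_one_of_one_le₀ ((hS z.re List.mem_cons_self).trans (hre z y))
    have e4 : (vline (g.x S)).curve y = g.x S + y * Complex.I := by simp [curve]
    rw [vline_vel, norm_mul, norm_mul, norm_mul, Complex.norm_I, mul_one]
    calc _ ≤ (C * Real.exp (-(k₂ / 2) * S ^ 2)) * 1 * 1 := by
          gcongr
          rw [e4]
          exact e1
      _ = _ := by ring
  refine (intervalIntegral.norm_integral_le_of_norm_le_const hb).trans (le_of_eq ?_)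
  rw [sub_neg_eq_add, ← two_mul, abs_of_nonneg (by linarith)]
  ring

end VGraph


/-! ### Replacing an arbitrary loop by two unbounded graphs. -/

/-- The polynomial function with the given list of real roots. -/
abbrev realRootProd (ξ : List ℝ) : ℂ → ℂ := rootProd (ξ.map fun b : ℝ => (b : ℂ))

/-- Dividing `(Q z - Q w)/(z - w)` by `Q w` leaves the Cauchy-type integrand times `Q z`, minus `H
w/(z - w)`, which `h0` discards. The divided-difference form has no pole at `w = z`, so it does not
see the position of `z` relative to the loop. -/
theorem IsLoop.rootProdDiv_eq {J : (ℂ → ℂ) → ℂ} {K : Set ℂ} (h : IsLoop J K) {l : List ℂ}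
    (hl : ∀ a ∈ l, a ∉ K) {H : ℂ → ℂ} (hH : ContinuousOn H K) {z : ℂ} (hz : z ∉ K)
    (h0 : J (fun w => H w * (z - w)⁻¹) = 0) :
    J (fun w => H w * (rootProd l w)⁻¹ * rootProdDiv l z w)
      = rootProd l z * J (fun w => H w * (rootProd l w)⁻¹ * (z - w)⁻¹) := by
  have hne : ∀ w ∈ K, z - w ≠ 0 := fun w hw h0 => hz (by rwa [sub_eq_zero.1 h0])
  have hne' : ∀ w ∈ K, rootProd l w ≠ 0 := fun w hw => rootProd_ne_zero fun hwl => hl w hwl hw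
  have c1 : ContinuousOn (fun w => (z - w)⁻¹) K :=
    ContinuousOn.inv₀ (by fun_prop) hne
  have c2 : ContinuousOn (fun w => (rootProd l w)⁻¹) K :=
    (differentiable_rootProd l).continuous.continuousOn.inv₀ hne'
  have c3 : ContinuousOn (fun w => H w * (z - w)⁻¹) K := hH.mul c1
  have c4 : ContinuousOn (fun w => H w * (rootProd l w)⁻¹ * (z - w)⁻¹) K := (hH.mul c2).mul c1
  have h1 := h.smul (-1) _ c3
  rw [h0, mul_zero] at h1
  rw [← add_zero (rootProd l z * _), ← h1, ← h.smul _ _ c4,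
    ← h.add (fun w => rootProd l z * (H w * (rootProd l w)⁻¹ * (z - w)⁻¹))
      (fun w => -1 * (H w * (z - w)⁻¹)) (continuousOn_const.mul c4) (continuousOn_const.mul c3)]
  refine h.congr _ _ fun w hw => ?_
  have e1 := hne w hw
  have e2 := hne' w hw
  have e3 := rootProdDiv_mul_sub l z w
  have e4 : rootProdDiv l z w = (rootProd l z - rootProd l w) * (z - w)⁻¹ := by
    rw [← e3]; field_simp
  rw [e4]
  field_simp
  ring

theorem IsLoop.inv_sub_eq_zero_of_re_lt {J : (ℂ → ℂ) → ℂ} {K : Set ℂ} (h : IsLoop J K)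
    (hK : IsCompact K) {H : ℂ → ℂ} (hH : Differentiable ℂ H) {z : ℂ} (hz : ∀ w ∈ K, w.re < z.re) :
    J (fun w => H w * (z - w)⁻¹) = 0 := by
  have hd : DifferentiableOn ℂ (fun w => H w * (z - w)⁻¹) {w | w.re < z.re} := fun w hw => by
    refine (hH w).differentiableWithinAt.mul (DifferentiableWithinAt.inv (by fun_prop) ?_)
    intro h0
    rw [sub_eq_zero.1 h0] at hw
    exact lt_irrefl w.re hw
  obtain ⟨F, hF⟩ := exists_primitive_of_isCompact_of_re_lt hd hK hz
  exact h.exact _ F (hd.continuousOn.mono hz) hF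

theorem IsLoop.inv_sub_eq_zero_of_lt_re {J : (ℂ → ℂ) → ℂ} {K : Set ℂ} (h : IsLoop J K)
    (hK : IsCompact K) {H : ℂ → ℂ} (hH : Differentiable ℂ H) {z : ℂ} (hz : ∀ w ∈ K, z.re < w.re) :
    J (fun w => H w * (z - w)⁻¹) = 0 := by
  have hd : DifferentiableOn ℂ (fun w => H w * (z - w)⁻¹) {w | z.re < w.re} := fun w hw => by
    refine (hH w).differentiableWithinAt.mul (DifferentiableWithinAt.inv (by fun_prop) ?_)
    intro h0
    rw [sub_eq_zero.1 h0] at hw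
    exact lt_irrefl w.re hw
  obtain ⟨F, hF⟩ := exists_primitive_of_isCompact_of_lt_re hd hK hz
  exact h.exact _ F (hd.continuousOn.mono hz) hF

namespace VGraph

theorem x_le (g : VGraph) (hm : g.m ≤ 0) (y : ℝ) : g.x y ≤ g.a := by
  have := mul_nonpos_of_nonpos_of_nonneg hm (le_max_right (|y| - g.y₀) 0)
  rw [x]; linarith

theorem le_x (g : VGraph) (hm : 0 ≤ g.m) (y : ℝ) : g.a ≤ g.x y := by
  have := mul_nonneg hm (le_max_right (|y| - g.y₀) 0)
  rw [x]; linarith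

theorem eventually_x_lt (g : VGraph) (hm : g.m ^ 2 = 3) (hm' : g.m ≤ 0) (b : ℝ) :
    ∀ᶠ S in atTop, g.x S < b := by
  filter_upwards [(g.tendsto_abs_x hm).eventually_gt_atTop (|b| + |g.a|)] with S hS
  have h1 := g.x_le hm' S
  rcases le_total 0 (g.x S) with h | h
  · rw [abs_of_nonneg h] at hS
    linarith [le_abs_self g.a, abs_nonneg b]
  · rw [abs_of_nonpos h] at hS
    linarith [neg_abs_le b, abs_nonneg g.a]

theorem eventually_lt_x (g : VGraph) (hm : g.m ^ 2 = 3) (hm' : 0 ≤ g.m) (b : ℝ) :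
    ∀ᶠ S in atTop, b < g.x S := by
  filter_upwards [(g.tendsto_abs_x hm).eventually_gt_atTop (|b| + |g.a|)] with S hS
  have h1 := g.le_x hm' S
  rcases le_total 0 (g.x S) with h | h
  · rw [abs_of_nonneg h] at hS
    linarith [le_abs_self b, abs_nonneg g.a]
  · rw [abs_of_nonpos h] at hS
    linarith [neg_abs_le g.a, abs_nonneg b]

end VGraph

open VGraph in
/-- A loop with winding number one around all the points may be replaced by two unbounded graphs
that enclose the points on the left and on the right. -/
theorem IsLoop.eq_fullInt_sub {J : (ℂ → ℂ) → ℂ} {K : Set ℂ} (h : IsLoop J K) {ξ : List ℝ}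
    (hξK : ∀ b ∈ ξ, (b : ℂ) ∉ K)
    (hJ : ∀ b ∈ ξ, J (fun w => (w - (b : ℂ))⁻¹) = 2 * Real.pi * Complex.I) {gL gR : VGraph}
    (hL : gL.m ^ 2 = 3) (hL' : gL.m ≤ 0) (hR : gR.m ^ 2 = 3) (hR' : 0 ≤ gR.m)
    (hξ : ∀ b ∈ ξ, b < gL.a ∨ gR.a < b) (k₀ k₁ : ℝ) {k₂ : ℝ} (hk : 0 < k₂) {z : ℂ}
    (hzL : gL.a < z.re) (hzR : z.re < gR.a) :
    J (fun w => quadExp k₀ k₁ (-k₂) w * (realRootProd ξ w)⁻¹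
        * rootProdDiv (ξ.map fun b : ℝ => (b : ℂ)) z w)
      = realRootProd ξ z *
        (gL.fullInt (fun w => quadExp k₀ k₁ (-k₂) w * (realRootProd ξ w)⁻¹ * (z - w)⁻¹)
          - gR.fullInt (fun w => quadExp k₀ k₁ (-k₂) w * (realRootProd ξ w)⁻¹ * (z - w)⁻¹)) := by
  set H := quadExp k₀ k₁ (-k₂)
  have hHd : Differentiable ℂ H := differentiable_quadExp _ _ _
  set φ : ℂ → ℂ := fun w => H w * (realRootProd ξ w)⁻¹ * (z - w)⁻¹ with hφ
  set l := ξ.map fun b : ℝ => (b : ℂ) with hl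
  -- The graphs are cut at height `S` and closed by vertical segments through their endpoints; for
  -- large `S` the two closed loops enclose all roots on their respective sides.
  have hev : ∀ᶠ S in atTop, J (fun w => H w * (realRootProd ξ w)⁻¹ * rootProdDiv l z w)
      = realRootProd ξ z * ((gL.partialInt S φ - (vline (gL.x S)).partialInt S φ)
        - (gR.partialInt S φ - (vline (gR.x S)).partialInt S φ)) := by
    have h1 : ∀ᶠ S in atTop, ∀ b ∈ ξ, gL.x S < b ∧ b < gR.x S := by
      clear hl hφ φ hξ hξK hJ
      clear_value l
      induction ξ with
      | nil => simp
      | cons b l ih =>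
        filter_upwards [ih, gL.eventually_x_lt hL hL' b, gR.eventually_lt_x hR hR' b]
          with S h1 h2 h3 c hc
        rcases List.mem_cons.1 hc with rfl | hc
        · exact ⟨h2, h3⟩
        · exact h1 c hc
    filter_upwards [h1, eventually_gt_atTop 0] with S hS hS0
    have hA := isLoop_sub hS0.le (g := gL) (k := vline (gL.x S)) (by simp)
    have hB := isLoop_sub hS0.le (g := gR) (k := vline (gR.x S)) (by simp)
    set KA := gL.part S ∪ (vline (gL.x S)).part S with hKA
    set KB := gR.part S ∪ (vline (gR.x S)).part S with hKB
    have hAc : IsCompact KA := (gL.isCompact_part S).union (isCompact_part _ S)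
    have hBc : IsCompact KB := (gR.isCompact_part S).union (isCompact_part _ S)
    have hAre : ∀ w ∈ KA, w.re < z.re := by
      rintro w (hw | hw)
      · rw [((mem_part _).1 hw).2]
        exact (gL.x_le hL' _).trans_lt hzL
      · rw [((mem_part _).1 hw).2, vline_x]
        exact (gL.x_le hL' _).trans_lt hzL
    have hBre : ∀ w ∈ KB, z.re < w.re := by
      rintro w (hw | hw)
      · rw [((mem_part _).1 hw).2]
        exact hzR.trans_le (gR.le_x hR' _)
      · rw [((mem_part _).1 hw).2, vline_x]
        exact hzR.trans_le (gR.le_x hR' _)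
    have hzA : z ∉ KA := fun hz => lt_irrefl _ (hAre z hz)
    have hzB : z ∉ KB := fun hz => lt_irrefl _ (hBre z hz)
    have hne : ∀ b ∈ ξ, b ≠ gL.a ∧ b ≠ gR.a := fun b hb => by
      rcases hξ b hb with h | h
      · exact ⟨h.ne, (h.trans (hzL.trans hzR)).ne⟩
      · exact ⟨((hzL.trans hzR).trans h).ne', h.ne'⟩
    have hlA : ∀ a ∈ l, a ∉ KA := by
      intro a ha
      obtain ⟨b, hb, rfl⟩ := List.mem_map.1 ha
      rintro (hw | hw)
      · exact gL.ofReal_notMem_part (hne b hb).1 hw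
      · exact ofReal_notMem_part _ (hS b hb).1.ne' hw
    have hlB : ∀ a ∈ l, a ∉ KB := by
      intro a ha
      obtain ⟨b, hb, rfl⟩ := List.mem_map.1 ha
      rintro (hw | hw)
      · exact gR.ofReal_notMem_part (hne b hb).2 hw
      · exact ofReal_notMem_part _ (hS b hb).2.ne hw
    have hlK : ∀ a ∈ l, a ∉ K := by
      intro a ha
      obtain ⟨b, hb, rfl⟩ := List.mem_map.1 ha
      exact hξK b hb
    -- The loop `hA` winds once around the left points, and `hB`, oriented the other way, minus once
    -- around the right points. Thus `J` minus `hA - hB` has winding number zero about every root,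
    -- and with the divided difference as numerator there is no further pole at `z`.
    have hD := (h.sub (hA.sub hB)).eq_zero_of_residues l ?_ ?_
      (fun w => H w * rootProdDiv l z w) (hHd.mul (differentiable_rootProdDiv l z))
    · have e : (fun w => H w * rootProdDiv l z w * (rootProd l w)⁻¹)
          = fun w => H w * (rootProd l w)⁻¹ * rootProdDiv l z w := by
        ext w; ring
      rw [e] at hD
      rw [hA.rootProdDiv_eq hlA hHd.continuous.continuousOn hzA
        (hA.inv_sub_eq_zero_of_re_lt hAc hHd hAre),
        hB.rootProdDiv_eq hlB hHd.continuous.continuousOn hzB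
        (hB.inv_sub_eq_zero_of_lt_re hBc hHd hBre)] at hD
      rw [sub_eq_zero.1 hD]
      ring
    · rintro a ha (hw | hw | hw)
      · exact hlK a ha hw
      · exact hlA a ha hw
      · exact hlB a ha hw
    · intro a ha
      obtain ⟨b, hb, rfl⟩ := List.mem_map.1 ha
      rw [hJ b hb]
      rcases hξ b hb with hb' | hb'
      · rw [loop_inv_sub hS0 (by simp) hb' (hS b hb).1,
          loop_inv_sub_eq_zero hS0 (by simp) (Or.inl ⟨hb'.trans (hzL.trans hzR), (hS b hb).2⟩)]
        ring
      · have h2 := loop_inv_sub hS0 (g := vline (gR.x S)) (k := gR) (by simp) (hS b hb).2 hb'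
        rw [loop_inv_sub_eq_zero hS0 (by simp) (Or.inr ⟨(hzL.trans hzR).trans hb', (hS b hb).1⟩)]
        linear_combination -h2
  have hneL : ∀ b ∈ ξ, b ≠ gL.a := fun b hb => by
    rcases hξ b hb with h | h
    · exact h.ne
    · exact ((hzL.trans hzR).trans h).ne'
  have hneR : ∀ b ∈ ξ, b ≠ gR.a := fun b hb => by
    rcases hξ b hb with h | h
    · exact (h.trans (hzL.trans hzR)).ne
    · exact h.ne'
  have hdL : ∀ y, z.re - gL.a ≤ ‖z - gL.curve y‖ := fun y => by
    have h1 := Complex.abs_re_le_norm (z - gL.curve y)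
    have h2 := le_abs_self (z - gL.curve y).re
    simp only [Complex.sub_re, curve_re] at h1 h2
    linarith [gL.x_le hL' y]
  have hdR : ∀ y, gR.a - z.re ≤ ‖z - gR.curve y‖ := fun y => by
    have h1 := Complex.abs_re_le_norm (z - gR.curve y)
    have h2 := neg_abs_le (z - gR.curve y).re
    simp only [Complex.sub_re, curve_re] at h1 h2
    linarith [gR.le_x hR' y]
  obtain ⟨CL, -, hCL⟩ := gL.exists_integrand_bound hL hneL k₀ k₁ hk (sub_pos.2 hzL)
  obtain ⟨CR, -, hCR⟩ := gR.exists_integrand_bound hR hneR k₀ k₁ hk (sub_pos.2 hzR)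
  have hgauss : ∀ C : ℝ, Integrable fun y : ℝ => C * Real.exp (-(k₂ / 2) * y ^ 2) := fun C =>
    (integrable_exp_neg_mul_sq (half_pos hk)).const_mul C
  have iL := gL.integrable_of_bound (f := φ) (gL.continuous_comp_curve hneL (fun y hy => by
    have := hdL y
    rw [hy, sub_self, norm_zero] at this
    linarith) _ _ _) (hgauss CL) (hCL z hdL)
  have iR := gR.integrable_of_bound (f := φ) (gR.continuous_comp_curve hneR (fun y hy => by
    have := hdR y
    rw [hy, sub_self, norm_zero] at this
    linarith) _ _ _) (hgauss CR) (hCR z hdR)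
  have hlim := ((((gL.tendsto_partialInt iL).sub
    (gL.tendsto_vline_partialInt hL ξ z k₀ k₁ hk)).sub ((gR.tendsto_partialInt iR).sub
    (gR.tendsto_vline_partialInt hR ξ z k₀ k₁ hk))).const_mul (realRootProd ξ z))
  rw [sub_zero, sub_zero] at hlim
  exact tendsto_nhds_unique (tendsto_const_nhds.congr' hev) hlim

open VGraph in
/-- The double contour integral with `z` on a vertical line that avoids the loop, moved to the
contours used in the asymptotic analysis. -/
theorem IsLoop.integral_line_eq {J : (ℂ → ℂ) → ℂ} {K : Set ℂ} (h : IsLoop J K) {ξ : List ℝ}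
    (hξK : ∀ b ∈ ξ, (b : ℂ) ∉ K)
    (hJ : ∀ b ∈ ξ, J (fun w => (w - (b : ℂ))⁻¹) = 2 * Real.pi * Complex.I) {gL gR : VGraph}
    (hL : gL.m ^ 2 = 3) (hL' : gL.m ≤ 0) (hR : gR.m ^ 2 = 3) (hR' : 0 ≤ gR.m)
    (hξ : ∀ b ∈ ξ, b < gL.a ∨ gR.a < b) (k₀ k₁ : ℝ) {k₂ : ℝ} (hk : 0 < k₂)
    (j₀ j₁ : ℝ) {j₂ : ℝ} (hj : 0 < j₂) {x₀ r : ℝ} (hx₀ : ∀ w ∈ K, w.re ≠ x₀)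
    (hJ0 : ∀ f : ℂ → ℂ, (∀ w : ℂ, w.re ≠ x₀ → DifferentiableAt ℂ f w) → J f = 0)
    (hrL : gL.a < r) (hrR : r < gR.a) :
    ∫ y : ℝ, quadExp j₀ j₁ j₂ (x₀ + y * Complex.I) * (realRootProd ξ (x₀ + y * Complex.I) *
        J (fun w => quadExp k₀ k₁ (-k₂) w * (realRootProd ξ w)⁻¹ * (x₀ + y * Complex.I - w)⁻¹))
      = ∫ y : ℝ, quadExp j₀ j₁ j₂ (r + y * Complex.I) * (realRootProd ξ (r + y * Complex.I) *
        (gL.fullInt (fun w => quadExp k₀ k₁ (-k₂) w * (realRootProd ξ w)⁻¹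
            * (r + y * Complex.I - w)⁻¹)
          - gR.fullInt (fun w => quadExp k₀ k₁ (-k₂) w * (realRootProd ξ w)⁻¹
            * (r + y * Complex.I - w)⁻¹))) := by
  have hHd := differentiable_quadExp k₀ k₁ (-k₂)
  have hlK : ∀ a ∈ ξ.map fun b : ℝ => (b : ℂ), a ∉ K := by
    intro a ha
    obtain ⟨b, hb, rfl⟩ := List.mem_map.1 ha
    exact hξK b hb
  -- On both lines the integrand is the same quadratic exponential times the same polynomial `p`, so
  -- no residue arises even if the line is moved across the loop. On the line through `x₀` the
  -- discarded term `H w/(z - w)` is holomorphic off that line, so `hJ0` applies.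
  obtain ⟨p, hp⟩ := h.exists_polynomial (ξ.map fun b : ℝ => (b : ℂ))
    (fun w => quadExp k₀ k₁ (-k₂) w * (realRootProd ξ w)⁻¹)
    (hHd.continuous.continuousOn.mul ((differentiable_rootProd _).continuous.continuousOn.inv₀
      fun w hw => rootProd_ne_zero fun hwl => hlK w hwl hw))
  have e1 : ∀ y : ℝ, realRootProd ξ (x₀ + y * Complex.I) *
      J (fun w => quadExp k₀ k₁ (-k₂) w * (realRootProd ξ w)⁻¹ * (x₀ + y * Complex.I - w)⁻¹)
      = p.eval (x₀ + y * Complex.I) := fun y => by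
    rw [← hp, h.rootProdDiv_eq hlK hHd.continuous.continuousOn]
    · exact fun hz => hx₀ _ hz (by simp)
    · refine hJ0 _ fun w hw => (hHd w).mul (DifferentiableAt.inv (by fun_prop) fun h0 => hw ?_)
      rw [← sub_eq_zero.1 h0]
      simp
  have e2 : ∀ y : ℝ, realRootProd ξ (r + y * Complex.I) *
        (gL.fullInt (fun w => quadExp k₀ k₁ (-k₂) w * (realRootProd ξ w)⁻¹
            * (r + y * Complex.I - w)⁻¹)
          - gR.fullInt (fun w => quadExp k₀ k₁ (-k₂) w * (realRootProd ξ w)⁻¹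
            * (r + y * Complex.I - w)⁻¹)) = p.eval (r + y * Complex.I) := fun y => by
    rw [← hp, h.eq_fullInt_sub hξK hJ hL hL' hR hR' hξ k₀ k₁ hk (by simpa using hrL)
      (by simpa using hrR)]
  simp only [e1, e2]
  exact integral_quadExp_mul_eval_eq hj p x₀ r


/-! ### Approximation of the rescaled integrand by a cubic exponential. -/

theorem mem_slitPlane_one_add {x : ℂ} (hx : ‖x‖ ≤ 1 / 2 ∨ ‖x‖ / 2 ≤ |x.im|) :
    1 + x ∈ Complex.slitPlane := by
  rcases hx with hx | hx
  · exact Complex.mem_slitPlane_of_norm_lt_one (by linarith)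
  · by_cases h0 : x = 0
    · simp [h0]
    · rw [Complex.mem_slitPlane_iff]
      right
      have : 0 < ‖x‖ := norm_pos_iff.2 h0
      have h1 : x.im ≠ 0 := abs_pos.1 (by linarith)
      simpa using h1

/-- Third order Taylor expansion of the logarithm, uniformly in a cone around the imaginary
axis. -/
theorem norm_log_one_add_sub_le {x : ℂ} (hx : ‖x‖ ≤ 1 / 2 ∨ ‖x‖ / 2 ≤ |x.im|) :
    ‖Complex.log (1 + x) - (x - x ^ 2 / 2 + x ^ 3 / 3)‖ ≤ 199 * ‖x‖ ^ 4 := by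
  rcases le_or_gt ‖x‖ (1 / 2) with h | h
  · have h1 := Complex.norm_log_sub_logTaylor_le 3 (z := x) (by linarith)
    have h2 : Complex.logTaylor (3 + 1) x = x - x ^ 2 / 2 + x ^ 3 / 3 := by
      simp [Complex.logTaylor, Finset.sum_range_succ]
      ring
    rw [h2] at h1
    refine h1.trans ?_
    have h3 : (1 - ‖x‖)⁻¹ ≤ 2 := by
      rw [inv_le_comm₀ (by linarith) (by norm_num)]
      linarith
    have h4 : ‖x‖ ^ (3 + 1) * (1 - ‖x‖)⁻¹ ≤ ‖x‖ ^ (3 + 1) * 2 := by gcongr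
    have h5 : 0 ≤ ‖x‖ ^ 4 := by positivity
    norm_num at h4 ⊢
    linarith
  · have him : ‖x‖ / 2 ≤ |x.im| := hx.resolve_left (by linarith)
    set t := ‖x‖ with ht
    have h1 : 1 / 4 ≤ ‖1 + x‖ := by
      have := Complex.abs_im_le_norm (1 + x)
      simp at this
      linarith
    have h2 : ‖1 + x‖ ≤ 1 + t := (norm_add_le _ _).trans (by simp [ht])
    have h3 : |Real.log ‖1 + x‖| ≤ t + 3 := by
      rw [abs_le]
      constructor
      · have := Real.one_sub_inv_le_log_of_pos (by linarith : 0 < ‖1 + x‖)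
        have h4 : ‖1 + x‖⁻¹ ≤ 4 := by
          rw [inv_le_comm₀ (by linarith) (by norm_num)]
          linarith
        linarith
      · have := Real.log_le_sub_one_of_pos (by linarith : 0 < ‖1 + x‖)
        linarith
    have h4 : ‖Complex.log (1 + x)‖ ≤ t + 3 + 4 := by
      refine (Complex.norm_le_abs_re_add_abs_im _).trans ?_
      rw [Complex.log_re, Complex.log_im]
      linarith [Complex.abs_arg_le_pi (1 + x), Real.pi_le_four]
    have h5 : ‖x - x ^ 2 / 2 + x ^ 3 / 3‖ ≤ t + t ^ 2 / 2 + t ^ 3 / 3 := by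
      refine (norm_add_le _ _).trans ?_
      refine add_le_add ((norm_sub_le _ _).trans ?_) ?_ <;> simp [ht]
    refine (norm_sub_le _ _).trans ((add_le_add h4 h5).trans ?_)
    have e1 : t ≤ 2 * t ^ 2 := by nlinarith
    have e2 : t ^ 2 ≤ 2 * t ^ 3 := by nlinarith [sq_nonneg t]
    have e3 : t ^ 3 ≤ 2 * t ^ 4 := by
      have : 0 ≤ t ^ 3 := by positivity
      nlinarith
    linarith

/-- The function `exp (k₀ + k₁ ζ + k₂ ζ²) ∏ⱼ (1 + bⱼ ζ)`. -/
def expProd {n : ℕ} (k₀ k₁ k₂ : ℝ) (b : Fin n → ℝ) (ζ : ℂ) : ℂ :=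
  quadExp k₀ k₁ k₂ ζ * ∏ j, (1 + (b j : ℂ) * ζ)

/-- The exponential of the cubic polynomial in the Airy kernel. -/
def cubicExp (τ v : ℝ) (ζ : ℂ) : ℂ := Complex.exp (ζ ^ 3 / 3 - τ * ζ ^ 2 - v * ζ)

/-- The logarithm of `expProd k₀ k₁ k₂ b` agrees with `ζ³/3 - τ ζ² - v ζ` up to third order, with
an error of size `K` in the coefficients, and the fourth order term is of size `K`. -/
structure CubicApprox {n : ℕ} (k₀ k₁ k₂ : ℝ) (b : Fin n → ℝ) (τ v K : ℝ) : Prop where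
  zero : |k₀| ≤ K
  one : |k₁ + ∑ j, b j + v| ≤ K
  two : |k₂ - (∑ j, b j ^ 2) / 2 + τ| ≤ K
  three : |∑ j, b j ^ 3 - 1| ≤ K
  four : ∑ j, b j ^ 4 ≤ K
  le : ∀ j, |b j| ≤ K

theorem CubicApprox.nonneg {n : ℕ} {k₀ k₁ k₂ : ℝ} {b : Fin n → ℝ} {τ v K : ℝ}
    (h : CubicApprox k₀ k₁ k₂ b τ v K) : 0 ≤ K := (abs_nonneg _).trans h.zero

/-- Expand the logarithm of each factor to third order. The first three power sums combine with
`k₁`, `k₂` into the controlled coefficients, and the remainders add up to `199 (∑ b_j⁴) ‖ζ‖⁴`. The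
alternative in `hζ` survives multiplication by every real `b_j`: either `b_j ζ` is small because
`|b_j| ≤ K`, or it stays in the cone around the imaginary axis. -/
theorem CubicApprox.exists_eq_mul_exp {n : ℕ} {k₀ k₁ k₂ : ℝ} {b : Fin n → ℝ} {τ v K : ℝ}
    (h : CubicApprox k₀ k₁ k₂ b τ v K) {ζ : ℂ} (hζ : K * ‖ζ‖ ≤ 1 / 2 ∨ ‖ζ‖ / 2 ≤ |ζ.im|) :
    ∃ Δ : ℂ, expProd k₀ k₁ k₂ b ζ = cubicExp τ v ζ * Complex.exp Δ ∧
      ‖Δ‖ ≤ 200 * K * (1 + ‖ζ‖) ^ 4 := by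
  have hK := h.nonneg
  have hcone : ∀ j, ‖(b j : ℂ) * ζ‖ ≤ 1 / 2 ∨ ‖(b j : ℂ) * ζ‖ / 2 ≤ |((b j : ℂ) * ζ).im| := by
    intro j
    rw [norm_mul, Complex.norm_real, Real.norm_eq_abs]
    rcases hζ with hζ | hζ
    · exact Or.inl ((mul_le_mul_of_nonneg_right (h.le j) (norm_nonneg _)).trans hζ)
    · right
      simp only [Complex.mul_im, Complex.ofReal_re, Complex.ofReal_im, zero_mul, add_zero]
      rw [abs_mul, mul_div_assoc]
      gcongr
  have hlog : ∀ j, (1 + (b j : ℂ) * ζ) = Complex.exp (Complex.log (1 + (b j : ℂ) * ζ)) :=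
    fun j => (Complex.exp_log (Complex.slitPlane_ne_zero (mem_slitPlane_one_add (hcone j)))).symm
  set ρ : Fin n → ℂ := fun j => Complex.log (1 + (b j : ℂ) * ζ)
    - ((b j : ℂ) * ζ - ((b j : ℂ) * ζ) ^ 2 / 2 + ((b j : ℂ) * ζ) ^ 3 / 3) with hρ
  have hρn : ‖∑ j, ρ j‖ ≤ 199 * K * ‖ζ‖ ^ 4 := by
    calc _ ≤ ∑ j, 199 * (b j ^ 4 * ‖ζ‖ ^ 4) := by
          refine norm_sum_le_of_le _ fun j _ => (norm_log_one_add_sub_le (hcone j)).trans ?_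
          rw [norm_mul, Complex.norm_real, Real.norm_eq_abs, mul_pow, Even.pow_abs (by decide)]
      _ = 199 * (∑ j, b j ^ 4) * ‖ζ‖ ^ 4 := by
          rw [← Finset.mul_sum, ← Finset.sum_mul]; ring
      _ ≤ _ := by gcongr; exact h.four
  set d₁ := k₁ + ∑ j, b j + v with hd₁
  set d₂ := k₂ - (∑ j, b j ^ 2) / 2 + τ with hd₂
  set d₃ := ∑ j, b j ^ 3 - 1 with hd₃
  refine ⟨k₀ + d₁ * ζ + d₂ * ζ ^ 2 + d₃ * ζ ^ 3 / 3 + ∑ j, ρ j, ?_, ?_⟩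
  · rw [expProd, Finset.prod_congr rfl fun j _ => hlog j, ← Complex.exp_sum, quadExp, cubicExp,
      ← Complex.exp_add, ← Complex.exp_add]
    congr 1
    simp only [hρ, Finset.sum_sub_distrib, Finset.sum_add_distrib, mul_pow, hd₁, hd₂, hd₃,
      ← Finset.sum_div, ← Finset.sum_mul]
    push_cast
    ring
  · set t := ‖ζ‖ with ht
    have ht0 : 0 ≤ t := norm_nonneg ζ
    have h1 : ‖(k₀ : ℂ) + d₁ * ζ + d₂ * ζ ^ 2 + d₃ * ζ ^ 3 / 3‖
        ≤ K + K * t + K * t ^ 2 + K * t ^ 3 / 3 := by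
      refine (norm_add_le _ _).trans (add_le_add ((norm_add_le _ _).trans (add_le_add
        ((norm_add_le _ _).trans (add_le_add ?_ ?_)) ?_)) ?_)
      · simpa using h.zero
      · rw [norm_mul, Complex.norm_real]
        exact mul_le_mul_of_nonneg_right h.one ht0
      · rw [norm_mul, Complex.norm_real, norm_pow]
        exact mul_le_mul_of_nonneg_right h.two (by positivity)
      · rw [norm_div, norm_mul, Complex.norm_real, norm_pow, Complex.norm_ofNat]
        gcongr
        exact h.three
    refine (norm_add_le _ _).trans ((add_le_add h1 hρn).trans ?_)
    have : 0 ≤ K * t := by positivity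
    have : 0 ≤ K * t ^ 2 := by positivity
    have : 0 ≤ K * t ^ 3 := by positivity
    have : 0 ≤ K * t ^ 4 := by positivity
    nlinarith

/-- No smallness of `q` is needed: for `q ≤ 1` use `|e^Δ - 1| ≤ 2|Δ|`, and for `q ≥ 1` the trivial
bound `2B` suffices. Hence it applies along a whole contour, where `q` grows polynomially but `B`
decays. -/
theorem norm_mul_exp_sub_le {A a Δ : ℂ} {q B : ℝ} (h : A = a * Complex.exp Δ) (hΔ : ‖Δ‖ ≤ q)
    (hA : ‖A‖ ≤ B) (ha : ‖a‖ ≤ B) : ‖A - a‖ ≤ 2 * q * B := by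
  have hB : 0 ≤ B := (norm_nonneg _).trans ha
  have hq0 : 0 ≤ q := (norm_nonneg _).trans hΔ
  rcases le_total q 1 with hq | hq
  · have h1 := Complex.norm_exp_sub_one_le (hΔ.trans hq)
    have h2 : A - a = (Complex.exp Δ - 1) * a := by rw [h]; ring
    rw [h2, norm_mul]
    gcongr
    linarith
  · refine (norm_sub_le _ _).trans ?_
    nlinarith

theorem norm_cubicExp (τ v : ℝ) (ζ : ℂ) : ‖cubicExp τ v ζ‖
    = Real.exp ((ζ.re ^ 3 - 3 * ζ.re * ζ.im ^ 2) / 3 - τ * (ζ.re ^ 2 - ζ.im ^ 2) - v * ζ.re) := by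
  rw [cubicExp, Complex.norm_exp]
  congr 1
  have h3 : (ζ ^ 3 / 3).re = (ζ.re ^ 3 - 3 * ζ.re * ζ.im ^ 2) / 3 := by
    rw [show (3 : ℂ) = ((3 : ℝ) : ℂ) by norm_num, Complex.div_ofReal_re]
    simp [pow_succ]
    ring
  rw [Complex.sub_re, Complex.sub_re, h3]
  simp [pow_two]

theorem inv_one_add_sq_le {x : ℝ} (hx : |x| ≤ 1 / 2) :
    1 / (1 + x) ^ 2 ≤ 1 - 2 * x + 8 * x ^ 2 := by
  have h := abs_le.1 hx
  have h1 : 0 < (1 + x) ^ 2 := by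
    have : 0 < 1 + x := by linarith
    positivity
  rw [div_le_iff₀ h1]
  have h2 : (1 - 2 * x + 8 * x ^ 2) * (1 + x) ^ 2 - 1 = x ^ 2 * (5 + 14 * x + 8 * x ^ 2) := by ring
  have h3 : 0 ≤ x ^ 2 * (5 + 14 * x + 8 * x ^ 2) := by
    refine mul_nonneg (sq_nonneg x) ?_
    nlinarith
  linarith

theorem sum_sq_div_le {n : ℕ} {b : Fin n → ℝ} {r : ℝ} (h : ∀ j, |b j * r| ≤ 1 / 2) :
    ∑ j, b j ^ 2 / (1 + b j * r) ^ 2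
      ≤ ∑ j, b j ^ 2 - 2 * r * ∑ j, b j ^ 3 + 8 * r ^ 2 * ∑ j, b j ^ 4 := by
  rw [Finset.mul_sum, Finset.mul_sum, ← Finset.sum_sub_distrib, ← Finset.sum_add_distrib]
  refine Finset.sum_le_sum fun j _ => ?_
  have h1 := mul_le_mul_of_nonneg_left (inv_one_add_sq_le (h j)) (sq_nonneg (b j))
  rw [mul_one_div] at h1
  refine h1.trans (le_of_eq ?_)
  ring

/-! ### The vertical line -/

theorem norm_one_add_mul_vertical_le {b R : ℝ} (h : |b * R| ≤ 1 / 2) (η : ℝ) :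
    ‖1 + (b : ℂ) * (R + η * Complex.I)‖
      ≤ ‖1 + (b : ℂ) * R‖ * Real.exp (η ^ 2 / 2 * (b ^ 2 / (1 + b * R) ^ 2)) := by
  have h0 : 0 < 1 + b * R := by linarith [(abs_le.1 h).1]
  have e1 : 1 + (b : ℂ) * (R + η * Complex.I) = ((1 + b * R : ℝ) : ℂ) +
      ((b * η : ℝ) : ℂ) * Complex.I := by
    push_cast; ring
  have e2 : ‖1 + (b : ℂ) * R‖ = 1 + b * R := by
    rw [← abs_of_pos h0, ← Real.norm_eq_abs, ← Complex.norm_real]; push_cast; rfl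
  rw [e1, e2, Complex.norm_add_mul_I, Real.sqrt_le_left (by positivity), mul_pow (1 + b * R),
    ← Real.exp_nat_mul]
  have h1 := Real.add_one_le_exp (((2 : ℕ) : ℝ) * (η ^ 2 / 2 * (b ^ 2 / (1 + b * R) ^ 2)))
  calc (1 + b * R) ^ 2 + (b * η) ^ 2
      = (1 + b * R) ^ 2 * (((2 : ℕ) : ℝ) * (η ^ 2 / 2 * (b ^ 2 / (1 + b * R) ^ 2)) + 1) := by
        push_cast; field_simp; ring
    _ ≤ _ := by gcongr

/-- Each factor satisfies `|1 + b(R+iη)|² = (1+bR)² + b²η²`, which `1 + x ≤ exp x` turns into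
Gaussian growth. Expanding `(1+bR)⁻²` in `R` leaves a coefficient of `-η²` that is close to `R - τ`
under `CubicApprox`. -/
theorem norm_expProd_vertical_le {n : ℕ} (k₀ k₁ k₂ : ℝ) {b : Fin n → ℝ} {R : ℝ}
    (h : ∀ j, |b j * R| ≤ 1 / 2) (η : ℝ) :
    ‖expProd k₀ k₁ k₂ b (R + η * Complex.I)‖ ≤ ‖expProd k₀ k₁ k₂ b R‖ *
      Real.exp (-η ^ 2 * (k₂ - (∑ j, b j ^ 2) / 2 + R * ∑ j, b j ^ 3
        - 4 * R ^ 2 * ∑ j, b j ^ 4)) := by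
  have h1 : ∏ j, ‖1 + (b j : ℂ) * (R + η * Complex.I)‖
      ≤ (∏ j, ‖1 + (b j : ℂ) * R‖) * Real.exp (η ^ 2 / 2 * ∑ j, b j ^ 2 / (1 + b j * R) ^ 2) := by
    rw [Finset.mul_sum, Real.exp_sum, ← Finset.prod_mul_distrib]
    exact Finset.prod_le_prod (fun j _ => norm_nonneg _)
      fun j _ => norm_one_add_mul_vertical_le (h j) η
  have h2 := mul_le_mul_of_nonneg_left (sum_sq_div_le h) (by positivity : 0 ≤ η ^ 2 / 2)
  rw [expProd, expProd, norm_mul, norm_mul, norm_prod, norm_prod]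
  have h3 : ‖quadExp k₀ k₁ k₂ (R + η * Complex.I)‖
      = ‖quadExp k₀ k₁ k₂ R‖ * Real.exp (-k₂ * η ^ 2) := by
    rw [norm_quadExp, norm_quadExp, ← Real.exp_add]
    congr 1
    simp
    ring
  rw [h3]
  calc _ ≤ ‖quadExp k₀ k₁ k₂ R‖ * Real.exp (-k₂ * η ^ 2) * ((∏ j, ‖1 + (b j : ℂ) * R‖)
        * Real.exp (η ^ 2 / 2 * ∑ j, b j ^ 2 / (1 + b j * R) ^ 2)) := by gcongr
    _ = ‖quadExp k₀ k₁ k₂ R‖ * (∏ j, ‖1 + (b j : ℂ) * R‖) * Real.exp (-k₂ * η ^ 2 +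
        η ^ 2 / 2 * ∑ j, b j ^ 2 / (1 + b j * R) ^ 2) := by rw [Real.exp_add]; ring
    _ ≤ _ := by
        refine mul_le_mul_of_nonneg_left (Real.exp_le_exp.2 ?_) (by positivity)
        linarith

/-! ### Rays -/

/-- The second derivative of `t ↦ log ((X+t)² + Y²)/2` is never below `-1/(8Y²)`, the minimum being
attained at `(X+t)² = 3Y²`. This is Taylor's formula with that bound. -/
theorem log_add_sq_ge {X Y : ℝ} (hY : Y ≠ 0) {s : ℝ} (hs : 0 ≤ s) :
    Real.log (X ^ 2 + Y ^ 2) / 2 + s * (X / (X ^ 2 + Y ^ 2)) - s ^ 2 / (16 * Y ^ 2)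
      ≤ Real.log ((X + s) ^ 2 + Y ^ 2) / 2 := by
  have hY2 : 0 < Y ^ 2 := by positivity
  have hpos : ∀ t : ℝ, 0 < (X + t) ^ 2 + Y ^ 2 := fun t => by positivity
  have hX : 0 < X ^ 2 + Y ^ 2 := by positivity
  set f : ℝ → ℝ := fun t => Real.log ((X + t) ^ 2 + Y ^ 2) / 2 - t * (X / (X ^ 2 + Y ^ 2))
    + t ^ 2 / (16 * Y ^ 2)
  have hd : ∀ t, HasDerivAt f ((X + t) / ((X + t) ^ 2 + Y ^ 2) - X / (X ^ 2 + Y ^ 2)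
      + t / (8 * Y ^ 2)) t := by
    intro t
    have h1 : HasDerivAt (fun t => (X + t) ^ 2 + Y ^ 2) (2 * (X + t)) t := by
      simpa using (((hasDerivAt_id t).const_add X).fun_pow 2).add_const (Y ^ 2)
    have h2 := ((h1.log (hpos t).ne').div_const 2).sub
      ((hasDerivAt_id t).mul_const (X / (X ^ 2 + Y ^ 2)))
    have h3 := h2.add (((hasDerivAt_id t).fun_pow 2).div_const (16 * Y ^ 2))
    refine h3.congr_deriv ?_
    have := (hpos t).ne'
    simp only [id]
    field_simp
    ring
  have hmono : MonotoneOn f (Ici 0) := by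
    refine monotoneOn_of_deriv_nonneg (convex_Ici 0)
      (fun t _ => (hd t).continuousAt.continuousWithinAt)
      (fun t _ => (hd t).differentiableAt.differentiableWithinAt) fun t ht => ?_
    rw [interior_Ici] at ht
    have ht : 0 < t := ht
    rw [(hd t).deriv]
    have h1 := hpos t
    -- With `P = X (X+t)`, the numerator over the common denominator is `P² - 6PY² + 9Y⁴ + Y²t²`,
    -- visibly a sum of squares.
    have e : (X + t) / ((X + t) ^ 2 + Y ^ 2) - X / (X ^ 2 + Y ^ 2) + t / (8 * Y ^ 2)
        = t * ((X * (X + t) - 3 * Y ^ 2) ^ 2 + Y ^ 2 * t ^ 2)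
          / (8 * Y ^ 2 * ((X + t) ^ 2 + Y ^ 2) * (X ^ 2 + Y ^ 2)) := by
      field_simp
      ring
    rw [e]
    positivity
  have h := hmono (mem_Ici.2 le_rfl) (mem_Ici.2 hs) hs
  simp only [f, add_zero, zero_mul, sub_zero] at h
  norm_num at h
  linarith

/-- Lower bound for a linear factor along a ray in a direction `e` with `Im e = 1/2`. -/
theorem le_norm_one_add_mul_ray {b r : ℝ} (h : |b * r| ≤ 1 / 2) {ω₀ e : ℂ} (he : ‖e‖ = 1)
    (hω : (ω₀ * (starRingEnd ℂ) e).im = -r / 2) (hei : e.im = 1 / 2) {s : ℝ} (hs : 0 ≤ s) :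
    ‖1 + (b : ℂ) * ω₀‖ * Real.exp (s * ((b : ℂ) * e / (1 + b * ω₀)).re
        - s ^ 2 / 4 * (b ^ 2 / (1 + b * r) ^ 2))
      ≤ ‖1 + (b : ℂ) * (ω₀ + s * e)‖ := by
  rcases eq_or_ne b 0 with rfl | hb
  · simp
  have h0 : 0 < 1 + b * r := by linarith [(abs_le.1 h).1]
  have hee : e * (starRingEnd ℂ) e = 1 := by
    rw [Complex.mul_conj, Complex.normSq_eq_norm_sq, he]; norm_num
  have hbC : (b : ℂ) ≠ 0 := Complex.ofReal_ne_zero.2 hb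
  set p : ℂ := (1 + b * ω₀) * (starRingEnd ℂ) e / b with hp
  have e1 : ∀ t : ℂ, 1 + (b : ℂ) * (ω₀ + t * e) = b * e * (p + t) := by
    intro t
    rw [hp]
    field_simp
    linear_combination (-(1 + b * ω₀)) * hee
  have e1' : 1 + (b : ℂ) * ω₀ = b * e * p := by simpa using e1 0
  have hY : p.im = -(1 + b * r) / (2 * b) := by
    rw [hp, Complex.div_ofReal_im, add_mul, one_mul, mul_assoc, Complex.add_im, Complex.conj_im,
      Complex.im_ofReal_mul, hω, hei]
    field_simp
    ring
  have hY0 : p.im ≠ 0 := by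
    rw [hY]
    exact div_ne_zero (by linarith) (by positivity)
  have hpne : p ≠ 0 := fun h => hY0 (by rw [h]; rfl)
  have hn : ∀ t : ℝ, ‖p + t‖ = Real.exp (Real.log ((p.re + t) ^ 2 + p.im ^ 2) / 2) := by
    intro t
    have hpos : 0 < (p.re + t) ^ 2 + p.im ^ 2 := by positivity
    rw [Complex.norm_def, Complex.normSq_apply, ← Real.log_sqrt hpos.le, Real.exp_log
      (Real.sqrt_pos.2 hpos)]
    simp [pow_two]
  have hn0 := hn 0
  simp only [Complex.ofReal_zero, add_zero] at hn0
  have hre : ((b : ℂ) * e / (1 + b * ω₀)).re = p.re / (p.re ^ 2 + p.im ^ 2) := by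
    have he0 : e ≠ 0 := by
      rintro rfl
      simp at he
    rw [e1', show (b : ℂ) * e / (b * e * p) = p⁻¹ by field_simp, Complex.inv_re,
        Complex.normSq_apply]
    simp [pow_two]
  have hsq : s ^ 2 / 4 * (b ^ 2 / (1 + b * r) ^ 2) = s ^ 2 / (16 * p.im ^ 2) := by
    rw [hY]
    field_simp
    ring
  rw [e1' , e1, norm_mul, norm_mul ((b : ℂ) * e) (p + s), mul_assoc, ← e1', hre, hsq, hn, hn0,
    ← Real.exp_add]
  refine mul_le_mul_of_nonneg_left (Real.exp_le_exp.2 ?_) (norm_nonneg _)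
  have := log_add_sq_ge (X := p.re) hY0 hs
  linarith


/-- This is the derivative of `log |expProd|` at the start of the ray. A geometric expansion of
`1/(1 + b_j ω₀)` identifies it with `Re (e (ω₀² - 2τω₀ - u))` up to errors of size `K`. The square
contributes at least `3r²/4`, which dominates because `r` is large compared with `M` and `T`. -/
theorem CubicApprox.slope_ge {n : ℕ} {k₀ k₁ k₂ : ℝ} {b : Fin n → ℝ} {τ u K T M r : ℝ}
    (h : CubicApprox k₀ k₁ k₂ b τ u K) (hT : |τ| ≤ T) (hM : 0 ≤ M) (hr : 2 * (M + 2 * T + 2) ≤ r)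
    (hKr : 16 * (K * r) ≤ 1) {ω₀ e : ℂ} (he : ‖e‖ = 1) (hω₀ : ‖ω₀‖ = r)
    (hω₂ : 3 / 4 * r ^ 2 ≤ (e * ω₀ ^ 2).re) (hu : u * e.re ≤ M * r) :
    0 ≤ k₁ * e.re + 2 * k₂ * (e * ω₀).re + ∑ j, ((b j : ℂ) * e / (1 + b j * ω₀)).re := by
  have hK := h.nonneg
  have hT0 : 0 ≤ T := (abs_nonneg _).trans hT
  have hr4 : 4 ≤ r := by linarith
  have hr0 : 0 ≤ r := by linarith
  have hfac : ∀ j, b j * e.re - b j ^ 2 * (e * ω₀).re + b j ^ 3 * (e * ω₀ ^ 2).re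
      - 2 * r ^ 3 * b j ^ 4 ≤ ((b j : ℂ) * e / (1 + b j * ω₀)).re := by
    intro j
    have hb : ‖(b j : ℂ) * ω₀‖ ≤ 1 / 2 := by
      rw [norm_mul, Complex.norm_real, hω₀, Real.norm_eq_abs]
      have := mul_le_mul_of_nonneg_right (h.le j) hr0
      linarith
    have hd : 1 / 2 ≤ ‖1 + (b j : ℂ) * ω₀‖ := by
      have := norm_sub_norm_le (1 : ℂ) (-((b j : ℂ) * ω₀))
      rw [sub_neg_eq_add, norm_neg, norm_one] at this
      linarith
    have hne : 1 + (b j : ℂ) * ω₀ ≠ 0 := norm_pos_iff.1 (by linarith)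
    have e1 : (b j : ℂ) * e / (1 + b j * ω₀) = ((b j : ℝ) : ℂ) * e - ((b j ^ 2 : ℝ) : ℂ) * (e * ω₀)
        + ((b j ^ 3 : ℝ) : ℂ) * (e * ω₀ ^ 2)
        - ((b j ^ 4 : ℝ) : ℂ) * (e * ω₀ ^ 3 / (1 + b j * ω₀)) := by
      push_cast
      field_simp
      ring
    have e2 : (e * ω₀ ^ 3 / (1 + b j * ω₀)).re ≤ 2 * r ^ 3 := by
      refine (Complex.re_le_norm _).trans ?_
      rw [norm_div, norm_mul, norm_pow, he, hω₀, one_mul, div_le_iff₀ (by linarith)]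
      have := mul_le_mul_of_nonneg_left hd (by positivity : 0 ≤ 2 * r ^ 3)
      linarith
    rw [e1, Complex.sub_re, Complex.add_re, Complex.sub_re, Complex.re_ofReal_mul,
      Complex.re_ofReal_mul, Complex.re_ofReal_mul, Complex.re_ofReal_mul]
    have := mul_le_mul_of_nonneg_left e2 (by positivity : 0 ≤ b j ^ 4)
    linarith
  have hsum := Finset.sum_le_sum fun j (_ : j ∈ Finset.univ) => hfac j
  rw [Finset.sum_sub_distrib, Finset.sum_add_distrib, Finset.sum_sub_distrib, ← Finset.sum_mul,
      ← Finset.sum_mul, ← Finset.sum_mul, ← Finset.mul_sum] at hsum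
  refine le_trans ?_ (add_le_add_right hsum _)
  have habs : ∀ {a x c d : ℝ}, |a| ≤ c → |x| ≤ d → 0 ≤ c → -(c * d) ≤ a * x := fun ha hx hc => by
    refine (abs_le.1 ?_).1
    rw [abs_mul]
    exact mul_le_mul ha hx (abs_nonneg _) hc
  have hA : |(e * ω₀).re| ≤ r :=
    (Complex.abs_re_le_norm _).trans (by rw [norm_mul, he, hω₀, one_mul])
  have hB : |(e * ω₀ ^ 2).re| ≤ r ^ 2 :=
    (Complex.abs_re_le_norm _).trans (by rw [norm_mul, he, norm_pow, hω₀, one_mul])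
  have t1 := habs h.one ((Complex.abs_re_le_norm e).trans he.le) hK
  have t2 := habs h.two hA hK
  have t3 := habs (a := -τ) (by rwa [abs_neg]) hA hT0
  have t4 := habs h.three hB hK
  have hKr0 : K * r ≤ 1 / 16 := by linarith
  have t5 : r ^ 3 * ∑ j, b j ^ 4 ≤ r ^ 2 * (1 / 16) := by
    calc r ^ 3 * ∑ j, b j ^ 4 ≤ r ^ 3 * K := mul_le_mul_of_nonneg_left h.four (by positivity)
      _ = r ^ 2 * (K * r) := by ring
      _ ≤ _ := mul_le_mul_of_nonneg_left hKr0 (by positivity)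
  have t6 : K * r ^ 2 ≤ r * (1 / 16) := by
    calc K * r ^ 2 = r * (K * r) := by ring
      _ ≤ _ := mul_le_mul_of_nonneg_left hKr0 hr0
  have t7 : r * (2 * (M + 2 * T + 2)) ≤ r ^ 2 := by
    rw [pow_two]; exact mul_le_mul_of_nonneg_left hr hr0
  have t8 : K ≤ 1 / 16 := by
    have := mul_le_mul_of_nonneg_left hr4 hK
    linarith
  have t9 : 0 ≤ M * r := by positivity
  have t10 : 0 ≤ T * r := by positivity
  linarith

/-- The quantity is close to `r - τ`: the difference of `k₂` and half the second power sum is near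
`-τ`, and the third power sum, near one, enters with the factor `r`. -/
theorem CubicApprox.curvature_ge {n : ℕ} {k₀ k₁ k₂ : ℝ} {b : Fin n → ℝ} {τ u K T r : ℝ}
    (h : CubicApprox k₀ k₁ k₂ b τ u K) (hT : |τ| ≤ T) (hr : 2 * (2 * T + 2) ≤ r)
    (hKr : 16 * (K * r) ≤ 1) : 1 ≤ k₂ - (∑ j, b j ^ 2 / (1 + b j * r) ^ 2) / 2 := by
  have hK := h.nonneg
  have hT0 : 0 ≤ T := (abs_nonneg _).trans hT
  have hr0 : 0 ≤ r := by linarith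
  have hbr : ∀ j, |b j * r| ≤ 1 / 2 := fun j => by
    rw [abs_mul, abs_of_nonneg hr0]
    have := mul_le_mul_of_nonneg_right (h.le j) hr0
    linarith
  have hcurv := sum_sq_div_le hbr
  have hKr0 : K * r ≤ 1 / 16 := by linarith
  have t1 : r ^ 2 * ∑ j, b j ^ 4 ≤ r * (1 / 16) := by
    calc r ^ 2 * ∑ j, b j ^ 4 ≤ r ^ 2 * K := mul_le_mul_of_nonneg_left h.four (by positivity)
      _ = r * (K * r) := by ring
      _ ≤ _ := mul_le_mul_of_nonneg_left hKr0 hr0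
  have t2 : r * (1 - K) ≤ r * ∑ j, b j ^ 3 :=
    mul_le_mul_of_nonneg_left (by linarith [(abs_le.1 h.three).1]) hr0
  have t3 : K ≤ 1 / 16 := by
    have := mul_le_mul_of_nonneg_left (by linarith : 4 ≤ r) hK
    linarith
  linarith [(abs_le.1 h.two).1, (abs_le.1 hT).2]

/-- Valid on the whole ray, unlike a Taylor expansion. The slope term is nonnegative. Since `Re (e²)
= 1/2`, the quadratic exponential gives `k₂ s²/2`, the factors cost at most `s²/4` times the
curvature sum, and `curvature_ge` bounds the difference below by `s²/2`. -/
theorem CubicApprox.le_norm_ray {n : ℕ} {k₀ k₁ k₂ : ℝ} {b : Fin n → ℝ} {τ u K T M r : ℝ}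
    (h : CubicApprox k₀ k₁ k₂ b τ u K) (hT : |τ| ≤ T) (hM : 0 ≤ M) (hr : 2 * (M + 2 * T + 2) ≤ r)
    (hKr : 16 * (K * r) ≤ 1) {ω₀ e : ℂ} (he : ‖e‖ = 1)
    (hω : (ω₀ * (starRingEnd ℂ) e).im = -r / 2) (hei : e.im = 1 / 2) (hω₀ : ‖ω₀‖ = r)
    (hω₂ : 3 / 4 * r ^ 2 ≤ (e * ω₀ ^ 2).re) (hu : u * e.re ≤ M * r) {s : ℝ} (hs : 0 ≤ s) :
    ‖expProd k₀ k₁ k₂ b ω₀‖ * Real.exp (s ^ 2 / 2) ≤ ‖expProd k₀ k₁ k₂ b (ω₀ + s * e)‖ := by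
  have hK := h.nonneg
  have hr0 : 0 ≤ r := hω₀ ▸ norm_nonneg ω₀
  have hbr : ∀ j, |b j * r| ≤ 1 / 2 := fun j => by
    rw [abs_mul, abs_of_nonneg hr0]
    have := mul_le_mul_of_nonneg_right (h.le j) hr0
    linarith
  have hslope := h.slope_ge hT hM hr hKr he hω₀ hω₂ hu
  have hcurv := h.curvature_ge hT (by linarith) hKr
  have hprod : (∏ j, ‖1 + (b j : ℂ) * ω₀‖) * Real.exp
      (s * ∑ j, ((b j : ℂ) * e / (1 + b j * ω₀)).re
        - s ^ 2 / 4 * ∑ j, b j ^ 2 / (1 + b j * r) ^ 2) ≤ ∏ j, ‖1 + (b j : ℂ) * (ω₀ + s * e)‖ := by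
    rw [Finset.mul_sum, Finset.mul_sum, ← Finset.sum_sub_distrib, Real.exp_sum,
      ← Finset.prod_mul_distrib]
    exact Finset.prod_le_prod (fun j _ => by positivity)
      fun j _ => le_norm_one_add_mul_ray (hbr j) he hω hei hs
  have hquad : ‖quadExp k₀ k₁ k₂ (ω₀ + s * e)‖ = ‖quadExp k₀ k₁ k₂ ω₀‖ *
      Real.exp (s * (k₁ * e.re + 2 * k₂ * (e * ω₀).re) + s ^ 2 / 2 * k₂) := by
    have hn : e.re ^ 2 = 3 / 4 := by
      have h5 := Complex.normSq_eq_norm_sq e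
      rw [he, Complex.normSq_apply, hei] at h5
      linarith
    rw [norm_quadExp, norm_quadExp, ← Real.exp_add]
    congr 1
    simp only [Complex.add_re, Complex.add_im, Complex.mul_im, Complex.mul_re, Complex.ofReal_re,
      Complex.ofReal_im, hei]
    linear_combination (k₂ * s ^ 2) * hn
  rw [expProd, expProd, norm_mul, norm_mul, norm_prod, norm_prod, hquad]
  set D := ∑ j, ((b j : ℂ) * e / (1 + b j * ω₀)).re
  set E := ∑ j, b j ^ 2 / (1 + b j * r) ^ 2
  set P := ∏ j, ‖1 + (b j : ℂ) * ω₀‖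
  have hP : 0 ≤ P := Finset.prod_nonneg fun j _ => norm_nonneg _
  calc _ = ‖quadExp k₀ k₁ k₂ ω₀‖ * P * Real.exp (s ^ 2 / 2) := by ring
    _ ≤ ‖quadExp k₀ k₁ k₂ ω₀‖ * P * Real.exp
        ((s * (k₁ * e.re + 2 * k₂ * (e * ω₀).re) + s ^ 2 / 2 * k₂)
        + (s * D - s ^ 2 / 4 * E)) := by
        refine mul_le_mul_of_nonneg_left (Real.exp_le_exp.2 ?_) (by positivity)
        have t1 := mul_nonneg hs hslope
        have t2 := mul_le_mul_of_nonneg_left hcurv (by positivity : 0 ≤ s ^ 2 / 2)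
        linarith
    _ = ‖quadExp k₀ k₁ k₂ ω₀‖ * Real.exp
        (s * (k₁ * e.re + 2 * k₂ * (e * ω₀).re) + s ^ 2 / 2 * k₂) *
        (P * Real.exp (s * D - s ^ 2 / 4 * E)) := by rw [Real.exp_add]; ring
    _ ≤ _ := by gcongr

/-! ### The contours -/

/-- The contour that encloses the left half of the poles, in the Airy scaling. -/
def leftGraph (R : ℝ) (hR : 0 ≤ R) : VGraph := ⟨-R, -√3, √3 * R, by positivity⟩

/-- The contour that encloses the right half of the poles, in the Airy scaling. -/
def rightGraph (r : ℝ) : VGraph := ⟨r, √3, 0, le_rfl⟩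

theorem sq_sqrt_three : √3 ^ 2 = (3 : ℝ) := Real.sq_sqrt (by norm_num)

theorem leftGraph_m_sq {R : ℝ} (hR : 0 ≤ R) : (leftGraph R hR).m ^ 2 = 3 := by
  simp [leftGraph]

theorem rightGraph_m_sq (r : ℝ) : (rightGraph r).m ^ 2 = 3 := by
  simp [rightGraph]

theorem VGraph.curve_neg (g : VGraph) (y : ℝ) : g.curve (-y) = (starRingEnd ℂ) (g.curve y) := by
  simp [VGraph.curve]

theorem expProd_conj {n : ℕ} (k₀ k₁ k₂ : ℝ) (b : Fin n → ℝ) (ζ : ℂ) :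
    expProd k₀ k₁ k₂ b ((starRingEnd ℂ) ζ) = (starRingEnd ℂ) (expProd k₀ k₁ k₂ b ζ) := by
  simp [expProd, quadExp, ← Complex.exp_conj]

theorem norm_expProd_curve_abs {n : ℕ} (k₀ k₁ k₂ : ℝ) (b : Fin n → ℝ) (g : VGraph) (y : ℝ) :
    ‖expProd k₀ k₁ k₂ b (g.curve |y|)‖ = ‖expProd k₀ k₁ k₂ b (g.curve y)‖ := by
  rcases abs_choice y with h | h
  · rw [h]
  · rw [h, VGraph.curve_neg, expProd_conj, Complex.norm_conj]

/-- The constant in the bounds on the contours. -/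
def contourConst (R T : ℝ) : ℝ := Real.exp (8 * R ^ 3 / 3 + 4 * T * R ^ 2 + 6 * R ^ 2 + 1)

theorem contourConst_pos (R T : ℝ) : 0 < contourConst R T := Real.exp_pos _

/-- The value at the real point `R` comes from the cubic approximation and supplies `exp (-R v)`.
Moving up the line costs nothing, since the Gaussian coefficient, near `R - τ`, is at least one. -/
theorem CubicApprox.norm_vertical_le {n : ℕ} {k₀ k₁ k₂ : ℝ} {b : Fin n → ℝ} {τ v K T R : ℝ}
    (h : CubicApprox k₀ k₁ k₂ b τ v K) (hT : |τ| ≤ T) (hR : T + 2 ≤ R)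
    (hK : 200 * K * (1 + 2 * R) ^ 4 ≤ 1) (η : ℝ) :
    ‖expProd k₀ k₁ k₂ b (R + η * Complex.I)‖
      ≤ contourConst R T * Real.exp (-R * v) * Real.exp (-η ^ 2) := by
  have hK0 := h.nonneg
  have hT0 : 0 ≤ T := (abs_nonneg _).trans hT
  have hKR : 200 * K * (1 + R) ^ 4 ≤ 1 := by
    refine le_trans ?_ hK
    have : R ≤ 2 * R := by linarith
    have : 0 ≤ 1 + R := by linarith
    gcongr
  have hp : K * (1 + R + 4 * R ^ 2) ≤ 1 / 50 := by
    have h1 : 1 + R + 4 * R ^ 2 ≤ 4 * (1 + R) ^ 4 := by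
      nlinarith [pow_nonneg (by linarith : 0 ≤ R) 3, pow_nonneg (by linarith : 0 ≤ R) 4]
    nlinarith
  have hKr : K * R ≤ 1 / 2 := by nlinarith [mul_nonneg hK0 (sq_nonneg R)]
  have hbr : ∀ j, |b j * R| ≤ 1 / 2 := fun j => by
    rw [abs_mul, abs_of_nonneg (by linarith : (0 : ℝ) ≤ R)]
    have := mul_le_mul_of_nonneg_right (h.le j) (by linarith : (0 : ℝ) ≤ R)
    linarith
  have h2 := abs_le.1 h.two
  have h3 := abs_le.1 h.three
  have hτ := abs_le.1 hT
  have hcoef : 1 ≤ k₂ - (∑ j, b j ^ 2) / 2 + R * ∑ j, b j ^ 3 - 4 * R ^ 2 * ∑ j, b j ^ 4 := by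
    have t1 : R * (1 - K) ≤ R * ∑ j, b j ^ 3 := mul_le_mul_of_nonneg_left (by linarith [h3.1])
        (by linarith)
    have t2 : R ^ 2 * ∑ j, b j ^ 4 ≤ R ^ 2 * K := mul_le_mul_of_nonneg_left h.four (by positivity)
    nlinarith
  have hnR : ‖(R : ℂ)‖ = R := by rw [Complex.norm_real, Real.norm_of_nonneg (by linarith)]
  obtain ⟨Δ, hΔ, hΔn⟩ := h.exists_eq_mul_exp (ζ := (R : ℂ)) (Or.inl (by rwa [hnR]))
  have hA : ‖expProd k₀ k₁ k₂ b R‖ ≤ contourConst R T * Real.exp (-R * v) := by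
    rw [hΔ, norm_mul, norm_cubicExp, Complex.norm_exp, contourConst, ← Real.exp_add, ← Real.exp_add]
    refine Real.exp_le_exp.2 ?_
    have h5 : Δ.re ≤ 1 := (Complex.re_le_norm _).trans (hΔn.trans (by rwa [hnR]))
    simp only [Complex.ofReal_re, Complex.ofReal_im]
    have t1 : -τ * R ^ 2 ≤ T * R ^ 2 := mul_le_mul_of_nonneg_right (by linarith) (by positivity)
    have t2 : 0 ≤ T * R ^ 2 := by positivity
    have t3 : 0 ≤ R ^ 3 := pow_nonneg (by linarith) 3
    nlinarith [sq_nonneg R]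
  refine (norm_expProd_vertical_le k₀ k₁ k₂ hbr η).trans ?_
  refine mul_le_mul hA (Real.exp_le_exp.2 ?_) (Real.exp_pos _).le
    (mul_nonneg (contourConst_pos R T).le (Real.exp_pos _).le)
  nlinarith [sq_nonneg η]

theorem norm_cubicExp_vertical_le {τ v T R : ℝ} (hT : |τ| ≤ T) (hR : T + 2 ≤ R) (η : ℝ) :
    ‖cubicExp τ v (R + η * Complex.I)‖
      ≤ contourConst R T * Real.exp (-R * v) * Real.exp (-η ^ 2) := by
  have hT0 : 0 ≤ T := (abs_nonneg _).trans hT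
  have hτ := abs_le.1 hT
  rw [norm_cubicExp, contourConst, ← Real.exp_add, ← Real.exp_add]
  refine Real.exp_le_exp.2 ?_
  simp only [Complex.add_re, Complex.ofReal_re, Complex.mul_re, Complex.I_re, mul_zero,
      Complex.ofReal_im, Complex.I_im, mul_one, sub_self, add_zero, Complex.add_im, Complex.mul_im,
      zero_add]
  have t1 : -τ * R ^ 2 ≤ T * R ^ 2 := mul_le_mul_of_nonneg_right (by linarith) (by positivity)
  have t2 : 0 ≤ T * R ^ 2 := by positivity
  have t3 : 0 ≤ R ^ 3 := pow_nonneg (by linarith) 3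
  have t4 : τ * η ^ 2 ≤ (R - 2) * η ^ 2 :=
    mul_le_mul_of_nonneg_right (by linarith) (by positivity)
  nlinarith [sq_nonneg R, sq_nonneg η]

/-- Points on the left contour above the real axis are on a ray. -/
theorem leftGraph_curve_eq {R y : ℝ} (hR : 0 ≤ R) (hy : √3 * R ≤ y) :
    (leftGraph R hR).curve y = (⟨-R, √3 * R⟩ : ℂ) + (2 * (y - √3 * R) : ℝ) * (⟨-√3 / 2,
        1 / 2⟩ : ℂ) := by
  have h0 : 0 ≤ √3 * R := by positivity
  refine Complex.ext ?_ ?_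
  · simp [leftGraph, VGraph.x, abs_of_nonneg (h0.trans hy), max_eq_left (sub_nonneg.2 hy)]
    ring
  · simp
    ring

theorem rightGraph_curve_eq {r y : ℝ} (hy : 0 ≤ y) :
    (rightGraph r).curve y = (r : ℂ) + (2 * y : ℝ) * (⟨√3 / 2, 1 / 2⟩ : ℂ) := by
  refine Complex.ext ?_ ?_
  · simp [rightGraph, VGraph.x, abs_of_nonneg hy, max_eq_left hy]
    ring
  · simp
    ring

theorem leftGraph_x_of_le {R y : ℝ} (hR : 0 ≤ R) (hy : |y| ≤ √3 * R) :
    (leftGraph R hR).x y = -R := by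
  simp [leftGraph, VGraph.x, hy]

theorem norm_dir {s : ℝ} (hs : s ^ 2 = 3) : ‖(⟨s / 2, 1 / 2⟩ : ℂ)‖ = 1 := by
  rw [Complex.norm_def, Complex.normSq_mk, Real.sqrt_eq_one]
  linear_combination hs / 4

/-- Within radius `2R` the correction `Δ` has norm at most one, so only the cubic polynomial
matters; its linear term, with `Re ω = -R`, gives `exp (-R u)`. -/
theorem CubicApprox.norm_inv_segment_le {n : ℕ} {k₀ k₁ k₂ : ℝ} {b : Fin n → ℝ} {τ u K T R : ℝ}
    (h : CubicApprox k₀ k₁ k₂ b τ u K) (hT : |τ| ≤ T)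
    (hK : 200 * K * (1 + 2 * R) ^ 4 ≤ 1) {ω : ℂ} (hω : ω.re = -R) (hωn : ‖ω‖ ≤ 2 * R) :
    ‖(expProd k₀ k₁ k₂ b ω)⁻¹‖
      ≤ Real.exp (8 * R ^ 3 / 3 + 4 * T * R ^ 2 + 1) * Real.exp (-R * u) := by
  have hK0 := h.nonneg
  have hT0 : 0 ≤ T := (abs_nonneg _).trans hT
  have hKR : 200 * K * (1 + ‖ω‖) ^ 4 ≤ 1 := by
    refine le_trans ?_ hK
    gcongr
  have hKr : K * ‖ω‖ ≤ 1 / 2 := by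
    have h1 : 1 + ‖ω‖ ≤ (1 + ‖ω‖) ^ 4 :=
      le_self_pow₀ (by linarith [norm_nonneg ω]) (by norm_num)
    nlinarith
  obtain ⟨Δ, hΔ, hΔn⟩ := h.exists_eq_mul_exp (ζ := ω) (Or.inl hKr)
  have h5 : -1 ≤ Δ.re := by
    have := (Complex.abs_re_le_norm Δ).trans (hΔn.trans hKR)
    exact (abs_le.1 this).1
  have hc : -(8 * R ^ 3 / 3) - 4 * T * R ^ 2 + R * u ≤ (ω ^ 3 / 3 - τ * ω ^ 2 - u * ω).re := by
    have e1 : -((2 * R) ^ 3 / 3) ≤ (ω ^ 3 / 3).re := by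
      have : ‖ω ^ 3 / 3‖ ≤ (2 * R) ^ 3 / 3 := by
        rw [norm_div, norm_pow, Complex.norm_ofNat]
        gcongr
      exact (abs_le.1 ((Complex.abs_re_le_norm _).trans this)).1
    have e2 : (τ * ω ^ 2 : ℂ).re ≤ T * (2 * R) ^ 2 := by
      refine (Complex.re_le_norm _).trans ?_
      rw [norm_mul, norm_pow, Complex.norm_real, Real.norm_eq_abs]
      gcongr
    rw [Complex.sub_re, Complex.sub_re, Complex.re_ofReal_mul u, hω]
    nlinarith
  rw [hΔ, cubicExp, ← Complex.exp_add, ← Complex.exp_neg, Complex.norm_exp, ← Real.exp_add]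
  refine Real.exp_le_exp.2 ?_
  rw [Complex.neg_re, Complex.add_re]
  linarith

/-- On the vertical segment the cubic approximation is accurate. Beyond the corner, the growth of
`expProd` along the ray gives the decay of its inverse. -/
theorem CubicApprox.norm_inv_left_le {n : ℕ} {k₀ k₁ k₂ : ℝ} {b : Fin n → ℝ} {τ u K T M R : ℝ}
    (h : CubicApprox k₀ k₁ k₂ b τ u K) (hT : |τ| ≤ T) (hM : 0 ≤ M) (hR : M + 2 * T + 2 ≤ R)
    (hR0 : 0 ≤ R) (hu : -M ≤ u) (hK : 200 * K * (1 + 2 * R) ^ 4 ≤ 1) (y : ℝ) :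
    ‖(expProd k₀ k₁ k₂ b ((leftGraph R hR0).curve y))⁻¹‖
      ≤ contourConst R T * Real.exp (-R * u) * Real.exp (-y ^ 2) := by
  have hK0 := h.nonneg
  have hT0 : 0 ≤ T := (abs_nonneg _).trans hT
  have hR1 : 1 ≤ R := by linarith
  rw [norm_inv, ← norm_expProd_curve_abs, ← norm_inv, ← sq_abs y]
  set t := |y| with ht
  have ht0 : 0 ≤ t := abs_nonneg y
  rcases le_total t (√3 * R) with hy | hy
  · have h1 := h.norm_inv_segment_le hT hK (ω := (leftGraph R hR0).curve t)
      (by simp [leftGraph_x_of_le hR0 (by rwa [abs_of_nonneg ht0])]) (by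
        rw [Complex.norm_def, Complex.normSq_apply]
        refine Real.sqrt_le_iff.2 ⟨by linarith, ?_⟩
        simp only [VGraph.curve_re, VGraph.curve_im,
          leftGraph_x_of_le hR0 (by rwa [abs_of_nonneg ht0])]
        nlinarith [sq_sqrt_three])
    refine h1.trans ?_
    rw [contourConst, ← Real.exp_add, ← Real.exp_add, ← Real.exp_add]
    refine Real.exp_le_exp.2 ?_
    nlinarith [sq_sqrt_three]
  · have h1 := h.norm_inv_segment_le hT hK (ω := ⟨-R, √3 * R⟩) rfl (by
        rw [Complex.norm_def, Complex.normSq_mk]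
        refine Real.sqrt_le_iff.2 ⟨by linarith, ?_⟩
        nlinarith [sq_sqrt_three])
    have h3 : 3 / 4 ≤ √3 / 2 := by
      have : 3 / 2 ≤ √3 := Real.le_sqrt_of_sq_le (by norm_num)
      linarith
    -- The corner is `2R e^{2πi/3}` and the ray points in direction `e^{5πi/6}`; prolonged backwards
    -- it meets the real axis at `2R`, whence this value of `r`. Then `e ω₀²` has argument `π/6`
    -- modulo `2π`.
    have h2 := h.le_norm_ray hT hM (r := 2 * R) (by linarith) (by
        nlinarith [pow_nonneg hR0 2, pow_nonneg hR0 3, pow_nonneg hR0 4,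
          mul_nonneg hK0 (pow_nonneg hR0 2), mul_nonneg hK0 (pow_nonneg hR0 3),
          mul_nonneg hK0 (pow_nonneg hR0 4), mul_nonneg hK0 hR0])
      (ω₀ := ⟨-R, √3 * R⟩) (e := ⟨-√3 / 2, 1 / 2⟩) (norm_dir (by rw [neg_sq, sq_sqrt_three]))
      (by
        simp only [Complex.mul_im, Complex.conj_re, Complex.conj_im]
        linear_combination (-R / 2) * sq_sqrt_three) rfl
      (by
        rw [Complex.norm_def, Complex.normSq_mk, ← Real.sqrt_sq (by linarith : 0 ≤ 2 * R)]
        congr 1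
        linear_combination R ^ 2 * sq_sqrt_three)
      (by
        have e : ((⟨-√3 / 2, 1 / 2⟩ : ℂ) * (⟨-R, √3 * R⟩ : ℂ) ^ 2).re = √3 / 2 * (2 * R) ^ 2 := by
          simp only [pow_two, Complex.mul_re, Complex.mul_im]
          linear_combination (√3 / 2 * R ^ 2) * sq_sqrt_three
        rw [e]
        gcongr)
      (by
        simp only
        have h5 : √3 ≤ 2 := Real.sqrt_le_iff.2 ⟨by norm_num, by norm_num⟩
        nlinarith [Real.sqrt_nonneg 3])
      (s := 2 * (t - √3 * R)) (by linarith)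
    rw [leftGraph_curve_eq hR0 hy]
    have hpos : 0 < ‖expProd k₀ k₁ k₂ b ⟨-R, √3 * R⟩‖ := by
      obtain ⟨Δ, hΔ, -⟩ := h.exists_eq_mul_exp (ζ := ⟨-R, √3 * R⟩) (Or.inr (by
        rw [Complex.norm_def, Complex.normSq_mk, abs_of_nonneg (by positivity), div_le_iff₀
            (by norm_num)]
        refine Real.sqrt_le_iff.2 ⟨by positivity, ?_⟩
        nlinarith [sq_sqrt_three]))
      rw [hΔ]
      simp [cubicExp]
    rw [norm_inv] at h1 ⊢
    have h4 : ‖expProd k₀ k₁ k₂ b ((⟨-R, √3 * R⟩ : ℂ) + (2 * (t - √3 * R) : ℝ)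
        * (⟨-√3 / 2, 1 / 2⟩ : ℂ))‖⁻¹ ≤ ‖expProd k₀ k₁ k₂ b ⟨-R, √3 * R⟩‖⁻¹ *
          Real.exp (-((2 * (t - √3 * R)) ^ 2 / 2)) := by
      rw [Real.exp_neg, ← mul_inv]
      exact inv_anti₀ (by positivity) h2
    refine h4.trans ((mul_le_mul_of_nonneg_right h1 (Real.exp_pos _).le).trans ?_)
    rw [contourConst, ← Real.exp_add, ← Real.exp_add, ← Real.exp_add, ← Real.exp_add]
    refine Real.exp_le_exp.2 ?_
    have := sq_nonneg (t - 2 * (√3 * R))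
    nlinarith [sq_sqrt_three]

theorem norm_inv_cubicExp_left_le {τ u T R : ℝ} (hT : |τ| ≤ T) (hR : T + 2 ≤ R) (hR0 : 0 ≤ R)
    (hu : 0 ≤ u + (R - 2)) (y : ℝ) :
    ‖(cubicExp τ u ((leftGraph R hR0).curve y))⁻¹‖
      ≤ contourConst R T * Real.exp (-R * u) * Real.exp (-y ^ 2) := by
  have hT0 : 0 ≤ T := (abs_nonneg _).trans hT
  have hτ := abs_le.1 hT
  have h3 := sq_sqrt_three
  have h0 := Real.sqrt_nonneg 3
  rw [norm_inv, norm_cubicExp, ← Real.exp_neg, contourConst, ← Real.exp_add, ← Real.exp_add,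
    VGraph.curve_re, VGraph.curve_im]
  refine Real.exp_le_exp.2 ?_
  have hx : (leftGraph R hR0).x y = -(R + √3 * max (|y| - √3 * R) 0) := by
    simp [leftGraph, VGraph.x]; ring
  rw [hx, ← sq_abs y]
  rcases le_total |y| (√3 * R) with hy | hy
  · rw [max_eq_right (by linarith)]
    have hy2 : |y| ^ 2 ≤ 3 * R ^ 2 := by
      calc |y| ^ 2 ≤ (√3 * R) ^ 2 := by gcongr
        _ = 3 * R ^ 2 := by rw [mul_pow, h3]
    have := sq_nonneg |y|
    have t1 : τ * (R ^ 2 - |y| ^ 2) ≤ T * (R ^ 2 + |y| ^ 2) := by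
      have a1 : τ * R ^ 2 ≤ T * R ^ 2 := mul_le_mul_of_nonneg_right hτ.2 (by positivity)
      have a2 : -τ * |y| ^ 2 ≤ T * |y| ^ 2 := mul_le_mul_of_nonneg_right (by linarith)
          (by positivity)
      linarith
    have t2 : T * (R ^ 2 + |y| ^ 2) ≤ T * (4 * R ^ 2) := mul_le_mul_of_nonneg_left (by linarith) hT0
    have t3 : 0 ≤ R * |y| ^ 2 := by positivity
    have t4 : 0 ≤ R ^ 3 := by positivity
    nlinarith
  · rw [max_eq_left (by linarith)]
    obtain ⟨t, ht⟩ : ∃ t, |y| = √3 * R + t := ⟨|y| - √3 * R, by ring⟩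
    have ht0 : 0 ≤ t := by linarith
    rw [ht, add_sub_cancel_left]
    have e1 : ((-(R + √3 * t)) ^ 3 - 3 * -(R + √3 * t) * (√3 * R + t) ^ 2) / 3
        = 8 / 3 * R ^ 3 + 4 * √3 * R ^ 2 * t + 4 * R * t ^ 2 := by
      linear_combination (R ^ 3 + √3 * R ^ 2 * t + R * t ^ 2 - √3 * t ^ 3 / 3) * h3
    have e2 : (-(R + √3 * t)) ^ 2 - (√3 * R + t) ^ 2 = 2 * t ^ 2 - 2 * R ^ 2 := by
      linear_combination (t ^ 2 - R ^ 2) * h3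
    rw [e1, e2]
    have t1 : τ * (2 * t ^ 2 - 2 * R ^ 2) ≤ T * (2 * t ^ 2 + 2 * R ^ 2) := by
      have a1 : τ * t ^ 2 ≤ T * t ^ 2 := mul_le_mul_of_nonneg_right hτ.2 (by positivity)
      have a2 : -τ * R ^ 2 ≤ T * R ^ 2 := mul_le_mul_of_nonneg_right (by linarith) (by positivity)
      linarith
    have t2 : 0 ≤ √3 * t * (u + (R - 2)) := mul_nonneg (by positivity) hu
    have t3 : T * t ^ 2 ≤ (R - 2) * t ^ 2 := mul_le_mul_of_nonneg_right (by linarith)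
        (by positivity)
    have t4 : 0 ≤ √3 * R * t := by positivity
    have t5 : 0 ≤ √3 * R * t * (R - 2) := mul_nonneg t4 (by linarith)
    have t6 : 0 ≤ R ^ 3 := by positivity
    have t7 : 0 ≤ T * R ^ 2 := by positivity
    have t8 : 0 ≤ √3 * t := by positivity
    nlinarith


/-- At the real point `r` the cubic is `r³/3`. The terms in `τ` and `u` cost at most `r³/12`, and so
does the approximation error, leaving `r³/6`. Along the rays the cone condition fails, so the bound
there must come from `le_norm_ray`. -/
theorem CubicApprox.norm_inv_right_le {n : ℕ} {k₀ k₁ k₂ : ℝ} {b : Fin n → ℝ} {τ u K T M r : ℝ}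
    (h : CubicApprox k₀ k₁ k₂ b τ u K) (hT : |τ| ≤ T) (hM : 0 ≤ M) (hr : 12 * (M + T + 1) ≤ r)
    (hKr : 16 * (K * r) ≤ 1) (hKr' : 200 * K * (1 + r) ^ 4 ≤ r ^ 3 / 12) (hu : u ≤ M * r) (y : ℝ) :
    ‖(expProd k₀ k₁ k₂ b ((rightGraph r).curve y))⁻¹‖
      ≤ Real.exp (-(r ^ 3 / 6)) * Real.exp (-y ^ 2) := by
  have hT0 : 0 ≤ T := (abs_nonneg _).trans hT
  have hr0 : 0 ≤ r := by linarith
  have hnr : ‖(r : ℂ)‖ = r := by rw [Complex.norm_real, Real.norm_of_nonneg hr0]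
  obtain ⟨Δ, hΔ, hΔn⟩ := h.exists_eq_mul_exp (ζ := (r : ℂ)) (Or.inl (by rw [hnr]; linarith))
  rw [hnr] at hΔn
  have hA : Real.exp (r ^ 3 / 6) ≤ ‖expProd k₀ k₁ k₂ b r‖ := by
    rw [hΔ, norm_mul, norm_cubicExp, Complex.norm_exp, ← Real.exp_add]
    refine Real.exp_le_exp.2 ?_
    have h1 := (abs_le.1 ((Complex.abs_re_le_norm Δ).trans (hΔn.trans hKr'))).1
    simp only [Complex.ofReal_re, Complex.ofReal_im]
    have t1 : τ * r ^ 2 ≤ T * r ^ 2 :=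
      mul_le_mul_of_nonneg_right (abs_le.1 hT).2 (by positivity)
    have t2 : u * r ≤ M * r * r := mul_le_mul_of_nonneg_right hu hr0
    have t3 : 12 * (M + T + 1) * r ^ 2 ≤ r * r ^ 2 :=
      mul_le_mul_of_nonneg_right hr (by positivity)
    have t4 : 0 ≤ r ^ 2 := by positivity
    nlinarith
  have h3 : 3 / 4 ≤ √3 / 2 := by
    have : 3 / 2 ≤ √3 := Real.le_sqrt_of_sq_le (by norm_num)
    linarith
  have h5 : √3 ≤ 2 := Real.sqrt_le_iff.2 ⟨by norm_num, by norm_num⟩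
  have h2 := h.le_norm_ray hT hM (r := r) (by linarith) hKr
    (ω₀ := (r : ℂ)) (e := ⟨√3 / 2, 1 / 2⟩) (norm_dir sq_sqrt_three)
    (by
      rw [Complex.im_ofReal_mul, Complex.conj_im]
      ring) rfl hnr
    (by
      rw [← Complex.ofReal_pow, Complex.re_mul_ofReal]
      exact mul_le_mul_of_nonneg_right h3 (sq_nonneg r))
    (by
      simp only
      rcases le_total 0 u with hu0 | hu0
      · nlinarith
      · nlinarith [mul_nonneg hM hr0])
    (s := 2 * |y|) (by positivity)
  rw [norm_inv, ← norm_expProd_curve_abs, rightGraph_curve_eq (abs_nonneg y), ← Real.exp_add,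
    show -(r ^ 3 / 6) + -y ^ 2 = -(r ^ 3 / 6 + y ^ 2) by ring, Real.exp_neg]
  refine inv_anti₀ (Real.exp_pos _) (le_trans ?_ h2)
  rw [Real.exp_add]
  gcongr
  rw [mul_pow, sq_abs]
  nlinarith [sq_nonneg y]

theorem one_add_norm_pow_mul_exp_le {x R y : ℝ} (hx0 : 0 ≤ x) (hx : x ≤ R + 3 * |y|) :
    (1 + x) ^ 4 * Real.exp (-y ^ 2) ≤ 24 * Real.exp (R + 11 / 2) * Real.exp (-(1 / 2) * y ^ 2) := by
  have h1 := Real.pow_div_factorial_le_exp (1 + x) (by linarith) 4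
  rw [div_le_iff₀ (by positivity)] at h1
  norm_num [Nat.factorial] at h1
  calc (1 + x) ^ 4 * Real.exp (-y ^ 2) ≤ (Real.exp (1 + x) * 24) * Real.exp (-y ^ 2) := by gcongr
    _ = 24 * Real.exp (1 + x + -y ^ 2) := by rw [Real.exp_add _ (-y ^ 2)]; ring
    _ ≤ 24 * Real.exp (R + 11 / 2 + -(1 / 2) * y ^ 2) := by
        refine mul_le_mul_of_nonneg_left (Real.exp_le_exp.2 ?_) (by norm_num)
        nlinarith [sq_nonneg (|y| - 3), sq_abs y]
    _ = _ := by rw [Real.exp_add _ (-(1 / 2) * y ^ 2)]; ring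

/-- The constant in the comparison with the cubic exponential. -/
def diffConst (R T : ℝ) : ℝ := 400 * (24 * Real.exp (R + 11 / 2)) * contourConst R T

theorem diffConst_pos (R T : ℝ) : 0 < diffConst R T :=
  mul_pos (by positivity) (contourConst_pos R T)

/-- Half of the Gaussian decay is spent on the factor `(1 + x)⁴`, which makes the error uniformly of
order `K` along the contour. -/
theorem norm_sub_le_of_eq_mul_exp {A a Δ : ℂ} {K x B c y R T : ℝ} (hK : 0 ≤ K) (hB : 0 ≤ B)
    (hc : c = contourConst R T) (h : A = a * Complex.exp Δ) (hΔ : ‖Δ‖ ≤ 200 * K * (1 + x) ^ 4)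
    (hA : ‖A‖ ≤ c * B * Real.exp (-y ^ 2)) (ha : ‖a‖ ≤ c * B * Real.exp (-y ^ 2)) (hx0 : 0 ≤ x)
    (hx : x ≤ R + 3 * |y|) :
    ‖A - a‖ ≤ diffConst R T * K * B * Real.exp (-(1 / 2) * y ^ 2) := by
  have h1 := norm_mul_exp_sub_le h hΔ hA ha
  have hc0 : 0 ≤ c := hc ▸ (contourConst_pos R T).le
  calc ‖A - a‖ ≤ (400 * c * K * B) * ((1 + x) ^ 4 * Real.exp (-y ^ 2)) := by
        refine h1.trans (le_of_eq ?_); ring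
    _ ≤ (400 * c * K * B) * (24 * Real.exp (R + 11 / 2) * Real.exp (-(1 / 2) * y ^ 2)) :=
        mul_le_mul_of_nonneg_left (one_add_norm_pow_mul_exp_le hx0 hx) (by positivity)
    _ = _ := by rw [diffConst, ← hc]; ring

theorem exp_neg_sq_le (y : ℝ) : Real.exp (-y ^ 2) ≤ Real.exp (-(1 / 2) * y ^ 2) :=
  Real.exp_le_exp.2 (by nlinarith [sq_nonneg y])

theorem CubicApprox.norm_sub_vertical_le {n : ℕ} {k₀ k₁ k₂ : ℝ} {b : Fin n → ℝ}
    {τ v K T R : ℝ} (h : CubicApprox k₀ k₁ k₂ b τ v K) (hT : |τ| ≤ T) (hR : T + 2 ≤ R)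
    (hK : 200 * K * (1 + 2 * R) ^ 4 ≤ 1) (η : ℝ) :
    ‖expProd k₀ k₁ k₂ b (R + η * Complex.I) - cubicExp τ v (R + η * Complex.I)‖
      ≤ diffConst R T * K * Real.exp (-R * v) * Real.exp (-(1 / 2) * η ^ 2) := by
  have hK0 := h.nonneg
  have hT0 : 0 ≤ T := (abs_nonneg _).trans hT
  have hR0 : 0 ≤ R := by linarith
  have hn : ‖(R : ℂ) + η * Complex.I‖ ≤ R + |η| := by
    refine (norm_add_le _ _).trans ?_
    simp [abs_of_nonneg hR0]
  have hcone : K * ‖(R : ℂ) + η * Complex.I‖ ≤ 1 / 2 ∨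
      ‖(R : ℂ) + η * Complex.I‖ / 2 ≤ |((R : ℂ) + η * Complex.I).im| := by
    rcases le_total |η| R with hη | hη
    · left
      have h1 : 1 + 2 * R ≤ (1 + 2 * R) ^ 4 := le_self_pow₀ (by linarith) (by norm_num)
      have h2 : K * (1 + 2 * R) ≤ K * (1 + 2 * R) ^ 4 := mul_le_mul_of_nonneg_left h1 hK0
      have h3 : K * ‖(R : ℂ) + η * Complex.I‖ ≤ K * (2 * R) :=
        mul_le_mul_of_nonneg_left (by linarith) hK0
      linarith
    · right
      simp only [Complex.add_im, Complex.ofReal_im, Complex.mul_im, Complex.ofReal_re,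
        Complex.I_im, Complex.I_re, mul_one, mul_zero, add_zero, zero_add]
      linarith
  obtain ⟨Δ, hΔ, hΔn⟩ := h.exists_eq_mul_exp hcone
  exact norm_sub_le_of_eq_mul_exp hK0 (Real.exp_pos _).le rfl hΔ hΔn
    (h.norm_vertical_le hT hR hK η) (norm_cubicExp_vertical_le hT hR η) (norm_nonneg _)
    (hn.trans (by linarith [abs_nonneg η]))

theorem sqrt_three_le_two : √3 ≤ (2 : ℝ) := Real.sqrt_le_iff.2 ⟨by norm_num, by norm_num⟩

theorem leftGraph_abs_x_le {R : ℝ} (hR : 0 ≤ R) (y : ℝ) : |(leftGraph R hR).x y| ≤ R + 2 * |y| := by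
  have h1 : max (|y| - √3 * R) 0 ≤ |y| :=
    max_le (by linarith [mul_nonneg (Real.sqrt_nonneg 3) hR]) (abs_nonneg y)
  have h2 := mul_le_mul sqrt_three_le_two h1 (le_max_right _ _) (by norm_num)
  have h3 := mul_nonneg (Real.sqrt_nonneg 3) (le_max_right (|y| - √3 * R) 0)
  rw [abs_le]
  simp only [leftGraph, VGraph.x]
  constructor <;> linarith [abs_nonneg y]

theorem leftGraph_norm_curve_le {R : ℝ} (hR : 0 ≤ R) (y : ℝ) :
    ‖(leftGraph R hR).curve y‖ ≤ R + 3 * |y| := by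
  refine (Complex.norm_le_abs_re_add_abs_im _).trans ?_
  rw [VGraph.curve_re, VGraph.curve_im]
  linarith [leftGraph_abs_x_le hR y]

/-- The segment stays within radius `2R`, where `K` makes the argument small. On the rays `|x| ≤ √3
|y|`, so they lie in the cone `‖ω‖ ≤ 2|Im ω|`. -/
theorem leftGraph_cone {R K : ℝ} (hR : 0 ≤ R) (hK0 : 0 ≤ K)
    (hK : 200 * K * (1 + 2 * R) ^ 4 ≤ 1) (y : ℝ) :
    K * ‖(leftGraph R hR).curve y‖ ≤ 1 / 2 ∨
      ‖(leftGraph R hR).curve y‖ / 2 ≤ |((leftGraph R hR).curve y).im| := by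
  rw [VGraph.curve_im]
  have hn : ‖(leftGraph R hR).curve y‖ = √((leftGraph R hR).x y ^ 2 + y ^ 2) := by
    rw [Complex.norm_def, Complex.normSq_apply]
    simp [pow_two]
  rcases le_total |y| (√3 * R) with hy | hy
  · left
    have h0 : ‖(leftGraph R hR).curve y‖ ≤ 2 * R := by
      rw [hn, leftGraph_x_of_le hR hy]
      refine Real.sqrt_le_iff.2 ⟨by linarith, ?_⟩
      have : |y| ^ 2 ≤ (√3 * R) ^ 2 := by gcongr
      rw [mul_pow, sq_sqrt_three, sq_abs] at this
      linarith
    have h1 : 1 + 2 * R ≤ (1 + 2 * R) ^ 4 := le_self_pow₀ (by linarith) (by norm_num)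
    have h2 : K * (1 + 2 * R) ≤ K * (1 + 2 * R) ^ 4 := mul_le_mul_of_nonneg_left h1 hK0
    have h3 : K * ‖(leftGraph R hR).curve y‖ ≤ K * (2 * R) := mul_le_mul_of_nonneg_left h0 hK0
    linarith
  · right
    have h1 : |(leftGraph R hR).x y| ≤ √3 * |y| := by
      have e : (leftGraph R hR).x y = -(√3 * |y| - 2 * R) := by
        simp only [leftGraph, VGraph.x, max_eq_left (sub_nonneg.2 hy)]
        linear_combination R * sq_sqrt_three
      have : √3 * (√3 * R) ≤ √3 * |y| := mul_le_mul_of_nonneg_left hy (Real.sqrt_nonneg 3)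
      have h4 : √3 * (√3 * R) = 3 * R := by linear_combination R * sq_sqrt_three
      rw [e, abs_neg, abs_of_nonneg (by linarith)]
      linarith
    have h2 : (leftGraph R hR).x y ^ 2 ≤ 3 * y ^ 2 := by
      rw [← sq_abs, ← sq_abs y]
      calc |(leftGraph R hR).x y| ^ 2 ≤ (√3 * |y|) ^ 2 := by gcongr
        _ = _ := by rw [mul_pow, sq_sqrt_three]
    rw [hn, div_le_iff₀ (by norm_num)]
    refine Real.sqrt_le_iff.2 ⟨by positivity, ?_⟩
    rw [mul_pow, sq_abs]
    linarith

theorem CubicApprox.norm_inv_sub_left_le {n : ℕ} {k₀ k₁ k₂ : ℝ} {b : Fin n → ℝ}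
    {τ u K T M R : ℝ} (h : CubicApprox k₀ k₁ k₂ b τ u K) (hT : |τ| ≤ T) (hM : 0 ≤ M)
    (hR : M + 2 * T + 2 ≤ R) (hR0 : 0 ≤ R) (hu : -M ≤ u) (hK : 200 * K * (1 + 2 * R) ^ 4 ≤ 1)
    (y : ℝ) :
    ‖(expProd k₀ k₁ k₂ b ((leftGraph R hR0).curve y))⁻¹
        - (cubicExp τ u ((leftGraph R hR0).curve y))⁻¹‖
      ≤ diffConst R T * K * Real.exp (-R * u) * Real.exp (-(1 / 2) * y ^ 2) := by
  have hK0 := h.nonneg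
  have hT0 : 0 ≤ T := (abs_nonneg _).trans hT
  obtain ⟨Δ, hΔ, hΔn⟩ := h.exists_eq_mul_exp (leftGraph_cone hR0 hK0 hK y)
  refine norm_sub_le_of_eq_mul_exp (Δ := -Δ) hK0 (Real.exp_pos _).le rfl ?_ (by rwa [norm_neg])
    (h.norm_inv_left_le hT hM hR hR0 hu hK y)
    (norm_inv_cubicExp_left_le hT (by linarith) hR0 (by linarith) y) (norm_nonneg _)
    (leftGraph_norm_curve_le hR0 y)
  rw [hΔ, mul_inv, Complex.exp_neg]

/-! ### Integrals of Cauchy type along a graph -/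

namespace VGraph

variable (g : VGraph)

theorem norm_fullInt_le {f : ℂ → ℂ} {c d : ℝ} {z : ℂ} (hm : |g.m| ≤ 2) (hd : 1 ≤ d)
    (hz : ∀ y, d ≤ ‖z - g.curve y‖)
    (hf : ∀ y, ‖f (g.curve y)‖ ≤ c * Real.exp (-(1 / 2) * y ^ 2)) :
    ‖g.fullInt (fun w => f w * (z - w)⁻¹)‖
      ≤ 3 * c * ∫ y : ℝ, Real.exp (-(1 / 2) * y ^ 2) := by
  rw [← integral_const_mul]
  refine norm_integral_le_of_norm_le ((integrable_exp_neg_mul_sq (by norm_num)).const_mul _)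
    (Eventually.of_forall fun y => ?_)
  have h1 : ‖(z - g.curve y)⁻¹‖ ≤ 1 := by
    rw [norm_inv]
    exact inv_le_one_of_one_le₀ (hd.trans (hz y))
  have h2 : ‖g.vel y‖ ≤ 3 := (g.norm_vel_le y).trans (by linarith)
  have h0 : 0 ≤ c * Real.exp (-(1 / 2) * y ^ 2) := (norm_nonneg _).trans (hf y)
  rw [norm_mul, norm_mul]
  calc _ ≤ (c * Real.exp (-(1 / 2) * y ^ 2)) * 1 * 3 := by
        gcongr
        exact hf y
    _ = _ := by ring

theorem integrable_cauchy {f : ℂ → ℂ} {c d : ℝ} {z : ℂ} (hd : 0 < d)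
    (hz : ∀ y, d ≤ ‖z - g.curve y‖) (hfc : Continuous fun y => f (g.curve y))
    (hf : ∀ y, ‖f (g.curve y)‖ ≤ c * Real.exp (-(1 / 2) * y ^ 2)) :
    Integrable (fun y => f (g.curve y) * (z - g.curve y)⁻¹ * g.vel y) := by
  refine g.integrable_of_bound (f := fun w => f w * (z - w)⁻¹)
    (b := fun y => c * Real.exp (-(1 / 2) * y ^ 2) * d⁻¹) ?_
    (((integrable_exp_neg_mul_sq (by norm_num)).const_mul _).mul_const _) fun y => ?_
  · refine hfc.mul ((continuous_const.sub g.continuous_curve).inv₀ fun y h => ?_)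
    have := hz y
    have h : z - g.curve y = 0 := h
    rw [h, norm_zero] at this
    linarith
  · rw [norm_mul, norm_inv]
    have h0 : 0 ≤ c * Real.exp (-(1 / 2) * y ^ 2) := (norm_nonneg _).trans (hf y)
    gcongr
    · exact hf y
    · exact hz y

theorem differentiableAt_fullInt_cauchy {f : ℂ → ℂ} {c d : ℝ} {z : ℂ} (hd : 0 < d)
    (hz : ∀ y, 2 * d ≤ ‖z - g.curve y‖) (hfc : Continuous fun y => f (g.curve y))
    (hf : ∀ y, ‖f (g.curve y)‖ ≤ c * Real.exp (-(1 / 2) * y ^ 2)) :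
    DifferentiableAt ℂ (fun z => g.fullInt (fun w => f w * (z - w)⁻¹)) z := by
  have hz' : ∀ x ∈ Metric.ball z d, ∀ y, d ≤ ‖x - g.curve y‖ := fun x hx y => by
    have h1 := norm_sub_norm_le (z - g.curve y) (z - x)
    rw [sub_sub_sub_cancel_left] at h1
    have h2 : ‖z - x‖ < d := by rwa [mem_ball_iff_norm, norm_sub_rev] at hx
    linarith [hz y]
  have hmeas : ∀ x ∈ Metric.ball z d, Continuous fun y => f (g.curve y) * (x - g.curve y)⁻¹ :=
    fun x hx => hfc.mul ((continuous_const.sub g.continuous_curve).inv₀ fun y h => by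
      have := hz' x hx y
      have h : x - g.curve y = 0 := h
      rw [h, norm_zero] at this
      linarith)
  have hvel : AEStronglyMeasurable g.vel := g.measurable_vel.aestronglyMeasurable
  refine (hasDerivAt_integral_of_dominated_loc_of_deriv_le
    (F := fun x y => f (g.curve y) * (x - g.curve y)⁻¹ * g.vel y)
    (F' := fun x y => f (g.curve y) * (-((x - g.curve y) ^ 2)⁻¹) * g.vel y)
    (bound := fun y => c * Real.exp (-(1 / 2) * y ^ 2) * (d ^ 2)⁻¹ * (|g.m| + 1))
    (Metric.ball_mem_nhds z hd) ?_ ?_ ?_ ?_ ?_ ?_).2.differentiableAt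
  · filter_upwards [Metric.ball_mem_nhds z hd] with x hx
    exact (hmeas x hx).aestronglyMeasurable.mul hvel
  · exact g.integrable_cauchy hd (hz' z (Metric.mem_ball_self hd)) hfc hf
  · refine (Continuous.aestronglyMeasurable ?_).mul hvel
    refine hfc.mul (Continuous.neg (Continuous.inv₀
        ((continuous_const.sub g.continuous_curve).pow 2)
      fun y h => ?_))
    have := hz' z (Metric.mem_ball_self hd) y
    rw [pow_eq_zero_iff two_ne_zero] at h
    rw [h, norm_zero] at this
    linarith
  · refine Eventually.of_forall fun y x hx => ?_
    have h0 : 0 ≤ c * Real.exp (-(1 / 2) * y ^ 2) := (norm_nonneg _).trans (hf y)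
    rw [norm_mul, norm_mul, norm_neg, norm_inv, norm_pow]
    gcongr
    · exact hf y
    · exact hz' x hx y
    · exact g.norm_vel_le y
  · exact ((((integrable_exp_neg_mul_sq (by norm_num)).const_mul _).mul_const _).mul_const _)
  · refine Eventually.of_forall fun y x hx => ?_
    have hne : x - g.curve y ≠ 0 := fun h => by
      have := hz' x hx y
      rw [h, norm_zero] at this
      linarith
    have h1 := (((hasDerivAt_id x).sub_const (g.curve y)).fun_inv hne).const_mul (f (g.curve y))
    refine (h1.mul_const (g.vel y)).congr_deriv ?_
    simp only [id]
    field_simp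

end VGraph


namespace VGraph

variable (g : VGraph)

theorem fullInt_cauchy_sub {f h : ℂ → ℂ} {c d e : ℝ} {z : ℂ} (hd : 0 < d)
    (hz : ∀ y, d ≤ ‖z - g.curve y‖) (hfc : Continuous fun y => f (g.curve y))
    (hf : ∀ y, ‖f (g.curve y)‖ ≤ c * Real.exp (-(1 / 2) * y ^ 2))
    (hhc : Continuous fun y => h (g.curve y))
    (hh : ∀ y, ‖h (g.curve y)‖ ≤ e * Real.exp (-(1 / 2) * y ^ 2)) :
    g.fullInt (fun w => f w * (z - w)⁻¹) - g.fullInt (fun w => h w * (z - w)⁻¹)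
      = g.fullInt (fun w => (f w - h w) * (z - w)⁻¹) := by
  rw [fullInt, fullInt, fullInt, ← integral_sub (g.integrable_cauchy hd hz hfc hf)
    (g.integrable_cauchy hd hz hhc hh)]
  refine integral_congr_ae (Eventually.of_forall fun y => ?_)
  simp only
  ring

theorem continuous_fullInt_cauchy_line {f : ℂ → ℂ} {c d R : ℝ} (hd : 0 < d)
    (hz : ∀ η y : ℝ, 2 * d ≤ ‖(R : ℂ) + η * Complex.I - g.curve y‖)
    (hfc : Continuous fun y => f (g.curve y))
    (hf : ∀ y, ‖f (g.curve y)‖ ≤ c * Real.exp (-(1 / 2) * y ^ 2)) :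
    Continuous fun η : ℝ => g.fullInt (fun w => f w * ((R : ℂ) + η * Complex.I - w)⁻¹) := by
  refine continuous_iff_continuousAt.2 fun η => ?_
  have h1 := (g.differentiableAt_fullInt_cauchy hd (hz η) hfc hf).continuousAt
  exact ContinuousAt.comp (f := fun η : ℝ => (R : ℂ) + η * Complex.I)
    (g := fun z => g.fullInt (fun w => f w * (z - w)⁻¹)) h1 (by fun_prop)

end VGraph

/-! ### Comparison of the double contour integrals. -/

/-- Stability of a double contour integral under perturbation of the two factors. -/
theorem norm_double_integral_sub_le {gL gR : VGraph} {A a B b : ℂ → ℂ} {R α β K : ℝ}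
    (hα : 0 ≤ α) (hmL : |gL.m| ≤ 2) (hmR : |gR.m| ≤ 2)
    (hzL : ∀ η y : ℝ, 2 ≤ ‖(R : ℂ) + η * Complex.I - gL.curve y‖)
    (hzR : ∀ η y : ℝ, 2 ≤ ‖(R : ℂ) + η * Complex.I - gR.curve y‖)
    (cA : Continuous fun η : ℝ => A (R + η * Complex.I))
    (ca : Continuous fun η : ℝ => a (R + η * Complex.I))
    (cB : Continuous fun y => B (gL.curve y)) (cb : Continuous fun y => b (gL.curve y))
    (cB' : Continuous fun y => B (gR.curve y))
    (hA : ∀ η : ℝ, ‖A (R + η * Complex.I)‖ ≤ α * Real.exp (-(1 / 2) * η ^ 2))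
    (ha : ∀ η : ℝ, ‖a (R + η * Complex.I)‖ ≤ α * Real.exp (-(1 / 2) * η ^ 2))
    (hAa : ∀ η : ℝ, ‖A (R + η * Complex.I) - a (R + η * Complex.I)‖
      ≤ α * K * Real.exp (-(1 / 2) * η ^ 2))
    (hB : ∀ y, ‖B (gL.curve y)‖ ≤ β * Real.exp (-(1 / 2) * y ^ 2))
    (hb : ∀ y, ‖b (gL.curve y)‖ ≤ β * Real.exp (-(1 / 2) * y ^ 2))
    (hBb : ∀ y, ‖B (gL.curve y) - b (gL.curve y)‖ ≤ β * K * Real.exp (-(1 / 2) * y ^ 2))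
    (hB' : ∀ y, ‖B (gR.curve y)‖ ≤ β * K * Real.exp (-(1 / 2) * y ^ 2)) :
    ‖(∫ η : ℝ, A (R + η * Complex.I) *
          (gL.fullInt (fun w => B w * ((R : ℂ) + η * Complex.I - w)⁻¹)
            - gR.fullInt (fun w => B w * ((R : ℂ) + η * Complex.I - w)⁻¹)))
        - ∫ η : ℝ, a (R + η * Complex.I) *
            gL.fullInt (fun w => b w * ((R : ℂ) + η * Complex.I - w)⁻¹)‖
      ≤ 9 * α * β * K * (∫ y : ℝ, Real.exp (-(1 / 2) * y ^ 2)) ^ 2 := by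
  set E := ∫ y : ℝ, Real.exp (-(1 / 2) * y ^ 2) with hE
  have hgauss : Integrable fun y : ℝ => Real.exp (-(1 / 2) * y ^ 2) :=
    integrable_exp_neg_mul_sq (by norm_num)
  have c1 := gL.continuous_fullInt_cauchy_line (R := R) one_pos (by simpa using hzL) cB hB
  have c2 := gL.continuous_fullInt_cauchy_line (R := R) one_pos (by simpa using hzL) cb hb
  have c3 := gR.continuous_fullInt_cauchy_line (R := R) one_pos (by simpa using hzR) cB' hB'
  have n1 : ∀ η : ℝ, _ := fun η =>
    gL.norm_fullInt_le (z := (R : ℂ) + η * Complex.I) hmL one_le_two (hzL η) hB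
  have n2 : ∀ η : ℝ, _ := fun η =>
    gL.norm_fullInt_le (z := (R : ℂ) + η * Complex.I) hmL one_le_two (hzL η) hb
  have n3 : ∀ η : ℝ, _ := fun η =>
    gR.norm_fullInt_le (z := (R : ℂ) + η * Complex.I) hmR one_le_two (hzR η) hB'
  have n4 : ∀ η : ℝ, _ := fun η => gL.norm_fullInt_le (f := fun w => B w - b w)
    (z := (R : ℂ) + η * Complex.I) hmL one_le_two (hzL η) hBb
  have key : ∀ {F G : ℝ → ℂ} {p q : ℝ}, 0 ≤ p → Continuous F → Continuous G →
      (∀ η, ‖F η‖ ≤ p * Real.exp (-(1 / 2) * η ^ 2)) → (∀ η, ‖G η‖ ≤ q) →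
      Integrable fun η => F η * G η := by
    intro F G p q hp hF hG h1 h2
    refine Integrable.mono' ((hgauss.const_mul p).mul_const q)
      (hF.mul hG).aestronglyMeasurable (Eventually.of_forall fun η => ?_)
    rw [norm_mul]
    exact mul_le_mul (h1 η) (h2 η) (norm_nonneg _) (mul_nonneg hp (Real.exp_pos _).le)
  have c4 : Continuous fun η : ℝ => gL.fullInt (fun w => B w * ((R : ℂ) + η * Complex.I - w)⁻¹)
      - gR.fullInt (fun w => B w * ((R : ℂ) + η * Complex.I - w)⁻¹) := c1.sub c3
  have i1 := key hα cA c4 hA fun η =>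
    (norm_sub_le _ _).trans (add_le_add (n1 η) (n3 η))
  have i2 := key hα ca c2 ha n2
  rw [← integral_sub i1 i2]
  refine (norm_integral_le_of_norm_le
    (hgauss.const_mul (9 * α * β * K * E)) (Eventually.of_forall fun η => ?_)).trans
    (le_of_eq (by rw [integral_const_mul]; ring))
  have hsub := gL.fullInt_cauchy_sub (z := (R : ℂ) + η * Complex.I) two_pos (hzL η) cB hB cb hb
  have hK : 0 ≤ α * K * Real.exp (-(1 / 2) * η ^ 2) := (norm_nonneg _).trans (hAa η)
  -- Change one factor at a time: first the outer one, then the inner one on the left graph. The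
  -- right graph is an error term by itself.
  have e : A (R + η * Complex.I) *
          (gL.fullInt (fun w => B w * ((R : ℂ) + η * Complex.I - w)⁻¹)
            - gR.fullInt (fun w => B w * ((R : ℂ) + η * Complex.I - w)⁻¹))
        - a (R + η * Complex.I) *
            gL.fullInt (fun w => b w * ((R : ℂ) + η * Complex.I - w)⁻¹)
      = (A (R + η * Complex.I) - a (R + η * Complex.I)) *
          gL.fullInt (fun w => B w * ((R : ℂ) + η * Complex.I - w)⁻¹)
        + a (R + η * Complex.I) *
          gL.fullInt (fun w => (B w - b w) * ((R : ℂ) + η * Complex.I - w)⁻¹)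
        - A (R + η * Complex.I) *
          gR.fullInt (fun w => B w * ((R : ℂ) + η * Complex.I - w)⁻¹) := by
    rw [← hsub]; ring
  rw [e]
  refine (norm_sub_le _ _).trans ((add_le_add (norm_add_le _ _) le_rfl).trans ?_)
  rw [norm_mul, norm_mul, norm_mul]
  have t1 := mul_le_mul (hAa η) (n1 η) (norm_nonneg _) hK
  have t2 := mul_le_mul (ha η) (n4 η) (norm_nonneg _) (by positivity)
  have t3 := mul_le_mul (hA η) (n3 η) (norm_nonneg _) (by positivity)
  refine (add_le_add (add_le_add t1 t2) t3).trans (le_of_eq ?_)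
  ring

theorem VGraph.expProd_curve_ne_zero (g : VGraph) {n : ℕ} (k₀ k₁ k₂ : ℝ) {b : Fin n → ℝ}
    (hb : ∀ j, |b j * g.a| < 1) (y : ℝ) : expProd k₀ k₁ k₂ b (g.curve y) ≠ 0 := by
  refine mul_ne_zero (quadExp_ne_zero _ _ _ _) (Finset.prod_ne_zero_iff.2 fun j _ h => ?_)
  have h1 := congrArg Complex.re h
  have h2 := congrArg Complex.im h
  simp only [Complex.add_im, Complex.one_im, Complex.im_ofReal_mul, VGraph.curve_im, zero_add,
    Complex.zero_im] at h2
  simp only [Complex.add_re, Complex.one_re, Complex.re_ofReal_mul, VGraph.curve_re,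
    Complex.zero_re] at h1
  have h3 := (abs_lt.1 (hb j)).1
  rcases mul_eq_zero.1 h2 with h2 | h2
  · rw [h2] at h1; norm_num at h1
  · rw [h2, VGraph.x_zero] at h1
    linarith

theorem differentiable_expProd {n : ℕ} (k₀ k₁ k₂ : ℝ) (b : Fin n → ℝ) :
    Differentiable ℂ (expProd k₀ k₁ k₂ b) := by
  refine (differentiable_quadExp _ _ _).mul ?_
  fun_prop

theorem differentiable_cubicExp (τ v : ℝ) : Differentiable ℂ (cubicExp τ v) := by
  unfold cubicExp; fun_prop

theorem cubicExp_ne_zero (τ v : ℝ) (ζ : ℂ) : cubicExp τ v ζ ≠ 0 := Complex.exp_ne_zero _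

/-- The constant in the comparison of the double contour integrals. -/
def kernelConst (R T : ℝ) : ℝ :=
  9 * (contourConst R T + diffConst R T + 1) ^ 2 * (∫ y : ℝ, Real.exp (-(1 / 2) * y ^ 2)) ^ 2

theorem abs_re_sub_le_norm_sub_curve (g : VGraph) (R η y : ℝ) :
    |R - g.x y| ≤ ‖(R : ℂ) + η * Complex.I - g.curve y‖ := by
  have h1 := Complex.abs_re_le_norm ((R : ℂ) + η * Complex.I - g.curve y)
  simpa using h1

/-- All estimates are fed into the stability lemma. The only point not covered by them is the right
graph, whose bound `exp (-r³/6)` is brought to the common form by `hexp`. The contours are at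
distance at least two from the line `Re ζ = R`, so the Cauchy kernel is harmless. -/
theorem CubicApprox.norm_double_integral_sub_le {n : ℕ} {k₀ k₁ k₂ j₀ j₁ j₂ : ℝ} {b : Fin n → ℝ}
    {τ₁ τ₂ u v K T M R r : ℝ} (hw : CubicApprox k₀ k₁ k₂ b τ₁ u K)
    (hz : CubicApprox j₀ j₁ j₂ b τ₂ v K) (hT₁ : |τ₁| ≤ T) (hT₂ : |τ₂| ≤ T) (hM : 0 ≤ M)
    (hR : M + 2 * T + 2 ≤ R) (hR0 : 0 ≤ R) (hK : 200 * K * (1 + 2 * R) ^ 4 ≤ 1)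
    (hr : 12 * (M + T + 1) ≤ r) (hRr : R + 2 ≤ r)
    (hKr : 16 * (K * r) ≤ 1) (hKr' : 200 * K * (1 + r) ^ 4 ≤ r ^ 3 / 12)
    (hu : -M ≤ u) (hu' : u ≤ M * r) (hexp : Real.exp (-(r ^ 3 / 6)) ≤ K * Real.exp (-R * u)) :
    ‖(∫ η : ℝ, expProd j₀ j₁ j₂ b (R + η * Complex.I) *
          ((leftGraph R hR0).fullInt
              (fun w => (expProd k₀ k₁ k₂ b w)⁻¹ * ((R : ℂ) + η * Complex.I - w)⁻¹)
            - (rightGraph r).fullInt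
              (fun w => (expProd k₀ k₁ k₂ b w)⁻¹ * ((R : ℂ) + η * Complex.I - w)⁻¹)))
        - ∫ η : ℝ, cubicExp τ₂ v (R + η * Complex.I) *
            (leftGraph R hR0).fullInt
              (fun w => (cubicExp τ₁ u w)⁻¹ * ((R : ℂ) + η * Complex.I - w)⁻¹)‖
      ≤ kernelConst R T * K * Real.exp (-R * (u + v)) := by
  have hT0 : 0 ≤ T := (abs_nonneg _).trans hT₁
  have hK0 := hw.nonneg
  have hc := contourConst_pos R T
  have hd := diffConst_pos R T
  set c := contourConst R T + diffConst R T + 1 with hcdef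
  have e1 := exp_neg_sq_le
  have up1 : ∀ {x p y : ℝ}, 0 ≤ p → x ≤ contourConst R T * p * Real.exp (-y ^ 2) →
      x ≤ c * p * Real.exp (-(1 / 2) * y ^ 2) := fun {x p y} hp h => h.trans (by
    have := e1 y
    gcongr
    linarith)
  have up2 : ∀ {x p y : ℝ}, 0 ≤ p →
      x ≤ diffConst R T * K * p * Real.exp (-(1 / 2) * y ^ 2) →
      x ≤ c * p * K * Real.exp (-(1 / 2) * y ^ 2) := fun {x p y} hp h => h.trans (by
    rw [mul_right_comm c p K]
    gcongr
    linarith)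
  have pe : ∀ x : ℝ, 0 ≤ Real.exp x := fun x => (Real.exp_pos x).le
  have hKR : K * (1 + 2 * R) ≤ 1 / 200 := by
    have h1 : 1 + 2 * R ≤ (1 + 2 * R) ^ 4 := le_self_pow₀ (by linarith) (by norm_num)
    have h2 : K * (1 + 2 * R) ≤ K * (1 + 2 * R) ^ 4 := mul_le_mul_of_nonneg_left h1 hK0
    linarith
  have hneL := (leftGraph R hR0).expProd_curve_ne_zero k₀ k₁ k₂ (b := b) fun j => by
    rw [abs_mul]
    have : |(leftGraph R hR0).a| = R := by simp [leftGraph, abs_of_nonneg hR0]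
    rw [this]
    have := mul_le_mul_of_nonneg_right (hw.le j) hR0
    nlinarith
  have hneR := (rightGraph r).expProd_curve_ne_zero k₀ k₁ k₂ (b := b) fun j => by
    rw [abs_mul]
    have : |(rightGraph r).a| = r := by
      simp only [rightGraph]
      exact abs_of_nonneg (by linarith)
    rw [this]
    have := mul_le_mul_of_nonneg_right (hw.le j) (by linarith : 0 ≤ r)
    linarith
  have hline : Continuous fun η : ℝ => (R : ℂ) + η * Complex.I := by fun_prop
  have h3 : |√3| ≤ (2 : ℝ) := by
    rw [abs_of_nonneg (Real.sqrt_nonneg 3)]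
    exact sqrt_three_le_two
  have main := NIBM.norm_double_integral_sub_le (gL := leftGraph R hR0) (gR := rightGraph r)
    (A := expProd j₀ j₁ j₂ b) (a := cubicExp τ₂ v) (B := fun w => (expProd k₀ k₁ k₂ b w)⁻¹)
    (b := fun w => (cubicExp τ₁ u w)⁻¹) (R := R) (α := c * Real.exp (-R * v))
    (β := c * Real.exp (-R * u)) (K := K) (by positivity)
    (by simpa only [leftGraph, abs_neg] using h3) (by simpa only [rightGraph] using h3)
    (fun η y => ?_) (fun η y => ?_)
    ((differentiable_expProd _ _ _ _).continuous.comp hline)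
    ((differentiable_cubicExp _ _).continuous.comp hline)
    (((differentiable_expProd _ _ _ _).continuous.comp
      (leftGraph R hR0).continuous_curve).inv₀ hneL)
    (((differentiable_cubicExp _ _).continuous.comp
      (leftGraph R hR0).continuous_curve).inv₀ fun y => cubicExp_ne_zero _ _ _)
    (((differentiable_expProd _ _ _ _).continuous.comp
      (rightGraph r).continuous_curve).inv₀ hneR)
    (fun η => up1 (pe _) (hz.norm_vertical_le hT₂ (by linarith) hK η))
    (fun η => up1 (pe _) (norm_cubicExp_vertical_le hT₂ (by linarith) η))
    (fun η => up2 (pe _) (hz.norm_sub_vertical_le hT₂ (by linarith) hK η))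
    (fun y => up1 (pe _) (hw.norm_inv_left_le hT₁ hM hR hR0 hu hK y))
    (fun y => up1 (pe _) (norm_inv_cubicExp_left_le hT₁ (by linarith) hR0 (by linarith) y))
    (fun y => up2 (pe _) (hw.norm_inv_sub_left_le hT₁ hM hR hR0 hu hK y))
    (fun y => ?_)
  · refine main.trans (le_of_eq ?_)
    rw [kernelConst, mul_add, Real.exp_add, ← hcdef]
    ring
  · refine le_trans ?_ (abs_re_sub_le_norm_sub_curve _ R η y)
    have := (leftGraph R hR0).x_le (by simp [leftGraph]) y
    have h4 : (leftGraph R hR0).a = -R := rfl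
    refine le_trans ?_ (le_abs_self _)
    linarith
  · refine le_trans ?_ (abs_re_sub_le_norm_sub_curve _ R η y)
    have := (rightGraph r).le_x (by simp [rightGraph]) y
    have h4 : (rightGraph r).a = r := rfl
    refine le_trans ?_ (neg_le_abs _)
    linarith
  · refine (hw.norm_inv_right_le hT₁ hM hr hKr hKr' hu' y).trans ?_
    have h4 := e1 y
    have h5 : K * Real.exp (-R * u) ≤ c * Real.exp (-R * u) * K := by
      have : 1 * (K * Real.exp (-R * u)) ≤ c * (K * Real.exp (-R * u)) := by
        gcongr
        linarith
      linarith
    exact mul_le_mul (hexp.trans h5) h4 (pe _) (by positivity)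


/-! ### Deforming the contours of the Airy kernel. -/

namespace VGraph

/-- The graph consisting of two rays from the origin. -/
def wedge (m : ℝ) : VGraph := ⟨0, m, 0, le_rfl⟩

theorem wedge_x (m y : ℝ) : (wedge m).x y = m * |y| := by simp [wedge, x]

theorem wedge_vel_of_pos {m y : ℝ} (hy : 0 < y) : (wedge m).vel y = m + Complex.I := by
  simp [wedge, vel, dx, hy]

theorem wedge_vel_of_neg {m y : ℝ} (hy : y < 0) : (wedge m).vel y = -m + Complex.I := by
  simp [wedge, vel, dx, hy, hy.not_gt]

/-- Two graphs in a region where `f` has primitives carry the same integral if `f` decays on the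
horizontal segments between them. -/
theorem fullInt_eq_fullInt {g k : VGraph} {f : ℂ → ℂ} {U : Set ℂ} (hU : Convex ℝ U)
    (hF : ∀ K ⊆ U, IsCompact K → ∃ F : ℂ → ℂ, ∀ z ∈ K, HasDerivAt F (f z) z)
    (hf : ContinuousOn f U)
    (hg : ∀ y, g.curve y ∈ U) (hk : ∀ y, k.curve y ∈ U)
    (ig : Integrable fun y => f (g.curve y) * g.vel y)
    (ik : Integrable fun y => f (k.curve y) * k.vel y) {B : ℝ → ℝ}
    (hB : ∀ᶠ S in atTop, ∀ y, |y| = S → ∀ z : ℂ, z.re ∈ uIcc (g.x S) (k.x S) → z.im = y →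
      ‖f z‖ ≤ B S)
    (hB0 : Tendsto (fun S => B S * |g.x S - k.x S|) atTop (𝓝 0)) :
    g.fullInt f = k.fullInt f := by
  have hlim := (g.tendsto_partialInt ig).sub (k.tendsto_partialInt ik)
  refine sub_eq_zero.1 (tendsto_nhds_unique hlim ?_)
  have h2 : Tendsto (fun S => 2 * (B S * |g.x S - k.x S|)) atTop (𝓝 0) := by
    simpa using hB0.const_mul 2
  refine squeeze_zero_norm' ?_ h2
  filter_upwards [hB, eventually_ge_atTop 0] with S hS hS0
  set K := (g.part S ∪ k.part S) ∪
    (segment ℝ (g.curve S) (k.curve S) ∪ segment ℝ (g.curve (-S)) (k.curve (-S))) with hK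
  have hKU : K ⊆ U := by
    refine union_subset (union_subset ?_ ?_) (union_subset ?_ ?_)
    · rintro _ ⟨y, -, rfl⟩; exact hg y
    · rintro _ ⟨y, -, rfl⟩; exact hk y
    · exact hU.segment_subset (hg _) (hk _)
    · exact hU.segment_subset (hg _) (hk _)
  have hseg : ∀ a b : ℂ, IsCompact (segment ℝ a b) := fun a b => by
    rw [segment_eq_image_lineMap]
    exact isCompact_Icc.image (by fun_prop)
  have hKc : IsCompact K := ((g.isCompact_part S).union (k.isCompact_part S)).union
    ((hseg _ _).union (hseg _ _))
  obtain ⟨F, hFd⟩ := hF K hKU hKc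
  have hb : ∀ y, |y| = S → segment ℝ (g.curve y) (k.curve y) ⊆ K →
      ‖F (g.curve y) - F (k.curve y)‖ ≤ B S * |g.x S - k.x S| := fun y hy hsub => by
    have hxy : ∀ l : VGraph, l.x y = l.x S := fun l => by simp [x, hy, abs_of_nonneg hS0]
    have hm := (convex_segment (𝕜 := ℝ) (g.curve y)
        (k.curve y)).norm_image_sub_le_of_norm_hasDerivWithin_le
      (f := F) (f' := f) (C := B S) (fun z hz => (hFd z (hsub hz)).hasDerivWithinAt)
          (fun z hz => ?_)
      (right_mem_segment ℝ _ _) (left_mem_segment ℝ _ _)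
    · refine hm.trans (le_of_eq ?_)
      rw [curve, curve, add_sub_add_right_eq_sub, ← Complex.ofReal_sub, Complex.norm_real,
        Real.norm_eq_abs, hxy, hxy]
    · rw [segment_eq_image_lineMap] at hz
      obtain ⟨t, ht, rfl⟩ := hz
      refine hS y hy _ ?_ ?_
      · rw [← hxy g, ← hxy k, ← segment_eq_uIcc, segment_eq_image_lineMap]
        exact ⟨t, ht, by simp [AffineMap.lineMap_apply]⟩
      · simp [AffineMap.lineMap_apply]
  have s1 : segment ℝ (g.curve S) (k.curve S) ⊆ K :=
    subset_union_of_subset_right subset_union_left _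
  have s2 : segment ℝ (g.curve (-S)) (k.curve (-S)) ⊆ K :=
    subset_union_of_subset_right subset_union_right _
  have g1 : g.part S ⊆ K := subset_union_of_subset_left subset_union_left _
  have k1 : k.part S ⊆ K := subset_union_of_subset_left subset_union_right _
  rw [g.partialInt_eq_sub hS0 (hf.mono (g1.trans hKU)) fun z hz => hFd z (g1 hz),
    k.partialInt_eq_sub hS0 (hf.mono (k1.trans hKU)) fun z hz => hFd z (k1 hz)]
  have n1 := hb S (abs_of_nonneg hS0) s1
  have n2 := hb (-S) (by rw [abs_neg, abs_of_nonneg hS0]) s2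
  rw [show F (g.curve S) - F (g.curve (-S)) - (F (k.curve S) - F (k.curve (-S)))
    = (F (g.curve S) - F (k.curve S)) - (F (g.curve (-S)) - F (k.curve (-S))) by ring]
  refine (norm_sub_le _ _).trans ?_
  linarith

end VGraph

open VGraph

/-- Both rays are parametrized by height `y = ± r sin θ` instead of arc length; the slope of the
graph is then `cot θ`. -/
theorem wedgeIntegral_eq_fullInt {θ : ℝ} (hθ : 0 < Real.sin θ) {f : ℂ → ℂ}
    (hf : Integrable fun y => f ((wedge (Real.cos θ / Real.sin θ)).curve y)
      * (wedge (Real.cos θ / Real.sin θ)).vel y) :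
    wedgeIntegral θ f = (wedge (Real.cos θ / Real.sin θ)).fullInt f := by
  have hs : (Real.sin θ : ℂ) ≠ 0 := by exact_mod_cast hθ.ne'
  have e1 : Complex.exp (θ * Complex.I) = Real.cos θ + Real.sin θ * Complex.I := by
    rw [Complex.exp_mul_I, Complex.ofReal_cos, Complex.ofReal_sin]
  have e2 : Complex.exp (((-θ : ℝ) : ℂ) * Complex.I) = Real.cos θ - Real.sin θ * Complex.I := by
    rw [Complex.exp_mul_I, ← Complex.ofReal_cos, ← Complex.ofReal_sin, Real.cos_neg, Real.sin_neg]
    push_cast; ring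
  generalize Real.cos θ = p at *
  generalize Real.sin θ = q at *
  set g := wedge (p / q) with hg
  rw [fullInt, ← intervalIntegral.integral_Iic_add_Ioi (b := 0) hf.integrableOn hf.integrableOn,
    ← neg_zero, ← integral_comp_neg_Ioi, neg_zero, wedgeIntegral, add_comm, sub_eq_add_neg]
  congr 1
  · have h1 := integral_comp_mul_left_Ioi' (fun y => f (g.curve y) * g.vel y) 0 hθ
    rw [mul_zero] at h1
    rw [← h1, ← integral_smul, rayIntegral]
    refine setIntegral_congr_fun measurableSet_Ioi fun y hy => ?_
    have hy0 : 0 < q * y := mul_pos hθ hy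
    rw [hg, wedge_vel_of_pos hy0, curve, wedge_x, abs_of_pos hy0, e1, Complex.real_smul]
    have a1 : (y : ℂ) * (p + q * Complex.I)
        = ((p / q * (q * y) : ℝ) : ℂ)
          + ((q * y : ℝ) : ℂ) * Complex.I := by
      push_cast
      field_simp
    rw [a1]
    push_cast
    field_simp
  · have h1 := integral_comp_mul_left_Ioi' (fun y => f (g.curve (-y)) * g.vel (-y)) 0 hθ
    rw [mul_zero] at h1
    rw [← h1, ← integral_smul, rayIntegral, ← integral_neg]
    refine setIntegral_congr_fun measurableSet_Ioi fun y hy => ?_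
    have hy0 : 0 < q * y := mul_pos hθ hy
    rw [hg, wedge_vel_of_neg (neg_lt_zero.2 hy0), curve, wedge_x, abs_neg, abs_of_pos hy0, e2,
      Complex.real_smul]
    have a1 : (y : ℂ) * (p - q * Complex.I)
        = ((p / q * (q * y) : ℝ) : ℂ)
          + ((-(q * y) : ℝ) : ℂ) * Complex.I := by
      push_cast
      field_simp
      ring
    rw [a1]
    push_cast
    field_simp
    ring

theorem exists_cubic_le {a : ℝ} (ha : 0 < a) (b c : ℝ) :
    ∃ C, ∀ t, 0 ≤ t → -a * t ^ 3 + b * t ^ 2 + c * t ≤ C := by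
  set t₀ := (|b| + |c|) / a + 1 with ht₀
  have h0 : 0 ≤ (|b| + |c|) / a := by positivity
  refine ⟨|b| * t₀ ^ 2 + |c| * t₀, fun t ht => ?_⟩
  have hb : b * t ^ 2 ≤ |b| * t ^ 2 := mul_le_mul_of_nonneg_right (le_abs_self b) (by positivity)
  have hc : c * t ≤ |c| * t := mul_le_mul_of_nonneg_right (le_abs_self c) ht
  have ht3 : 0 ≤ a * t ^ 3 := by positivity
  rcases le_total t t₀ with h | h
  · have h1 : |b| * t ^ 2 ≤ |b| * t₀ ^ 2 := by gcongr
    have h2 : |c| * t ≤ |c| * t₀ := by gcongr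
    linarith
  · have h1 : |b| + |c| ≤ a * t := by
      have : (|b| + |c|) / a ≤ t := by linarith
      rwa [div_le_iff₀' ha] at this
    have h2 : (|b| + |c|) * t ^ 2 ≤ a * t * t ^ 2 := by gcongr
    have h3 : |c| * t ≤ |c| * t ^ 2 := by
      have : t ≤ t ^ 2 := le_self_pow₀ (by linarith) (by norm_num)
      gcongr
    have h4 : 0 ≤ |b| * t₀ ^ 2 + |c| * t₀ := by positivity
    nlinarith

theorem exists_norm_cubicExp_wedge_le {s : ℝ} (hs : 0 < s) (hs2 : s ^ 2 = 1 / 3) (τ v : ℝ) :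
    ∃ C, 0 ≤ C ∧ ∀ y : ℝ,
      ‖cubicExp τ v ((wedge s).curve y)‖ ≤ C * Real.exp (-(1 / 2) * y ^ 2) := by
  obtain ⟨C, hC⟩ := exists_cubic_le (a := 8 / 9 * s) (by positivity) (2 / 3 * τ + 1 / 2) (-v * s)
  refine ⟨Real.exp C, (Real.exp_pos _).le, fun y => ?_⟩
  rw [norm_cubicExp, ← Real.exp_add, curve_re, curve_im, wedge_x]
  refine Real.exp_le_exp.2 ?_
  have h1 := hC |y| (abs_nonneg y)
  rw [← sq_abs y]
  have e : ((s * |y|) ^ 3 - 3 * (s * |y|) * |y| ^ 2) / 3 - τ * ((s * |y|) ^ 2 - |y| ^ 2)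
      - v * (s * |y|) = -(8 / 9 * s) * |y| ^ 3 + 2 / 3 * τ * |y| ^ 2 + -v * s * |y| := by
    rw [mul_pow, mul_pow, pow_succ s 2, hs2]; ring
  rw [e]
  linarith

theorem inv_cubicExp (τ u : ℝ) (ω : ℂ) : (cubicExp τ u ω)⁻¹ = cubicExp (-τ) u (-ω) := by
  rw [cubicExp, cubicExp, ← Complex.exp_neg]
  congr 1
  push_cast
  ring

theorem wedge_neg_curve (s y : ℝ) : (wedge (-s)).curve y = -(wedge s).curve (-y) := by
  simp only [curve, wedge_x, abs_neg]
  push_cast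
  ring

theorem exists_norm_inv_cubicExp_wedge_le {s : ℝ} (hs : 0 < s) (hs2 : s ^ 2 = 1 / 3) (τ u : ℝ) :
    ∃ C, 0 ≤ C ∧ ∀ y : ℝ,
      ‖(cubicExp τ u ((wedge (-s)).curve y))⁻¹‖ ≤ C * Real.exp (-(1 / 2) * y ^ 2) := by
  obtain ⟨C, hC0, hC⟩ := exists_norm_cubicExp_wedge_le hs hs2 (-τ) u
  refine ⟨C, hC0, fun y => ?_⟩
  have := hC (-y)
  rwa [inv_cubicExp, wedge_neg_curve, neg_neg, ← neg_sq y]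

/-- Estimate on the horizontal segments between two contours at height `S`. The real part of the
cubic is `-x (√3 S - x)(√3 S + x)/3`. The upper limit for `x` is the abscissa of the reflected left
graph, which keeps `x` away from the zero at `√3 S`: `x (√3 S - x)` is at least `√3 R S - 2R²`. This
wins over the quadratic `τ`-term. -/
theorem norm_cubicExp_horizontal_le {τ v T R S : ℝ} (hT : |τ| ≤ T) (hR : 2 * T + 2 ≤ R) {z : ℂ}
    (hx : R ≤ z.re) (hx' : z.re ≤ √3 * S - 2 * R) (hS : |z.im| = S) :
    ‖cubicExp τ v z‖ ≤ Real.exp (-2 * S ^ 2 + (2 * R ^ 2 + 2 * |v|) * S) := by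
  have hT0 : 0 ≤ T := (abs_nonneg _).trans hT
  have hτ := abs_le.1 hT
  have hS0 : 0 ≤ S := hS ▸ abs_nonneg _
  have h3 := sq_sqrt_three
  have h0 : 0 < √(3 : ℝ) := by positivity
  have h2 := sqrt_three_le_two
  have h1 : 1 ≤ √(3 : ℝ) := Real.one_le_sqrt.2 (by norm_num)
  rw [norm_cubicExp, ← sq_abs z.im, hS]
  generalize z.re = x at *
  refine Real.exp_le_exp.2 ?_
  have hx0 : 0 ≤ x := by linarith
  have hxS : x ≤ √3 * S := by linarith
  have hx2 : x ≤ 2 * S := hxS.trans (by gcongr)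
  have hxx : x ^ 2 ≤ 3 * S ^ 2 := by
    calc x ^ 2 ≤ (√3 * S) ^ 2 := by gcongr
      _ = _ := by rw [mul_pow, h3]
  have t1 : -τ * (x ^ 2 - S ^ 2) ≤ T * (2 * S ^ 2) := by
    refine (le_abs_self _).trans ?_
    rw [abs_mul, abs_neg]
    refine mul_le_mul hT ?_ (abs_nonneg _) hT0
    rw [abs_le]
    constructor <;> nlinarith [sq_nonneg S, sq_nonneg x]
  have t2 : -v * x ≤ |v| * (2 * S) := by
    refine (le_abs_self _).trans ?_
    rw [abs_mul, abs_neg, abs_of_nonneg hx0]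
    gcongr
  have t3 : √3 * (R * S) - 2 * R ^ 2 ≤ x * (√3 * S - x) := by
    nlinarith [mul_nonneg (sub_nonneg.2 hx) (sub_nonneg.2 hx')]
  have t4 : 0 ≤ x * (√3 * S - x) := mul_nonneg hx0 (by linarith)
  have t5 : (√3 * (R * S) - 2 * R ^ 2) * (√3 * S) ≤ x * (√3 * S - x) * (√3 * S + x) :=
    mul_le_mul t3 (by linarith) (by positivity) t4
  have t6 : x * (√3 * S - x) * (√3 * S + x) = 3 * x * S ^ 2 - x ^ 3 := by
    linear_combination x * S ^ 2 * h3
  have t7 : (√3 * (R * S) - 2 * R ^ 2) * (√3 * S) = 3 * R * S ^ 2 - 2 * R ^ 2 * (√3 * S) := by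
    linear_combination R * S ^ 2 * h3
  have t8 : R ^ 2 * (√3 * S) ≤ R ^ 2 * (2 * S) := by gcongr
  have t9 : (2 * T + 2) * S ^ 2 ≤ R * S ^ 2 := by gcongr
  have t10 : 0 ≤ R ^ 2 * S := by positivity
  nlinarith

theorem tendsto_exp_neg_sq_mul (c d : ℝ) :
    Tendsto (fun S : ℝ => Real.exp (-2 * S ^ 2 + c * S) * (d * S)) atTop (𝓝 0) := by
  have h1 : Tendsto (fun S : ℝ => ‖d * (S ^ 1 * Real.exp (-S))‖) atTop (𝓝 0) := by
    simpa using ((Real.tendsto_pow_mul_exp_neg_atTop_nhds_zero 1).const_mul d).norm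
  refine squeeze_zero_norm' ?_ h1
  filter_upwards [eventually_ge_atTop (max 0 (c + 1))] with S hS
  have hS0 : 0 ≤ S := (le_max_left _ _).trans hS
  have hSc : c + 1 ≤ S := (le_max_right _ _).trans hS
  rw [norm_mul, norm_mul, norm_mul, norm_mul, mul_comm, Real.norm_of_nonneg (Real.exp_pos _).le,
    Real.norm_of_nonneg (Real.exp_pos _).le, pow_one, mul_assoc]
  gcongr
  nlinarith

/-- For `Re ζ > 0` the integrand is holomorphic in `Re ω < Re ζ`, a convex region containing both
contours. The reflection `ω ↦ -ω` turns the inverse cubic exponential into one with `-τ`, so the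
horizontal estimate applies. -/
theorem inner_deform {s : ℝ} (hs : 0 < s) (hs2 : s ^ 2 = 1 / 3) {τ u T R : ℝ} (hT : |τ| ≤ T)
    (hR : 2 * T + 2 ≤ R) (hR0 : 0 ≤ R) (hu : 0 ≤ u + (R - 2)) {ζ : ℂ} (hζ : 0 < ζ.re) :
    Integrable (fun y => (cubicExp τ u ((wedge (-s)).curve y))⁻¹ * (ζ - (wedge (-s)).curve y)⁻¹
      * (wedge (-s)).vel y) ∧
    (wedge (-s)).fullInt (fun ω => (cubicExp τ u ω)⁻¹ * (ζ - ω)⁻¹)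
      = (leftGraph R hR0).fullInt (fun ω => (cubicExp τ u ω)⁻¹ * (ζ - ω)⁻¹) := by
  have hT0 : 0 ≤ T := (abs_nonneg _).trans hT
  obtain ⟨C, hC0, hC⟩ := exists_norm_inv_cubicExp_wedge_le hs hs2 τ u
  have hxw : ∀ y, (wedge (-s)).x y ≤ 0 := fun y => by
    rw [wedge_x]; nlinarith [abs_nonneg y]
  have hxl : ∀ y, (leftGraph R hR0).x y ≤ -R := (leftGraph R hR0).x_le (by simp [leftGraph])
  have hdist : ∀ (g : VGraph) (y : ℝ), ζ.re - g.x y ≤ ‖ζ - g.curve y‖ := fun g y => by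
    have h1 := Complex.abs_re_le_norm (ζ - g.curve y)
    have h2 := le_abs_self (ζ - g.curve y).re
    simp only [Complex.sub_re, curve_re] at h1 h2
    linarith
  have hcont : Continuous fun ω => (cubicExp τ u ω)⁻¹ :=
    (differentiable_cubicExp τ u).continuous.inv₀ (cubicExp_ne_zero τ u)
  have ig := (wedge (-s)).integrable_cauchy (f := fun ω => (cubicExp τ u ω)⁻¹) (z := ζ) hζ
      (fun y => by
    linarith [hdist (wedge (-s)) y, hxw y]) (hcont.comp (wedge (-s)).continuous_curve) hC
  have ik := (leftGraph R hR0).integrable_cauchy (f := fun ω => (cubicExp τ u ω)⁻¹) (z := ζ) hζ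
      (fun y => by
    linarith [hdist (leftGraph R hR0) y, hxl y])
    (hcont.comp (leftGraph R hR0).continuous_curve)
    (c := contourConst R T * Real.exp (-R * u)) fun y => by
      refine (norm_inv_cubicExp_left_le hT (by linarith) hR0 hu y).trans ?_
      have := exp_neg_sq_le y
      have := contourConst_pos R T
      gcongr
  refine ⟨ig, fullInt_eq_fullInt (U := {z | z.re < ζ.re})
    (B := fun S => Real.exp (-2 * S ^ 2 + (2 * R ^ 2 + 2 * |u|) * S) * 1)
    (convex_halfSpace_re_lt _) ?_ ?_ ?_ ?_ ig ik ?_ ?_⟩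
  · have hd : DifferentiableOn ℂ (fun ω => (cubicExp τ u ω)⁻¹ * (ζ - ω)⁻¹) {z | z.re < ζ.re} := by
      intro w hw
      refine (((differentiable_cubicExp τ u w).inv (cubicExp_ne_zero τ u w)).mul
        (DifferentiableAt.inv (by fun_prop) fun h => ?_)).differentiableWithinAt
      rw [sub_eq_zero.1 h] at hw
      exact lt_irrefl w.re hw
    exact fun K hK hKc => exists_primitive_of_isCompact_of_re_lt hd hKc hK
  · refine hcont.continuousOn.mul (ContinuousOn.inv₀ (by fun_prop) fun w hw h => ?_)
    rw [sub_eq_zero.1 h] at hw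
    exact lt_irrefl w.re hw
  · exact fun y => by rw [mem_ofPred_eq, curve_re]; linarith [hxw y]
  · exact fun y => by rw [mem_ofPred_eq, curve_re]; linarith [hxl y]
  · filter_upwards [eventually_ge_atTop (√3 * R), eventually_ge_atTop (R / s)]
      with S hS hS' y hy z hz hzy
    have hS0 : 0 ≤ S := le_trans (by positivity) hS
    rw [wedge_x, abs_of_nonneg hS0, uIcc_comm, mem_uIcc] at hz
    rw [div_le_iff₀ hs] at hS'
    have hl : (leftGraph R hR0).x S = -(√3 * S - 2 * R) := by
      simp only [leftGraph, VGraph.x, abs_of_nonneg hS0, max_eq_left (sub_nonneg.2 hS)]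
      linear_combination R * sq_sqrt_three
    have hs3 : s * √3 = 1 := by
      have : (s * √3) ^ 2 = 1 := by rw [mul_pow, hs2, sq_sqrt_three]; norm_num
      exact (pow_eq_one_iff_of_nonneg (by positivity) two_ne_zero).1 this
    have hlt : -(√3 * S - 2 * R) ≤ -s * S := by
      have : √3 = 3 * s := by linear_combination 3 * s * hs3 - 3 * √3 * hs2
      nlinarith
    rw [hl] at hz
    have hz' : -(√3 * S - 2 * R) ≤ z.re ∧ z.re ≤ -s * S := by
      rcases hz with hz | hz
      · exact hz
      · exact ⟨by linarith, by linarith⟩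
    rw [norm_mul, inv_cubicExp, norm_inv]
    refine mul_le_mul (norm_cubicExp_horizontal_le (by rwa [abs_neg]) hR (z := -z) ?_ ?_ ?_)
      (inv_le_one_of_one_le₀ ?_) (by positivity) (Real.exp_pos _).le
    · rw [Complex.neg_re]; nlinarith
    · rw [Complex.neg_re]; linarith
    · rw [Complex.neg_im, abs_neg, hzy, hy]
    · have h1 := Complex.abs_re_le_norm (ζ - z)
      have h2 := le_abs_self (ζ - z).re
      simp only [Complex.sub_re] at h1 h2
      nlinarith
  · have h1 := tendsto_exp_neg_sq_mul (2 * R ^ 2 + 2 * |u|) (s + R + 4)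
    refine squeeze_zero_norm' ?_ h1
    filter_upwards [eventually_ge_atTop 1] with S hS
    rw [norm_mul, mul_one, Real.norm_of_nonneg (Real.exp_pos _).le, Real.norm_eq_abs, abs_abs]
    gcongr
    refine (abs_sub _ _).trans ?_
    have h2 := leftGraph_abs_x_le hR0 S
    rw [wedge_x, abs_mul, abs_neg, abs_of_pos hs, abs_abs]
    rw [abs_of_nonneg (by linarith : 0 ≤ S)] at *
    nlinarith

/-- `I` stands for the inner integral after its contour has been moved left. It is then holomorphic
beyond the imaginary axis, so the vertex of the outer wedge at the origin causes no singularity. -/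
theorem outer_deform {s : ℝ} (hs : 0 < s) (hs2 : s ^ 2 = 1 / 3) {τ v T R C : ℝ} (hT : |τ| ≤ T)
    (hR : 2 * T + 2 ≤ R) {I : ℂ → ℂ} (hI : DifferentiableOn ℂ I {z | -1 < z.re}) (hC : 0 ≤ C)
    (hIC : ∀ z : ℂ, 0 ≤ z.re → ‖I z‖ ≤ C) :
    Integrable (fun y => cubicExp τ v ((wedge s).curve y) * I ((wedge s).curve y)
      * (wedge s).vel y) ∧
    (wedge s).fullInt (fun ζ => cubicExp τ v ζ * I ζ)
      = (vline R).fullInt (fun ζ => cubicExp τ v ζ * I ζ) := by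
  have hT0 : 0 ≤ T := (abs_nonneg _).trans hT
  obtain ⟨C', hC0', hC'⟩ := exists_norm_cubicExp_wedge_le hs hs2 τ v
  have hxw : ∀ y, 0 ≤ (wedge s).x y := fun y => by
    rw [wedge_x]; positivity
  have hd : DifferentiableOn ℂ (fun ζ => cubicExp τ v ζ * I ζ) {z | -1 < z.re} :=
    (differentiable_cubicExp τ v).differentiableOn.mul hI
  have hcont : ∀ g : VGraph, (∀ y, 0 ≤ g.x y) →
      Continuous fun y => cubicExp τ v (g.curve y) * I (g.curve y) := fun g hg =>
    hd.continuousOn.comp_continuous g.continuous_curve fun y => by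
      rw [mem_ofPred_eq, curve_re]; linarith [hg y]
  have hgauss : ∀ c : ℝ, Integrable fun y : ℝ => c * Real.exp (-(1 / 2) * y ^ 2) * C := fun c =>
    ((integrable_exp_neg_mul_sq (by norm_num)).const_mul c).mul_const C
  have ig := (wedge s).integrable_of_bound (f := fun ζ => cubicExp τ v ζ * I ζ)
    (hcont (wedge s) hxw) (hgauss C') fun y => by
      rw [norm_mul]
      exact mul_le_mul (hC' y) (hIC _ (by rw [curve_re]; exact hxw y)) (norm_nonneg _)
        (mul_nonneg hC0' (Real.exp_pos _).le)
  have hxl : ∀ y, 0 ≤ (vline R).x y := fun y => by rw [vline_x]; linarith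
  have ik := (vline R).integrable_of_bound (f := fun ζ => cubicExp τ v ζ * I ζ)
    (hcont (vline R) hxl) (hgauss (contourConst R T * Real.exp (-R * v))) fun y => by
      rw [norm_mul]
      refine mul_le_mul ?_ (hIC _ (by rw [curve_re]; exact hxl y)) (norm_nonneg _)
        (mul_nonneg (mul_nonneg (contourConst_pos R T).le (Real.exp_pos _).le) (Real.exp_pos _).le)
      have := norm_cubicExp_vertical_le (v := v) hT (by linarith : T + 2 ≤ R) y
      rw [curve, vline_x]
      refine this.trans ?_
      have := exp_neg_sq_le y
      have := contourConst_pos R T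
      gcongr
  refine ⟨ig, fullInt_eq_fullInt (U := {z | -1 < z.re})
    (B := fun S => Real.exp (-2 * S ^ 2 + (2 * R ^ 2 + 2 * |v|) * S) * C)
    (convex_halfSpace_re_gt _) (fun K hK hKc => exists_primitive_of_isCompact_of_lt_re hd hKc hK)
    hd.continuousOn (fun y => by rw [mem_ofPred_eq, curve_re]; linarith [hxw y])
    (fun y => by rw [mem_ofPred_eq, curve_re]; linarith [hxl y]) ig ik ?_ ?_⟩
  · filter_upwards [eventually_ge_atTop (2 * R), eventually_ge_atTop (R / s)]
      with S hS hS' y hy z hz hzy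
    have hS0 : 0 ≤ S := le_trans (by linarith) hS
    rw [wedge_x, vline_x, abs_of_nonneg hS0, uIcc_comm, mem_uIcc] at hz
    rw [div_le_iff₀' hs] at hS'
    have hz' : R ≤ z.re ∧ z.re ≤ s * S := by
      rcases hz with hz | hz
      · exact hz
      · exact ⟨by linarith, by linarith⟩
    have hs3 : s * √3 = 1 := by
      have : (s * √3) ^ 2 = 1 := by rw [mul_pow, hs2, sq_sqrt_three]; norm_num
      exact (pow_eq_one_iff_of_nonneg (by positivity) two_ne_zero).1 this
    have h3s : √3 = 3 * s := by linear_combination 3 * s * hs3 - 3 * √3 * hs2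
    have hs12 : 1 / 2 ≤ s := by nlinarith
    rw [norm_mul]
    refine mul_le_mul (norm_cubicExp_horizontal_le hT hR hz'.1 ?_ (by rw [hzy, hy]))
      (hIC _ (by linarith)) (norm_nonneg _) (Real.exp_pos _).le
    rw [h3s]
    nlinarith
  · have h1 := tendsto_exp_neg_sq_mul (2 * R ^ 2 + 2 * |v|) (C * (s + R))
    refine squeeze_zero_norm' ?_ h1
    filter_upwards [eventually_ge_atTop 1] with S hS
    rw [norm_mul, norm_mul, Real.norm_of_nonneg (Real.exp_pos _).le, Real.norm_of_nonneg hC,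
      Real.norm_eq_abs, abs_abs, mul_assoc, mul_assoc C]
    gcongr
    refine (abs_sub _ _).trans ?_
    rw [wedge_x, vline_x, abs_mul, abs_of_pos hs, abs_abs, abs_of_nonneg (by linarith : 0 ≤ S),
      abs_of_nonneg (by linarith : 0 ≤ R)]
    nlinarith

/-- The double contour integral in the Airy kernel, on the contours used in the comparison. -/
theorem airy_double_integral_eq {τ₁ τ₂ u v T R : ℝ} (hT₁ : |τ₁| ≤ T) (hT₂ : |τ₂| ≤ T)
    (hR : 2 * T + 2 ≤ R) (hR0 : 0 ≤ R) (hu : 0 ≤ u + (R - 2)) :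
    wedgeIntegral (Real.pi / 3) (fun ζ => wedgeIntegral (2 * Real.pi / 3) (fun ω =>
        Complex.exp (ζ ^ 3 / 3 - ζ * v - τ₂ * ζ ^ 2 - ω ^ 3 / 3 + ω * u + τ₁ * ω ^ 2) / (ζ - ω)))
      = (∫ η : ℝ, cubicExp τ₂ v (R + η * Complex.I) *
            (leftGraph R hR0).fullInt
              (fun w => (cubicExp τ₁ u w)⁻¹ * ((R : ℂ) + η * Complex.I - w)⁻¹)) * Complex.I := by
  have hT0 : 0 ≤ T := (abs_nonneg _).trans hT₁
  set s : ℝ := 1 / √3 with hsdef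
  have hs : 0 < s := by positivity
  have hs2 : s ^ 2 = 1 / 3 := by rw [hsdef, div_pow, sq_sqrt_three, one_pow]
  have hsn : (√3 : ℝ) ≠ 0 := by positivity
  have e1 : Real.cos (Real.pi / 3) / Real.sin (Real.pi / 3) = s := by
    rw [Real.cos_pi_div_three, Real.sin_pi_div_three, hsdef]
    field_simp
  have e2s : Real.sin (2 * Real.pi / 3) = √3 / 2 := by
    rw [show 2 * Real.pi / 3 = Real.pi - Real.pi / 3 by ring, Real.sin_pi_sub,
      Real.sin_pi_div_three]
  have e2 : Real.cos (2 * Real.pi / 3) / Real.sin (2 * Real.pi / 3) = -s := by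
    rw [e2s, show 2 * Real.pi / 3 = Real.pi - Real.pi / 3 by ring, Real.cos_pi_sub,
      Real.cos_pi_div_three, hsdef]
    field_simp
  set I : ℂ → ℂ := fun ζ => (leftGraph R hR0).fullInt (fun w => (cubicExp τ₁ u w)⁻¹ * (ζ - w)⁻¹)
    with hI
  -- The two wedges touch at the origin, where the Cauchy kernel is singular. The rays omit that
  -- point, so the inner contour can be moved first, for each fixed `ζ` on the open rays.
  have hinner : ∀ ζ : ℂ, 0 < ζ.re → wedgeIntegral (2 * Real.pi / 3) (fun ω =>
        Complex.exp (ζ ^ 3 / 3 - ζ * v - τ₂ * ζ ^ 2 - ω ^ 3 / 3 + ω * u + τ₁ * ω ^ 2) / (ζ - ω))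
      = cubicExp τ₂ v ζ * I ζ := by
    intro ζ hζ
    obtain ⟨h1, h2⟩ := inner_deform hs hs2 (u := u) hT₁ hR hR0 hu hζ
    have e : (fun ω : ℂ => Complex.exp (ζ ^ 3 / 3 - ζ * v - τ₂ * ζ ^ 2 - ω ^ 3 / 3 + ω * u
        + τ₁ * ω ^ 2) / (ζ - ω))
        = fun ω => cubicExp τ₂ v ζ * ((cubicExp τ₁ u ω)⁻¹ * (ζ - ω)⁻¹) := by
      ext ω
      rw [div_eq_mul_inv, ← mul_assoc, cubicExp, cubicExp, ← Complex.exp_neg, ← Complex.exp_add]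
      congr 2
      ring
    rw [e, wedgeIntegral_eq_fullInt (by rw [e2s]; positivity), e2]
    · rw [show I ζ = _ from h2.symm, fullInt, fullInt, ← integral_const_mul]
      refine integral_congr_ae (Eventually.of_forall fun y => ?_)
      simp only
      ring
    · rw [e2]
      refine (h1.const_mul (cubicExp τ₂ v ζ)).congr (Eventually.of_forall fun y => ?_)
      simp only
      ring
  have hcont : Continuous fun y => (cubicExp τ₁ u ((leftGraph R hR0).curve y))⁻¹ :=
    ((differentiable_cubicExp τ₁ u).continuous.comp (leftGraph R hR0).continuous_curve).inv₀
      fun y => cubicExp_ne_zero τ₁ u _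
  have hbd : ∀ y, ‖(cubicExp τ₁ u ((leftGraph R hR0).curve y))⁻¹‖
      ≤ contourConst R T * Real.exp (-R * u) * Real.exp (-(1 / 2) * y ^ 2) := fun y => by
    refine (norm_inv_cubicExp_left_le hT₁ (by linarith) hR0 hu y).trans ?_
    have := exp_neg_sq_le y
    have := contourConst_pos R T
    gcongr
  have hxl : ∀ y, (leftGraph R hR0).x y ≤ -R := (leftGraph R hR0).x_le (by simp [leftGraph])
  have hdist : ∀ (ζ : ℂ) (y : ℝ), ζ.re + R ≤ ‖ζ - (leftGraph R hR0).curve y‖ := fun ζ y => by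
    have h1 := Complex.abs_re_le_norm (ζ - (leftGraph R hR0).curve y)
    have h2 := le_abs_self (ζ - (leftGraph R hR0).curve y).re
    simp only [Complex.sub_re, curve_re] at h1 h2
    linarith [hxl y]
  have hId : DifferentiableOn ℂ I {z | -1 < z.re} := fun z hz => by
    have hz : -1 < z.re := hz
    exact ((leftGraph R hR0).differentiableAt_fullInt_cauchy (f := fun w => (cubicExp τ₁ u w)⁻¹)
      (d := (z.re + R) / 2) (by linarith) (fun y => by linarith [hdist z y]) hcont
      hbd).differentiableWithinAt
  have hm : |(leftGraph R hR0).m| ≤ 2 := by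
    simp only [leftGraph, abs_neg, abs_of_nonneg (Real.sqrt_nonneg 3)]
    exact sqrt_three_le_two
  have hIC : ∀ z : ℂ, 0 ≤ z.re → ‖I z‖ ≤ _ := fun z hz =>
    (leftGraph R hR0).norm_fullInt_le (f := fun w => (cubicExp τ₁ u w)⁻¹) hm le_rfl
      (fun y => by linarith [hdist z y]) hbd
  obtain ⟨h1, h2⟩ := outer_deform hs hs2 (v := v) hT₂ hR hId
    ((norm_nonneg _).trans (hIC 0 (by simp))) hIC
  have hray : ∀ θ : ℝ, 0 < Real.cos θ → rayIntegral θ (fun ζ => wedgeIntegral (2 * Real.pi / 3)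
      (fun ω => Complex.exp (ζ ^ 3 / 3 - ζ * v - τ₂ * ζ ^ 2 - ω ^ 3 / 3 + ω * u + τ₁ * ω ^ 2)
        / (ζ - ω))) = rayIntegral θ (fun ζ => cubicExp τ₂ v ζ * I ζ) := by
    intro θ hθ
    refine setIntegral_congr_fun measurableSet_Ioi fun r hr => ?_
    simp only
    rw [hinner]
    rw [Complex.re_ofReal_mul, Complex.exp_ofReal_mul_I_re]
    exact mul_pos hr hθ
  have hc : 0 < Real.cos (Real.pi / 3) := by rw [Real.cos_pi_div_three]; norm_num
  rw [wedgeIntegral, hray _ hc, hray _ (by rwa [Real.cos_neg]), ← wedgeIntegral,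
    wedgeIntegral_eq_fullInt (by rw [Real.sin_pi_div_three]; positivity), e1, h2, fullInt,
    ← integral_mul_const]
  · refine integral_congr_ae (Eventually.of_forall fun y => ?_)
    simp only [vline_vel, curve, vline_x, hI]
  · rw [e1]; exact h1


/-! ### The correlation kernel in scaled coordinates. -/

theorem integral_empiricalMeasure {E : Type*} [NormedAddCommGroup E] [NormedSpace ℝ E]
    [CompleteSpace E] {n : ℕ} (X : Fin n → ℝ) (f : ℝ → E) :
    ∫ x, f x ∂(empiricalMeasure X) = (n : ℝ)⁻¹ • ∑ j, f (X j) := by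
  rw [empiricalMeasure, integral_smul_measure, integral_finsetSum_measure]
  · simp [integral_dirac]
  · exact fun j _ => integrable_dirac (by simp)

/-- The branch of the logarithm plays no role, since the factor `n` cancels the weight `1/n` and
exponentiation leaves a polynomial. Only the points `X_j` themselves are excluded, as there
`Complex.log 0 = 0`. -/
theorem exp_mul_logPotential {n : ℕ} (hn : n ≠ 0) (X : Fin n → ℝ) {z : ℂ}
    (hz : ∀ j, z ≠ (X j : ℂ)) : Complex.exp (n * logPotential X z) = ∏ j, (z - (X j : ℂ)) := by
  have hn' : (n : ℂ) ≠ 0 := by exact_mod_cast hn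
  rw [logPotential, integral_empiricalMeasure, Complex.real_smul]
  push_cast
  rw [← mul_assoc, mul_inv_cancel₀ hn', one_mul, Complex.exp_sum]
  exact Finset.prod_congr rfl fun j _ => Complex.exp_log (sub_ne_zero.2 (hz j))

theorem realRootProd_ofFn {n : ℕ} (ξ : Fin n → ℝ) (w : ℂ) :
    realRootProd (List.ofFn ξ) w = ∏ j, (w - (ξ j : ℂ)) := by
  simp [realRootProd, rootProd, List.map_ofFn, List.prod_ofFn]

theorem quadExp_eq {c x y : ℝ} {l : ℝ} (hl : l ≠ 0) (z : ℂ) :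
    quadExp (c * (x - y) ^ 2) (2 * c * (x - y) / l) (c / l ^ 2) (l * (z - x))
      = Complex.exp (c * (z - y) ^ 2) := by
  have hl' : (l : ℂ) ≠ 0 := by exact_mod_cast hl
  rw [quadExp]
  congr 1
  push_cast
  field_simp
  ring

/-- The integrand of the correlation kernel in product form. -/
theorem kernel_integrand_eq {n : ℕ} (hn : n ≠ 0) (X : Fin n → ℝ) {s t : ℝ} (hs : s ≠ 0)
    (ht : t ≠ 0) (x y xs : ℝ) {l : ℝ} (hl : l ≠ 0) {z w : ℂ} (hz : ∀ j, z ≠ (X j : ℂ))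
    (hw : ∀ j, w ≠ (X j : ℂ)) :
    Complex.exp ((n : ℂ) / (2 * t) * ((z - y) ^ 2 + 2 * t * logPotential X z)
        - (n : ℂ) / (2 * s) * ((w - x) ^ 2 + 2 * s * logPotential X w)) / (z - w)
      = quadExp (n / (2 * t) * (xs - y) ^ 2) (2 * (n / (2 * t)) * (xs - y) / l)
          (n / (2 * t) / l ^ 2) (l * (z - xs))
        * (realRootProd (List.ofFn fun j => l * (X j - xs)) (l * (z - xs)))
        * (l * (quadExp (-(n / (2 * s) * (xs - x) ^ 2)) (-(2 * (n / (2 * s)) * (xs - x) / l))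
            (-(n / (2 * s) / l ^ 2)) (l * (w - xs))
          * (realRootProd (List.ofFn fun j => l * (X j - xs)) (l * (w - xs)))⁻¹
          * (l * (z - xs) - l * (w - xs))⁻¹)) := by
  have hl' : (l : ℂ) ≠ 0 := by exact_mod_cast hl
  have hs' : (s : ℂ) ≠ 0 := by exact_mod_cast hs
  have ht' : (t : ℂ) ≠ 0 := by exact_mod_cast ht
  have hprod : ∀ z : ℂ, realRootProd (List.ofFn fun j => l * (X j - xs)) (l * (z - xs))
      = (l : ℂ) ^ n * ∏ j, (z - (X j : ℂ)) := fun z => by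
    rw [realRootProd_ofFn]
    have : ∀ j, (l : ℂ) * (z - xs) - ((l * (X j - xs) : ℝ) : ℂ) = l * (z - X j) := fun j => by
      push_cast; ring
    simp only [this, Finset.prod_mul_distrib, Finset.prod_const, Finset.card_univ,
      Fintype.card_fin]
  rw [hprod, hprod, quadExp_neg, quadExp_eq hl, quadExp_eq hl, ← exp_mul_logPotential hn X hz,
    ← exp_mul_logPotential hn X hw, ← mul_sub, show z - (xs : ℂ) - (w - xs) = z - w by ring,
    mul_inv, mul_inv, ← Complex.exp_neg, ← Complex.exp_neg]
  have e : (n : ℂ) / (2 * t) * ((z - y) ^ 2 + 2 * t * logPotential X z)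
        - (n : ℂ) / (2 * s) * ((w - x) ^ 2 + 2 * s * logPotential X w)
      = ((n / (2 * t) : ℝ) : ℂ) * (z - y) ^ 2 + n * logPotential X z
        + -(((n / (2 * s) : ℝ) : ℂ) * (w - x) ^ 2) + -(n * logPotential X w) := by
    push_cast
    field_simp
    ring
  rw [e, Complex.exp_add, Complex.exp_add, Complex.exp_add, div_eq_mul_inv]
  field_simp

/-- The constant `∏ (-ξ_j)` normalises the polynomial to one at the origin. It cancels in the kernel
because the product occurs once in the numerator and once in the denominator. -/
theorem expProd_eq {n : ℕ} (k₀ k₁ k₂ : ℝ) (ξ : Fin n → ℝ) (hξ : ∀ j, ξ j ≠ 0) (ζ : ℂ) :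
    expProd k₀ k₁ k₂ (fun j => -(ξ j)⁻¹) ζ
      = (∏ j, (-(ξ j : ℂ)))⁻¹ * (quadExp k₀ k₁ k₂ ζ * realRootProd (List.ofFn ξ) ζ) := by
  have hne : ∏ j, (-(ξ j : ℂ)) ≠ 0 :=
    Finset.prod_ne_zero_iff.2 fun j _ => neg_ne_zero.2 (by exact_mod_cast hξ j)
  have h1 : realRootProd (List.ofFn ξ) ζ
      = (∏ j, (-(ξ j : ℂ))) * ∏ j, (1 + ((-(ξ j)⁻¹ : ℝ) : ℂ) * ζ) := by
    rw [realRootProd_ofFn, ← Finset.prod_mul_distrib]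
    refine Finset.prod_congr rfl fun j _ => ?_
    have : (ξ j : ℂ) ≠ 0 := by exact_mod_cast hξ j
    push_cast
    field_simp
    ring
  rw [h1, expProd, mul_left_comm (quadExp _ _ _ _), inv_mul_cancel_left₀ hne]

theorem VGraph.fullInt_const_mul (g : VGraph) (c : ℂ) (f : ℂ → ℂ) :
    g.fullInt (fun w => c * f w) = c * g.fullInt f := by
  rw [fullInt, fullInt, ← integral_const_mul]
  simp only [mul_assoc]

/-- The double contour integral in the correlation kernel, in scaled coordinates and on the
contours used in the asymptotic analysis. -/
theorem kernel_integral_eq {n : ℕ} (hn : n ≠ 0) {X : Fin n → ℝ} {x₀ : ℝ} {m : ℕ}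
    {Γ : Fin m → ℝ → ℂ} (hΓ : IsAdmissible X x₀ Γ) {s t : ℝ} (hs : 0 < s) (ht : 0 < t)
    (x y xs : ℝ) {l : ℝ} (hl : 0 < l) {R r : ℝ} (hR : 0 ≤ R) (hR0 : 0 < R) (hRr : R < r)
    (hX : ∀ j, r < |l * (X j - xs)|) :
    ∫ η : ℝ, (fun z : ℂ => contourIntegral Γ (fun w : ℂ =>
        Complex.exp
          ((n : ℂ) / (2 * t) * ((z - y) ^ 2 + 2 * t * logPotential X z)
            - (n : ℂ) / (2 * s) * ((w - x) ^ 2 + 2 * s * logPotential X w)) / (z - w)))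
        ((x₀ : ℂ) + η * Complex.I) * Complex.I
      = ((l⁻¹ : ℝ) : ℂ) * Complex.I * ∫ η : ℝ,
          expProd (n / (2 * t) * (xs - y) ^ 2) (2 * (n / (2 * t)) * (xs - y) / l)
            (n / (2 * t) / l ^ 2) (fun j => -(l * (X j - xs))⁻¹) (R + η * Complex.I) *
          ((leftGraph R hR).fullInt
              (fun w => (expProd (n / (2 * s) * (xs - x) ^ 2) (2 * (n / (2 * s)) * (xs - x) / l)
                (n / (2 * s) / l ^ 2) (fun j => -(l * (X j - xs))⁻¹) w)⁻¹
                * ((R : ℂ) + η * Complex.I - w)⁻¹)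
            - (rightGraph r).fullInt
              (fun w => (expProd (n / (2 * s) * (xs - x) ^ 2) (2 * (n / (2 * s)) * (xs - x) / l)
                (n / (2 * s) / l ^ 2) (fun j => -(l * (X j - xs))⁻¹) w)⁻¹
                * ((R : ℂ) + η * Complex.I - w)⁻¹)) := by
  set ξ : Fin n → ℝ := fun j => l * (X j - xs) with hξ
  have hξ0 : ∀ j, ξ j ≠ 0 := fun j h => by
    have := hX j
    rw [show l * (X j - xs) = 0 from h, abs_zero] at this
    linarith
  have hl' : (l : ℂ) ≠ 0 := by exact_mod_cast hl.ne'
  have hn0 : (0 : ℝ) < n := by exact_mod_cast Nat.pos_of_ne_zero hn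
  have hloop := isLoop_contourIntegral hΓ.curves
  have hloop' := hloop.comp_affine l xs
  have hRP : ∀ w : ℂ, (∀ j, w ≠ (X j : ℂ)) → realRootProd (List.ofFn ξ) (l * (w - xs)) ≠ 0 := by
    intro w hw
    rw [realRootProd_ofFn]
    refine Finset.prod_ne_zero_iff.2 fun j _ h => hw j ?_
    have h1 : (l : ℂ) * (w - X j) = 0 := by rw [← h, hξ]; push_cast; ring
    exact sub_eq_zero.1 ((mul_eq_zero.1 h1).resolve_left hl')
  have hav : ∀ w ∈ trace Γ, ∀ j, w ≠ (X j : ℂ) := by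
    intro w hw j
    obtain ⟨k, τ, hτ, rfl⟩ := mem_iUnion.1 hw
    exact hΓ.avoids_points k τ hτ j
  have hav' : ∀ w ∈ trace Γ, w.re ≠ x₀ := by
    intro w hw
    obtain ⟨k, τ, hτ, rfl⟩ := mem_iUnion.1 hw
    exact hΓ.avoids_line k τ hτ
  have hscale : ∀ w : ℂ, ((l : ℂ) * (w - xs)).re = l * (w.re - xs) := fun w => by
    rw [Complex.re_ofReal_mul, Complex.sub_re, Complex.ofReal_re]
  have hline := hloop'.integral_line_eq (ξ := List.ofFn ξ) (gL := leftGraph R hR)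
    (gR := rightGraph r) ?_ ?_ (leftGraph_m_sq hR) (by simp [leftGraph]) (rightGraph_m_sq r)
    (by simp [rightGraph]) ?_ (-(n / (2 * s) * (xs - x) ^ 2)) (-(2 * (n / (2 * s)) * (xs - x) / l))
    (k₂ := n / (2 * s) / l ^ 2) (by positivity) (n / (2 * t) * (xs - y) ^ 2)
    (2 * (n / (2 * t)) * (xs - y) / l) (j₂ := n / (2 * t) / l ^ 2) (by positivity)
    (x₀ := l * (x₀ - xs)) (r := R) ?_ ?_ ?_ hRr
  · have hcv := Measure.integral_comp_mul_left (fun η : ℝ => (fun z : ℂ => contourIntegral Γ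
      (fun w : ℂ => Complex.exp
          ((n : ℂ) / (2 * t) * ((z - y) ^ 2 + 2 * t * logPotential X z)
            - (n : ℂ) / (2 * s) * ((w - x) ^ 2 + 2 * s * logPotential X w)) / (z - w)))
        ((x₀ : ℂ) + η * Complex.I) * Complex.I) l⁻¹
    rw [inv_inv, abs_of_pos hl, ← inv_smul_eq_iff₀ hl.ne', Complex.real_smul] at hcv
    rw [← hcv, mul_assoc]
    congr 1
    rw [integral_mul_const, mul_comm]
    congr 1
    trans ∫ y_1 : ℝ, quadExp (n / (2 * t) * (xs - y) ^ 2) (2 * (n / (2 * t)) * (xs - y) / l)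
            (n / (2 * t) / l ^ 2) (((l * (x₀ - xs) : ℝ) : ℂ) + y_1 * Complex.I) *
        (realRootProd (List.ofFn ξ) (((l * (x₀ - xs) : ℝ) : ℂ) + y_1 * Complex.I) *
        contourIntegral Γ (fun w => l * (quadExp (-(n / (2 * s) * (xs - x) ^ 2))
            (-(2 * (n / (2 * s)) * (xs - x) / l)) (-(n / (2 * s) / l ^ 2)) (l * (w - xs)) *
          (realRootProd (List.ofFn ξ) (l * (w - xs)))⁻¹ *
          (((l * (x₀ - xs) : ℝ) : ℂ) + y_1 * Complex.I - l * (w - xs))⁻¹)))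
    · refine integral_congr_ae ?_
      -- The point `η = 0` has to be left out: `x₀` may be one of the starting points, and there the
      -- product formula for `exp (n g)` fails.
      filter_upwards [compl_mem_ae_iff.2 (measure_singleton (μ := volume) (0 : ℝ))] with η hη
      have hη : η ≠ 0 := hη
      set z : ℂ := (x₀ : ℂ) + ((l⁻¹ * η : ℝ) : ℂ) * Complex.I with hz
      have hzz : ((l * (x₀ - xs) : ℝ) : ℂ) + η * Complex.I = l * (z - xs) := by
        rw [hz]; push_cast; field_simp; ring
      have hzX : ∀ j, z ≠ (X j : ℂ) := fun j h => by
        have := congrArg Complex.im h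
        simp [hz, hl.ne', hη] at this
      have hzre : z.re = x₀ := by simp [hz]
      rw [hzz, ← mul_assoc, ← hloop.smul]
      · refine hloop.congr _ _ fun w hw => ?_
        exact kernel_integrand_eq hn X hs.ne' ht.ne' x y xs hl.ne' hzX (hav w hw)
      · have c1 : ContinuousOn (fun w : ℂ => (l : ℂ) * (w - xs)) (trace Γ) := by fun_prop
        have c2 : ContinuousOn (fun w : ℂ => quadExp (-(n / (2 * s) * (xs - x) ^ 2))
            (-(2 * (n / (2 * s)) * (xs - x) / l)) (-(n / (2 * s) / l ^ 2)) (l * (w - xs)))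
            (trace Γ) := (differentiable_quadExp _ _ _).continuous.comp_continuousOn c1
        have c3 : ContinuousOn (fun w : ℂ => (realRootProd (List.ofFn ξ) (l * (w - xs)))⁻¹)
            (trace Γ) :=
          ((differentiable_rootProd _).continuous.comp_continuousOn c1).inv₀ fun w hw =>
            hRP w (hav w hw)
        have c4 : ContinuousOn (fun w : ℂ => (l * (z - xs) - l * (w - xs))⁻¹) (trace Γ) := by
          refine ContinuousOn.inv₀ (by fun_prop) fun w hw h => hav' w hw ?_
          have h1 : (l : ℂ) * (z - w) = 0 := by rw [← h]; ring
          rw [← sub_eq_zero.1 ((mul_eq_zero.1 h1).resolve_left hl'), hzre]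
        exact continuousOn_const.mul ((c2.mul c3).mul c4)
    · rw [hline]
      refine integral_congr_ae (Eventually.of_forall fun η => ?_)
      have hc : ∏ j, (-(ξ j : ℂ)) ≠ 0 :=
        Finset.prod_ne_zero_iff.2 fun j _ => neg_ne_zero.2 (by exact_mod_cast hξ0 j)
      have hinv : ∀ w : ℂ, (expProd (n / (2 * s) * (xs - x) ^ 2) (2 * (n / (2 * s)) * (xs - x) / l)
          (n / (2 * s) / l ^ 2) (fun j => -(l * (X j - xs))⁻¹) w)⁻¹
            * ((R : ℂ) + η * Complex.I - w)⁻¹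
          = (∏ j, (-(ξ j : ℂ))) * (quadExp (-(n / (2 * s) * (xs - x) ^ 2))
            (-(2 * (n / (2 * s)) * (xs - x) / l)) (-(n / (2 * s) / l ^ 2)) w
            * (realRootProd (List.ofFn ξ) w)⁻¹ * ((R : ℂ) + η * Complex.I - w)⁻¹) := fun w => by
        rw [show (fun j => -(l * (X j - xs))⁻¹) = fun j => -(ξ j)⁻¹ from rfl,
            expProd_eq _ _ _ ξ hξ0,
          quadExp_neg, mul_inv, mul_inv, inv_inv]
        ring
      simp only [hinv, VGraph.fullInt_const_mul]
      rw [show (fun j => -(l * (X j - xs))⁻¹) = fun j => -(ξ j)⁻¹ from rfl, expProd_eq _ _ _ ξ hξ0]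
      field_simp
  · intro b hb
    obtain ⟨j, rfl⟩ := List.mem_ofFn.1 hb
    rintro ⟨w, hw, h⟩
    refine hav w hw j ?_
    have h1 : (l : ℂ) * (w - X j) = 0 := by
      have h : (l : ℂ) * (w - xs) = ((ξ j : ℝ) : ℂ) := h
      rw [show (l : ℂ) * (w - X j) = l * (w - xs) - ((l * (X j - xs) : ℝ) : ℂ) by push_cast; ring,
          h,
        sub_self]
    exact sub_eq_zero.1 ((mul_eq_zero.1 h1).resolve_left hl')
  · intro b hb
    obtain ⟨j, rfl⟩ := List.mem_ofFn.1 hb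
    rw [← hΓ.winding j]
    congr 1
    ext w
    simp only
    rw [show (l : ℂ) * (w - xs) - ((ξ j : ℝ) : ℂ) = l * (w - X j) by rw [hξ]; push_cast; ring,
      mul_inv, ← mul_assoc, mul_inv_cancel₀ hl', one_mul, one_div]
  · intro b hb
    obtain ⟨j, rfl⟩ := List.mem_ofFn.1 hb
    have h1 : r < |ξ j| := hX j
    simp only [leftGraph, rightGraph]
    rcases lt_abs.1 h1 with h | h
    · exact Or.inr h
    · exact Or.inl (by linarith)
  · rintro _ ⟨w, hw, rfl⟩ h
    refine hav' w hw ?_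
    have h : ((l : ℂ) * (w - xs)).re = l * (x₀ - xs) := h
    rw [hscale] at h
    have := mul_left_cancel₀ hl.ne' h
    linarith
  · intro f hf
    refine contourIntegral_eq_zero_of_differentiableOn hΓ.curves hΓ.avoids_line fun w hw => ?_
    refine DifferentiableAt.const_mul ?_ _
    refine DifferentiableAt.comp (g := f) (f := fun w : ℂ => (l : ℂ) * (w - xs)) w (hf _ ?_)
      (by fun_prop)
    rw [hscale]
    intro h
    have := mul_left_cancel₀ hl.ne' h
    exact hw (by linarith)
  · simp only [leftGraph]; linarith


/-! ### Prefactors, gauge and the comparison with the Airy kernel. -/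

theorem expProd_add {n : ℕ} (a k₀ k₁ k₂ : ℝ) (b : Fin n → ℝ) (ζ : ℂ) :
    expProd (a + k₀) k₁ k₂ b ζ = ((Real.exp a : ℝ) : ℂ) * expProd k₀ k₁ k₂ b ζ := by
  rw [expProd, expProd, quadExp, quadExp, Complex.ofReal_exp, ← mul_assoc, ← Complex.exp_add]
  congr 2
  push_cast
  ring

theorem norm_two_pi_I_sq_inv_mul_I_le : ‖1 / (2 * Real.pi * Complex.I) ^ 2 * Complex.I‖ ≤ 1 := by
  have h3 := Real.pi_gt_three
  have h1 : ‖(2 * Real.pi * Complex.I : ℂ)‖ = 2 * Real.pi := by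
    simp [abs_of_pos Real.pi_pos]
  rw [norm_mul, Complex.norm_I, mul_one, norm_div, norm_one, norm_pow, h1]
  exact div_le_one_of_le₀ (one_le_pow₀ (by linarith)) (by positivity)

/-- The gauge removes the parts of `ea` and `eb` of order `n`, and the half logarithms in them
contribute `√(st)/tc`. With `l = q/(c tc)` the scaling, the Jacobian and `n/√(st)` then multiply to
exactly one, so no multiplicative error remains outside the integrals. -/
theorem prefactor_eq {n q c tc G l s t u' v' g ea eb xs : ℝ} (hq3 : n = q ^ 3) (hq : 0 < q)
    (hc : 0 < c) (htc0 : 0 < tc) (hl : l = q / (c * tc)) (hs0 : 0 < s) (ht0 : 0 < t)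
    (hea : ea = n * G ^ 2 * t / 2 + n * G * v' - Real.log (tc / t) / 2)
    (heb : eb = n * G ^ 2 * s / 2 + n * G * u' + Real.log (tc / s) / 2)
    (hg : g = (-(n * G * (xs + t * G + v')) + n * G ^ 2 * t / 2)
        - (-(n * G * (xs + s * G + u')) + n * G ^ 2 * s / 2)) :
    1 / (c * q ^ 2) * (n / √(s * t) * (l⁻¹ * Real.exp (ea - eb)) * Real.exp g) = 1 := by
  have e1 : Real.exp (ea - eb) * Real.exp g = √(s * t) / tc := by
    rw [← Real.exp_add]
    have : ea - eb + g = Real.log (√(s * t) / tc) := by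
      rw [Real.log_div (by positivity) htc0.ne', Real.log_sqrt (by positivity),
        Real.log_mul hs0.ne' ht0.ne', hea, heb, hg, Real.log_div htc0.ne' hs0.ne',
        Real.log_div htc0.ne' ht0.ne']
      ring
    rw [this, Real.exp_log (by positivity)]
  have e2 : n / √(s * t) * (l⁻¹ * Real.exp (ea - eb)) * Real.exp g
      = n / √(s * t) * l⁻¹ * (Real.exp (ea - eb) * Real.exp g) := by ring
  have : √(s * t) ≠ 0 := by positivity
  rw [e2, e1, hl, hq3]
  field_simp

/-- The heat kernel part of the gauged kernel equals the heat kernel part of the Airy kernel. -/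
theorem gauged_heat_eq {q c tc G τ₁ τ₂ u v : ℝ} (hq : 0 < q) (hc : 0 < c) (h : τ₂ < τ₁)
    {s t x y : ℝ} (hs : s = tc + 2 * τ₁ / (c ^ 2 * q)) (ht : t = tc + 2 * τ₂ / (c ^ 2 * q))
    (hx : x = s * G + u / (c * q ^ 2)) (hy : y = t * G + v / (c * q ^ 2)) :
    1 / (c * q ^ 2) * (√(q ^ 3) / √(2 * Real.pi * (s - t))
      * Real.exp (-(q ^ 3 / (2 * (s - t)) * (x - y) ^ 2))
      * Real.exp ((-(q ^ 3 * G * y) + q ^ 3 * G ^ 2 * t / 2)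
        - (-(q ^ 3 * G * x) + q ^ 3 * G ^ 2 * s / 2)))
      = 1 / √(4 * Real.pi * (τ₁ - τ₂)) * Real.exp (-((u - v) ^ 2 / (4 * (τ₁ - τ₂)))) := by
  have hd : 0 < τ₁ - τ₂ := sub_pos.2 h
  have hst : s - t = 2 * (τ₁ - τ₂) / (c ^ 2 * q) := by rw [hs, ht]; field_simp; ring
  have hst0 : 0 < s - t := by rw [hst]; positivity
  have h1 : √(q ^ 3) / √(2 * Real.pi * (s - t))
      = c * q ^ 2 * (1 / √(4 * Real.pi * (τ₁ - τ₂))) := by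
    rw [← Real.sqrt_div (by positivity), hst,
      show q ^ 3 / (2 * Real.pi * (2 * (τ₁ - τ₂) / (c ^ 2 * q)))
        = (c * q ^ 2) ^ 2 / (4 * Real.pi * (τ₁ - τ₂)) by field_simp; norm_num,
      Real.sqrt_div (by positivity), Real.sqrt_sq (by positivity)]
    ring
  rw [h1, mul_assoc, ← Real.exp_add]
  have h2 : -(q ^ 3 / (2 * (s - t)) * (x - y) ^ 2) + ((-(q ^ 3 * G * y) + q ^ 3 * G ^ 2 * t / 2)
        - (-(q ^ 3 * G * x) + q ^ 3 * G ^ 2 * s / 2)) = -((u - v) ^ 2 / (4 * (τ₁ - τ₂))) := by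
    have e1 : x - y = (s - t) * G + (u - v) / (c * q ^ 2) := by rw [hx, hy]; ring
    have e2 : -(q ^ 3 / (2 * (s - t)) * (x - y) ^ 2)
        + ((-(q ^ 3 * G * y) + q ^ 3 * G ^ 2 * t / 2)
        - (-(q ^ 3 * G * x) + q ^ 3 * G ^ 2 * s / 2))
        = -(q ^ 3 / (2 * (s - t)) * (x - y) ^ 2) + q ^ 3 * G * (x - y)
          - q ^ 3 * G ^ 2 * (s - t) / 2 := by ring
    rw [e2, e1, hst]
    field_simp
    ring
  rw [h2]
  field_simp

-- The heat kernel parts coincide and the prefactor is exactly one, so the difference of the kernels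
-- is `i/(2πi)²` times the difference of two double integrals, to which the contour estimates apply.
set_option maxHeartbeats 800000 in
theorem CubicApprox.norm_gaugedKernel_sub_airyKernel_le {n : ℕ} (hn : n ≠ 0) {X : Fin n → ℝ}
    {μ : Measure ℝ} {xs x₀ : ℝ} {m : ℕ} {Γ : Fin m → ℝ → ℂ} (hΓ : IsAdmissible X x₀ Γ)
    {c tc G q l : ℝ} (hcdef : airyScale μ xs = c) (htc : criticalTime μ xs = tc)
    (hG : stieltjesDeriv μ 0 xs = G) (hqdef : (n : ℝ) ^ (1 / 3 : ℝ) = q) (hl : l = q / (c * tc))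
    (hc : 0 < c) (htc0 : 0 < tc) {τ₁ τ₂ u v s t : ℝ}
    (hs : airyTime μ xs n τ₁ = s) (ht : airyTime μ xs n τ₂ = t) (hs0 : 0 < s) (ht0 : 0 < t)
    {b : Fin n → ℝ} (hb : ∀ j, b j = -(l * (X j - xs))⁻¹) (hX : ∀ j, X j ≠ xs) {K T M R r : ℝ}
    (hw : CubicApprox (n / (2 * s) * (u / (c * q ^ 2)) ^ 2 - Real.log (tc / s) / 2)
      (2 * (n / (2 * s)) * -(s * G + u / (c * q ^ 2)) / l) (n / (2 * s) / l ^ 2) b τ₁ u K)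
    (hz : CubicApprox (n / (2 * t) * (v / (c * q ^ 2)) ^ 2 + Real.log (tc / t) / 2)
      (2 * (n / (2 * t)) * -(t * G + v / (c * q ^ 2)) / l) (n / (2 * t) / l ^ 2) b τ₂ v K)
    (hT₁ : |τ₁| ≤ T) (hT₂ : |τ₂| ≤ T) (hM : 0 ≤ M)
    (hR : M + 2 * T + 2 ≤ R) (hK : 200 * K * (1 + 2 * R) ^ 4 ≤ 1)
    (hr : 12 * (M + T + 1) ≤ r) (hRr : R + 2 ≤ r)
    (hKr : 16 * (K * r) ≤ 1) (hKr' : 200 * K * (1 + r) ^ 4 ≤ r ^ 3 / 12)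
    (hu : -M ≤ u) (hu' : u ≤ M * r) (hexp : Real.exp (-(r ^ 3 / 6)) ≤ K * Real.exp (-R * u)) :
    ‖((1 / (airyScale μ xs * (n : ℝ) ^ (2 / 3 : ℝ)) : ℝ) : ℂ) *
        gaugedKernel μ xs X x₀ Γ (airyTime μ xs n τ₁) (airyTime μ xs n τ₂)
          (airyCentre μ xs n τ₁ + u / (airyScale μ xs * (n : ℝ) ^ (2 / 3 : ℝ)))
          (airyCentre μ xs n τ₂ + v / (airyScale μ xs * (n : ℝ) ^ (2 / 3 : ℝ)))
        - airyKernel τ₁ τ₂ u v‖ ≤ kernelConst R T * K * Real.exp (-R * (u + v)) := by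
  have hT0 : 0 ≤ T := (abs_nonneg _).trans hT₁
  have hR0 : 0 < R := by linarith
  have hn0 : (0 : ℝ) < n := by exact_mod_cast Nat.pos_of_ne_zero hn
  have hq : 0 < q := hqdef ▸ Real.rpow_pos_of_pos hn0 _
  have hl0 : 0 < l := by rw [hl]; positivity
  have hq3 : (n : ℝ) = q ^ 3 := by
    rw [← hqdef, ← Real.rpow_natCast, ← Real.rpow_mul hn0.le]; norm_num
  have hq2 : (n : ℝ) ^ (2 / 3 : ℝ) = q ^ 2 := by
    rw [← hqdef, ← Real.rpow_natCast, ← Real.rpow_mul hn0.le]; norm_num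
  -- `|b_j| ≤ K` and `K r ≤ 1/16` force every scaled point beyond distance `r`; hence the strip
  -- between the left and the right contour contains none of them.
  have hbX : ∀ j, r < |l * (X j - xs)| := fun j => by
    by_contra! hcon
    have h0 : l * (X j - xs) ≠ 0 := mul_ne_zero hl0.ne' (sub_ne_zero.2 (hX j))
    have h1 := hw.le j
    rw [hb, abs_neg, abs_inv] at h1
    have h2 : |l * (X j - xs)| * |l * (X j - xs)|⁻¹ ≤ r * K :=
      mul_le_mul hcon h1 (by positivity) (by linarith)
    rw [mul_inv_cancel₀ (abs_ne_zero.2 h0)] at h2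
    linarith
  obtain rfl : b = fun j => -(l * (X j - xs))⁻¹ := funext hb
  have hint := kernel_integral_eq hn hΓ hs0 ht0 (xs + s * G + u / (c * q ^ 2))
    (xs + t * G + v / (c * q ^ 2)) xs hl0 hR0.le hR0 (by linarith) hbX
  have hA := airy_double_integral_eq (v := v) hT₁ hT₂ (by linarith : 2 * T + 2 ≤ R) hR0.le
    (by linarith : 0 ≤ u + (R - 2))
  have hmain := hw.norm_double_integral_sub_le hz hT₁ hT₂ hM hR hR0.le hK hr hRr hKr hKr' hu hu'
      hexp
  set b : Fin n → ℝ := fun j => -(l * (X j - xs))⁻¹ with hbdef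
  set D := ∫ η : ℝ, expProd (n / (2 * t) * (v / (c * q ^ 2)) ^ 2 + Real.log (tc / t) / 2)
      (2 * (n / (2 * t)) * -(t * G + v / (c * q ^ 2)) / l) (n / (2 * t) / l ^ 2) b
      (R + η * Complex.I) *
    ((leftGraph R hR0.le).fullInt (fun w =>
        (expProd (n / (2 * s) * (u / (c * q ^ 2)) ^ 2 - Real.log (tc / s) / 2)
          (2 * (n / (2 * s)) * -(s * G + u / (c * q ^ 2)) / l) (n / (2 * s) / l ^ 2) b w)⁻¹
          * ((R : ℂ) + η * Complex.I - w)⁻¹)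
      - (rightGraph r).fullInt (fun w =>
        (expProd (n / (2 * s) * (u / (c * q ^ 2)) ^ 2 - Real.log (tc / s) / 2)
          (2 * (n / (2 * s)) * -(s * G + u / (c * q ^ 2)) / l) (n / (2 * s) / l ^ 2) b w)⁻¹
          * ((R : ℂ) + η * Complex.I - w)⁻¹)) with hD
  set DA := ∫ η : ℝ, cubicExp τ₂ v (R + η * Complex.I) *
            (leftGraph R hR0.le).fullInt
              (fun w => (cubicExp τ₁ u w)⁻¹ * ((R : ℂ) + η * Complex.I - w)⁻¹) with hDA
  -- Expanding `n (tG + v')²/(2t)`, the first two terms go into `ea` for the gauge to cancel, and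
  -- only the term in `v'²` stays in `k₀`. The half logarithms in `ea` and `eb` distribute
  -- `tc/√(st)` over the two integrands.
  set ea : ℝ := n * G ^ 2 * t / 2 + n * G * (v / (c * q ^ 2)) - Real.log (tc / t) / 2 with hea
  set eb : ℝ := n * G ^ 2 * s / 2 + n * G * (u / (c * q ^ 2)) + Real.log (tc / s) / 2 with heb
  have hj1 : xs - (xs + t * G + v / (c * q ^ 2)) = -(t * G + v / (c * q ^ 2)) := by ring
  have hk1 : xs - (xs + s * G + u / (c * q ^ 2)) = -(s * G + u / (c * q ^ 2)) := by ring
  have hj0 : n / (2 * t) * (-(t * G + v / (c * q ^ 2))) ^ 2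
      = ea + (n / (2 * t) * (v / (c * q ^ 2)) ^ 2 + Real.log (tc / t) / 2) := by
    rw [hea]; field_simp; ring
  have hk0 : n / (2 * s) * (-(s * G + u / (c * q ^ 2))) ^ 2
      = eb + (n / (2 * s) * (u / (c * q ^ 2)) ^ 2 - Real.log (tc / s) / 2) := by
    rw [heb]; field_simp; ring
  have hscal : ∀ w z : ℂ, (((Real.exp eb : ℝ) : ℂ) * w)⁻¹ * z
      = ((Real.exp (-eb) : ℝ) : ℂ) * (w⁻¹ * z) := fun w z => by
    rw [Real.exp_neg, mul_inv]; push_cast; ring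
  have hint' : ∫ η : ℝ, (fun z : ℂ => contourIntegral Γ (fun w : ℂ =>
        Complex.exp
          ((n : ℂ) / (2 * t) * ((z - ((xs + t * G + v / (c * q ^ 2) : ℝ) : ℂ)) ^ 2
              + 2 * t * logPotential X z)
            - (n : ℂ) / (2 * s) * ((w - ((xs + s * G + u / (c * q ^ 2) : ℝ) : ℂ)) ^ 2
              + 2 * s * logPotential X w)) / (z - w)))
        ((x₀ : ℂ) + η * Complex.I) * Complex.I
      = ((l⁻¹ * Real.exp (ea - eb) : ℝ) : ℂ) * Complex.I * D := by
    rw [hint, hj1, hk1, hj0, hk0]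
    simp only [expProd_add ea, expProd_add eb, hscal, VGraph.fullInt_const_mul]
    rw [hD, sub_eq_add_neg ea eb, Real.exp_add]
    push_cast
    rw [show ((l : ℂ)⁻¹ * (Complex.exp ea * Complex.exp (-eb))) * Complex.I
      = (l : ℂ)⁻¹ * Complex.I * (Complex.exp ea * Complex.exp (-eb)) by ring, mul_assoc _ (_ * _)
          (integral _ _)]
    congr 1
    rw [← integral_const_mul]
    refine integral_congr_ae (Eventually.of_forall fun η => ?_)
    simp only
    ring
  set g : ℝ := (-(n * G * (xs + t * G + v / (c * q ^ 2))) + n * G ^ 2 * t / 2)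
        - (-(n * G * (xs + s * G + u / (c * q ^ 2))) + n * G ^ 2 * s / 2) with hg
  have hpref := prefactor_eq hq3 hq hc htc0 hl hs0 ht0 hea heb hg
  have hI : (2 * Real.pi * Complex.I) ≠ 0 := by
    simp [Real.pi_ne_zero]
  have key : ((1 / (airyScale μ xs * (n : ℝ) ^ (2 / 3 : ℝ)) : ℝ) : ℂ) *
        gaugedKernel μ xs X x₀ Γ (airyTime μ xs n τ₁) (airyTime μ xs n τ₂)
          (airyCentre μ xs n τ₁ + u / (airyScale μ xs * (n : ℝ) ^ (2 / 3 : ℝ)))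
          (airyCentre μ xs n τ₂ + v / (airyScale μ xs * (n : ℝ) ^ (2 / 3 : ℝ)))
        - airyKernel τ₁ τ₂ u v
      = 1 / (2 * Real.pi * Complex.I) ^ 2 * Complex.I * (D - DA) := by
    rw [gaugedKernel, airyCentre, airyCentre, hs, ht, hcdef, hG, hq2, gauge, gauge, hG, ← hg,
        kernel,
      hint', airyKernel, hA]
    have hheat : ((1 / (c * q ^ 2) : ℝ) : ℂ) * ((if t < s then
        ((√n / √(2 * Real.pi * (s - t)) * Real.exp (-((n : ℝ) / (2 * (s - t))
          * (xs + s * G + u / (c * q ^ 2) - (xs + t * G + v / (c * q ^ 2))) ^ 2)) : ℝ) : ℂ)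
        else 0) * ((Real.exp g : ℝ) : ℂ))
        = if τ₂ < τ₁ then ((1 / √(4 * Real.pi * (τ₁ - τ₂))
          * Real.exp (-((u - v) ^ 2 / (4 * (τ₁ - τ₂)))) : ℝ) : ℂ) else 0 := by
      have hs' : s = tc + 2 * τ₁ / (c ^ 2 * q) := by rw [← hs, airyTime, htc, hcdef, hqdef]
      have ht' : t = tc + 2 * τ₂ / (c ^ 2 * q) := by rw [← ht, airyTime, htc, hcdef, hqdef]
      have hiff : t < s ↔ τ₂ < τ₁ := by
        rw [hs', ht', add_lt_add_iff_left, div_lt_div_iff_of_pos_right (by positivity),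
          mul_lt_mul_iff_right₀ two_pos]
      by_cases h : τ₂ < τ₁
      · rw [if_pos h, if_pos (hiff.2 h), ← gauged_heat_eq (G := G) hq hc h hs' ht' rfl rfl, hg, hq3]
        rw [← Complex.ofReal_mul, ← Complex.ofReal_mul]
        congr 4
        · congr 2; ring
        · ring
      · rw [if_neg h, if_neg (fun h' => h (hiff.1 h'))]
        simp
    rw [sub_mul, mul_sub, hheat]
    have hp : (((1 / (c * q ^ 2) * (n / √(s * t) * (l⁻¹ * Real.exp
        (ea - eb)) * Real.exp g) : ℝ)) : ℂ)
        = 1 := by rw [hpref]; simp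
    have e : ((1 / (c * q ^ 2) : ℝ) : ℂ) * ((n : ℂ) / ((2 * Real.pi * Complex.I) ^ 2
        * ((√(s * t) : ℝ) : ℂ)) * (((l⁻¹ * Real.exp (ea - eb) : ℝ) : ℂ) * Complex.I * D)
          * ((Real.exp g : ℝ) : ℂ))
        = 1 / (2 * Real.pi * Complex.I) ^ 2 * Complex.I * D
          * (((1 / (c * q ^ 2) * (n / √(s * t) * (l⁻¹ * Real.exp
              (ea - eb)) * Real.exp g) : ℝ)) : ℂ) := by
      push_cast
      have : ((√(s * t) : ℝ) : ℂ) ≠ 0 := by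
        exact_mod_cast (Real.sqrt_pos.2 (mul_pos hs0 ht0)).ne'
      field_simp
    rw [e, hp]
    ring
  rw [key, norm_mul]
  have hnorm := norm_two_pi_I_sq_inv_mul_I_le
  calc _ ≤ 1 * ‖D - DA‖ := by gcongr
    _ ≤ _ := by rw [one_mul]; exact hmain


/-! ### Inverse moments: rigidity outside the gap, vanishing density inside. -/

theorem isProbabilityMeasure_empiricalMeasure {n : ℕ} (hn : n ≠ 0) (X : Fin n → ℝ) :
    IsProbabilityMeasure (empiricalMeasure X) := by
  refine ⟨?_⟩
  rw [empiricalMeasure, Measure.smul_apply, Measure.finsetSum_apply]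
  simp only [measure_univ, Finset.sum_const, Finset.card_univ, Fintype.card_fin, nsmul_eq_mul,
    mul_one, smul_eq_mul]
  exact ENNReal.inv_mul_cancel (by exact_mod_cast hn) (ENNReal.natCast_ne_top n)

section

variable {μ ν : Measure ℝ} [IsProbabilityMeasure μ] [IsProbabilityMeasure ν] {D : ℝ}

/-- A lower set of reals is empty, everything, or a closed or open half-line; the open half-line is
an increasing union of closed ones. -/
theorem abs_measureReal_sub_le_of_isLowerSet (h : ∀ x, |ν.real (Iic x) - μ.real (Iic x)| ≤ D)
    {A : Set ℝ} (hA : IsLowerSet A) : |ν.real A - μ.real A| ≤ D := by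
  have hD : 0 ≤ D := (abs_nonneg _).trans (h 0)
  rcases A.eq_empty_or_nonempty with rfl | hne
  · simpa using hD
  by_cases hb : BddAbove A
  · by_cases ha : sSup A ∈ A
    · have : A = Iic (sSup A) := Subset.antisymm (fun x hx => le_csSup hb hx)
        fun x hx => hA hx ha
      rw [this]
      exact h _
    · have : A = Iio (sSup A) := Subset.antisymm
        (fun x hx => lt_of_le_of_ne (le_csSup hb hx) fun h => ha (h ▸ hx)) fun x hx => by
          obtain ⟨y, hy, hxy⟩ := exists_lt_of_lt_csSup hne hx
          exact hA hxy.le hy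
      rw [this]
      obtain ⟨a, ha1, ha2, ha3⟩ := exists_seq_strictMono_tendsto (sSup A)
      have hU := iUnion_Iic_eq_Iio_of_lt_of_tendsto ha2 ha3
      have hlim : ∀ (ρ : Measure ℝ) [IsProbabilityMeasure ρ],
          Tendsto (fun k => ρ.real (Iic (a k))) atTop (𝓝 (ρ.real (Iio (sSup A)))) := fun ρ _ => by
        rw [← hU]
        exact (ENNReal.tendsto_toReal (measure_ne_top _ _)).comp
          (tendsto_measure_iUnion_atTop fun i j hij => Iic_subset_Iic.2 (ha1.monotone hij))
      exact le_of_tendsto ((hlim ν).sub (hlim μ)).abs (Eventually.of_forall fun k => h _)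
  · have : A = univ := eq_univ_of_forall fun x => by
      rw [not_bddAbove_iff] at hb
      obtain ⟨y, hy, hxy⟩ := hb x
      exact hA hxy.le hy
    rw [this]
    simpa using hD

/-- An interval is the difference of two nested lower sets, its lower closure `U` and the set `V` of
points strictly below it. Treating all kinds of intervals at once costs the factor two. -/
theorem abs_measureReal_sub_le_of_ordConnected (h : ∀ x, |ν.real (Iic x) - μ.real (Iic x)| ≤ D)
    {A : Set ℝ} (hA : A.OrdConnected) : |ν.real A - μ.real A| ≤ 2 * D := by
  set U : Set ℝ := {x | ∃ y ∈ A, x ≤ y} with hU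
  set V : Set ℝ := {x | ∀ y ∈ A, x < y} with hV
  have hUl : IsLowerSet U := fun x y hyx ⟨z, hz, hxz⟩ => ⟨z, hz, hyx.trans hxz⟩
  have hVl : IsLowerSet V := fun x y hyx hx z hz => hyx.trans_lt (hx z hz)
  rcases A.eq_empty_or_nonempty with rfl | hne
  · simpa using (abs_nonneg _).trans (h 0)
  have hVU : V ⊆ U := fun x hx => by
    obtain ⟨y, hy⟩ := hne
    exact ⟨y, hy, (hx y hy).le⟩
  have hAe : A = U \ V := by
    ext x
    constructor
    · exact fun hx => ⟨⟨x, hx, le_rfl⟩, fun hV => lt_irrefl x (hV x hx)⟩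
    · rintro ⟨⟨y, hy, hxy⟩, hV⟩
      have : ∃ z ∈ A, z ≤ x := by
        by_contra! hcon
        exact hV hcon
      obtain ⟨z, hz, hzx⟩ := this
      exact hA.out hz hy ⟨hzx, hxy⟩
  have h1 := abs_le.1 (abs_measureReal_sub_le_of_isLowerSet h hUl)
  have h2 := abs_le.1 (abs_measureReal_sub_le_of_isLowerSet h hVl)
  have hVm : MeasurableSet V := hVl.ordConnected.measurableSet
  rw [hAe, measureReal_sdiff hVU hVm, measureReal_sdiff hVU hVm, abs_le]
  constructor <;> linarith

/-- Two probability measures with uniformly close distribution functions have close integrals of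
bounded unimodal functions. -/
theorem abs_integral_sub_le_of_ordConnected (h : ∀ x, |ν.real (Iic x) - μ.real (Iic x)| ≤ D)
    {f : ℝ → ℝ} (hf : Measurable f) (h0 : ∀ s, 0 ≤ f s) {B : ℝ} (hB : ∀ s, f s ≤ B)
    (hI : ∀ t, 0 < t → {s | t ≤ f s}.OrdConnected) :
    |∫ s, f s ∂ν - ∫ s, f s ∂μ| ≤ 2 * D * B := by
  have hB0 : 0 ≤ B := (h0 0).trans (hB 0)
  have hint : ∀ (ρ : Measure ℝ) [IsProbabilityMeasure ρ], Integrable f ρ := fun ρ _ =>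
    Integrable.of_bound hf.aestronglyMeasurable B (Eventually.of_forall fun s => by
      rw [Real.norm_of_nonneg (h0 s)]; exact hB s)
  have hanti : ∀ (ρ : Measure ℝ) [IsProbabilityMeasure ρ],
      IntegrableOn (fun t => ρ.real {s | t ≤ f s}) (Ioc 0 B) := fun ρ _ => by
    have : Antitone fun t => ρ.real {s | t ≤ f s} := fun t t' htt' =>
      measureReal_mono (fun s (hs : t' ≤ f s) => htt'.trans hs)
    exact Measure.integrableOn_of_bounded (M := 1) (by simp) this.measurable.aestronglyMeasurable
      (Eventually.of_forall fun t => by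
        rw [Real.norm_of_nonneg measureReal_nonneg]; exact measureReal_le_one)
  -- Layer-cake formula: the integral is that of the measures of superlevel sets, which are
  -- intervals.
  rw [(hint ν).integral_eq_integral_Ioc_meas_le (Eventually.of_forall h0) (Eventually.of_forall hB),
    (hint μ).integral_eq_integral_Ioc_meas_le (Eventually.of_forall h0) (Eventually.of_forall hB),
    ← integral_sub (hanti ν) (hanti μ)]
  have := norm_setIntegral_le_of_norm_le_const (μ := volume) (s := Ioc 0 B) (C := 2 * D)
    (f := fun t => ν.real {s | t ≤ f s} - μ.real {s | t ≤ f s}) (by simp)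
    fun t ht => abs_measureReal_sub_le_of_ordConnected h (hI t ht.1)
  simpa [hB0] using this

end

/-- The function `1 / (σ (s - x)) ^ j` on the side `σ (s - x) > 0` of `x`, with `σ = ±1`. -/
def sidePow (x σ : ℝ) (j : ℕ) (s : ℝ) : ℝ := if 0 < σ * (s - x) then 1 / (σ * (s - x)) ^ j else 0

theorem sidePow_nonneg (x σ : ℝ) (j : ℕ) (s : ℝ) : 0 ≤ sidePow x σ j s := by
  rw [sidePow]; split_ifs <;> positivity

theorem measurable_sidePow (x σ : ℝ) (j : ℕ) : Measurable (sidePow x σ j) :=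
  Measurable.ite (measurableSet_lt measurable_const (by fun_prop)) (by fun_prop) measurable_const

/-- The split into sides is needed because `1/(x - s)^j` is not unimodal, while each half is
monotone away from `x`. At `s = x` both sides vanish through division by zero, which requires `j ≠
0`. -/
theorem one_div_sub_pow_eq {j : ℕ} (hj : j ≠ 0) (x s : ℝ) :
    1 / (x - s) ^ j = sidePow x (-1) j s + (-1) ^ j * sidePow x 1 j s := by
  rw [sidePow, sidePow]
  rcases lt_trichotomy s x with h | rfl | h
  · rw [if_pos (by linarith), if_neg (by linarith)]; ring
  · simp [hj]
  · rw [if_neg (by linarith), if_pos (by linarith), show x - s = -1 * (1 * (s - x)) by ring,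
        mul_pow,
      one_div, mul_inv, ← inv_pow]
    norm_num

theorem one_div_abs_sub_pow_eq {j : ℕ} (hj : j ≠ 0) (x s : ℝ) :
    1 / |x - s| ^ j = sidePow x (-1) j s + sidePow x 1 j s := by
  rw [sidePow, sidePow]
  rcases lt_trichotomy s x with h | rfl | h
  · rw [if_pos (by linarith), if_neg (by linarith), abs_of_pos (by linarith)]; ring
  · simp [hj]
  · rw [if_neg (by linarith), if_pos (by linarith), abs_of_neg (by linarith)]; ring

theorem ordConnected_sidePow {x σ g t : ℝ} (hg : 0 < g) (ht : 0 < t) (j : ℕ) :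
    {s | t ≤ if g < σ * (s - x) then sidePow x σ j s else 0}.OrdConnected := by
  set A : Set ℝ := {y | g < y ∧ t ≤ 1 / y ^ j} with hA
  have hAo : A.OrdConnected := ⟨fun y hy z hz w hw => by
    have hw0 : 0 < w := hg.trans (hy.1.trans_le hw.1)
    refine ⟨hy.1.trans_le hw.1, hz.2.trans ?_⟩
    have := hw.2
    gcongr⟩
  have hiff : ∀ s, (t ≤ if g < σ * (s - x) then sidePow x σ j s else 0) ↔ σ * (s - x) ∈ A := by
    intro s
    by_cases h : g < σ * (s - x)
    · rw [if_pos h, sidePow, if_pos (hg.trans h)]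
      exact ⟨fun h' => ⟨h, h'⟩, fun h' => h'.2⟩
    · rw [if_neg h]
      exact ⟨fun h' => absurd ht h'.not_gt, fun h' => absurd h'.1 h⟩
  refine ⟨fun s hs s' hs' w hw => ?_⟩
  refine (hiff w).2 (hAo.uIcc_subset ((hiff s).1 hs) ((hiff s').1 hs') ?_)
  rw [mem_uIcc]
  rcases le_total 0 σ with h | h
  · exact Or.inl ⟨mul_le_mul_of_nonneg_left (by linarith [hw.1]) h,
      mul_le_mul_of_nonneg_left (by linarith [hw.2]) h⟩
  · exact Or.inr ⟨mul_le_mul_of_nonpos_left (by linarith [hw.2]) h,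
      mul_le_mul_of_nonpos_left (by linarith [hw.1]) h⟩


/-- Only an upper bound for the density near `x` is extracted from the asymptotics; the value at `x`
itself is left free. -/
theorem HasVanishingLimitDensity.exists_density_le {X : (n : ℕ) → Fin n → ℝ} {μ : Measure ℝ}
    {x κ : ℝ} (h : HasVanishingLimitDensity X μ x κ) :
    ∃ ψ : ℝ → ℝ, Measurable ψ ∧ μ = volume.withDensity (fun s => ENNReal.ofReal (ψ s)) ∧
      ∃ c > 0, ∃ δ > 0, ∀ s, 0 < |s - x| → |s - x| ≤ δ → ψ s ≤ c * |s - x| ^ κ := by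
  obtain ⟨ψ, hm, h0, hμ, -, c, hc, hψ⟩ := h.density
  obtain ⟨C, hC, hb⟩ := hψ.isBigO.exists_pos
  have hb := hb.bound
  rw [eventually_nhdsWithin_iff, Metric.eventually_nhds_iff] at hb
  obtain ⟨δ, hδ, hb⟩ := hb
  refine ⟨ψ, hm, hμ, C * c, by positivity, δ / 2, by positivity, fun s hs hs' => ?_⟩
  have := hb (y := s) (by rw [Real.dist_eq]; linarith) fun h0 => by
    rw [mem_singleton_iff] at h0
    simp [h0] at hs
  rw [Real.norm_of_nonneg (h0 s), Real.norm_of_nonneg (by positivity)] at this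
  linarith

theorem lintegral_comp_side {x σ : ℝ} (hσ : σ = 1 ∨ σ = -1) (f : ℝ → ENNReal) :
    ∫⁻ s, f (σ * (s - x)) = ∫⁻ y, f y := by
  rcases hσ with rfl | rfl
  · simp only [one_mul]
    exact lintegral_sub_right_eq_self f x
  · have : ∀ s, -1 * (s - x) = x - s := fun s => by ring
    simp only [this]
    exact lintegral_sub_left_eq_self f x

theorem lintegral_rpow {c g p : ℝ} (hc : 0 ≤ c) (hg : 0 ≤ g) (hp : -1 < p) :
    ∫⁻ y in Ioc 0 g, ENNReal.ofReal (c * y ^ p) = ENNReal.ofReal (c * g ^ (p + 1) / (p + 1)) := by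
  have hi : IntegrableOn (fun y : ℝ => c * y ^ p) (Ioc 0 g) :=
    (intervalIntegrable_iff_integrableOn_Ioc_of_le hg).1
      ((intervalIntegral.intervalIntegrable_rpow' hp).const_mul c)
  rw [← ofReal_integral_eq_lintegral_ofReal hi, ← intervalIntegral.integral_of_le hg,
    intervalIntegral.integral_const_mul, integral_rpow (Or.inl hp),
    Real.zero_rpow (by linarith), sub_zero, mul_div_assoc]
  filter_upwards [ae_restrict_mem measurableSet_Ioc] with y hy
  exact mul_nonneg hc (Real.rpow_nonneg hy.1.le _)

/-- The points at distance at most `g` from `x` on the side `σ`. -/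
def sideNhd (x σ g : ℝ) : Set ℝ := {s | 0 < σ * (s - x) ∧ σ * (s - x) ≤ g}

theorem measurableSet_sideNhd (x σ g : ℝ) : MeasurableSet (sideNhd x σ g) :=
  (measurable_const.mul (measurable_id.sub_const x) : Measurable fun s => σ * (s - x))
    measurableSet_Ioc

theorem abs_side {x σ s : ℝ} (hσ : σ = 1 ∨ σ = -1) : |σ * (s - x)| = |s - x| := by
  rcases hσ with rfl | rfl <;> simp [abs_sub_comm]

/-- Against the density the singularity `y^{-j}` becomes `c y^{κ-j}`, integrable at zero since `j <
κ + 1`. -/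
theorem lintegral_sidePow_le {ψ : ℝ → ℝ} (hψ : Measurable ψ) {x κ c δ : ℝ} (hc : 0 < c)
    (hb : ∀ s, 0 < |s - x| → |s - x| ≤ δ → ψ s ≤ c * |s - x| ^ κ) {σ : ℝ} (hσ : σ = 1 ∨ σ = -1)
    {j : ℕ} (hj : (j : ℝ) < κ + 1) {g : ℝ} (hg : 0 ≤ g) (hgδ : g ≤ δ) :
    ∫⁻ s in sideNhd x σ g, ENNReal.ofReal (sidePow x σ j s)
        ∂(volume.withDensity fun s => ENNReal.ofReal (ψ s))
      ≤ ENNReal.ofReal (c * g ^ (κ + 1 - j) / (κ + 1 - j)) := by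
  rw [setLIntegral_withDensity_eq_setLIntegral_mul _ hψ.ennreal_ofReal
    (measurable_sidePow x σ j).ennreal_ofReal (measurableSet_sideNhd x σ g)]
  have h1 := lintegral_rpow (c := c) (p := κ - j) hc.le hg (by linarith)
  rw [show κ - j + 1 = κ + 1 - j by ring] at h1
  rw [← h1, ← lintegral_indicator measurableSet_Ioc, ← lintegral_comp_side (x := x) hσ,
    ← lintegral_indicator (measurableSet_sideNhd x σ g)]
  refine lintegral_mono fun s => ?_
  by_cases hs : s ∈ sideNhd x σ g
  · rw [indicator_of_mem hs, indicator_of_mem (show σ * (s - x) ∈ Ioc 0 g from hs), Pi.mul_apply,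
      sidePow, if_pos hs.1, ← ENNReal.ofReal_mul' (by have := hs.1; positivity)]
    refine ENNReal.ofReal_le_ofReal ?_
    have h2 := abs_side (x := x) (s := s) hσ
    rw [abs_of_pos hs.1] at h2
    have h3 := hb s (h2 ▸ hs.1) (h2 ▸ hs.2.trans hgδ)
    rw [← h2] at h3
    have h4 := hs.1
    rw [Real.rpow_sub h4, Real.rpow_natCast, mul_one_div, ← mul_div_assoc]
    gcongr
  · rw [indicator_of_notMem hs]
    exact zero_le

section

variable {μ : Measure ℝ} {x σ g e : ℝ} {j : ℕ}

theorem sidePow_eq_add_indicator :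
    sidePow x σ j = fun s => (if g < σ * (s - x) then sidePow x σ j s else 0)
      + (sideNhd x σ g).indicator (sidePow x σ j) s := by
  ext s
  by_cases h : g < σ * (s - x)
  · rw [if_pos h, indicator_of_notMem fun h' => h.not_ge h'.2, add_zero]
  · rw [if_neg h, zero_add]
    by_cases h' : 0 < σ * (s - x)
    · rw [indicator_of_mem (show s ∈ sideNhd x σ g from ⟨h', not_lt.1 h⟩)]
    · rw [indicator_of_notMem fun h'' => h' h''.1, sidePow, if_neg h']

theorem measurable_trunc_sidePow :
    Measurable fun s => if g < σ * (s - x) then sidePow x σ j s else 0 :=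
  Measurable.ite (measurableSet_lt measurable_const (by fun_prop)) (measurable_sidePow _ _ _)
    measurable_const

theorem trunc_sidePow_nonneg (s : ℝ) : 0 ≤ if g < σ * (s - x) then sidePow x σ j s else 0 := by
  split_ifs
  · exact sidePow_nonneg _ _ _ _
  · exact le_rfl

theorem trunc_sidePow_le (hg : 0 < g) (s : ℝ) :
    (if g < σ * (s - x) then sidePow x σ j s else 0) ≤ 1 / g ^ j := by
  split_ifs with h
  · rw [sidePow, if_pos (hg.trans h)]
    gcongr
  · positivity

theorem integrable_trunc_sidePow [IsProbabilityMeasure μ] (hg : 0 < g) :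
    Integrable (fun s => if g < σ * (s - x) then sidePow x σ j s else 0) μ :=
  Integrable.of_bound measurable_trunc_sidePow.aestronglyMeasurable (1 / g ^ j)
    (Eventually.of_forall fun s => by
      rw [Real.norm_of_nonneg (trunc_sidePow_nonneg s)]; exact trunc_sidePow_le hg s)

theorem integrable_indicator_sidePow
    (h : ∫⁻ s in sideNhd x σ g, ENNReal.ofReal (sidePow x σ j s) ∂μ ≤ ENNReal.ofReal e) :
    Integrable ((sideNhd x σ g).indicator (sidePow x σ j)) μ := by
  rw [integrable_indicator_iff (measurableSet_sideNhd x σ g)]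
  refine ⟨(measurable_sidePow x σ j).aestronglyMeasurable, ?_⟩
  rw [hasFiniteIntegral_iff_ofReal (Eventually.of_forall (sidePow_nonneg x σ j))]
  exact h.trans_lt ENNReal.ofReal_lt_top

theorem integrable_sidePow [IsProbabilityMeasure μ] (hg : 0 < g)
    (h : ∫⁻ s in sideNhd x σ g, ENNReal.ofReal (sidePow x σ j s) ∂μ ≤ ENNReal.ofReal e) :
    Integrable (sidePow x σ j) μ := by
  rw [sidePow_eq_add_indicator]
  exact (integrable_trunc_sidePow hg).add (integrable_indicator_sidePow h)

theorem integral_indicator_sidePow_le (he : 0 ≤ e)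
    (h : ∫⁻ s in sideNhd x σ g, ENNReal.ofReal (sidePow x σ j s) ∂μ ≤ ENNReal.ofReal e) :
    ∫ s, (sideNhd x σ g).indicator (sidePow x σ j) s ∂μ ≤ e := by
  rw [integral_indicator (measurableSet_sideNhd x σ g),
    integral_eq_lintegral_of_nonneg_ae (Eventually.of_forall (sidePow_nonneg x σ j))
      (measurable_sidePow x σ j).aestronglyMeasurable]
  exact ENNReal.toReal_le_of_le_ofReal he h

/-- Comparison of the empirical and the limiting one-sided inverse moments. -/
theorem abs_mean_sidePow_sub_integral_le [IsProbabilityMeasure μ] {n : ℕ}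
    (hn : n ≠ 0) {X : Fin n → ℝ} {D : ℝ}
    (hD : ∀ y, |(empiricalMeasure X).real (Iic y) - μ.real (Iic y)| ≤ D) (hσ : σ = 1 ∨ σ = -1)
    (hg : 0 < g) (hX : ∀ k, g < |X k - x|) (he : 0 ≤ e)
    (h : ∫⁻ s in sideNhd x σ g, ENNReal.ofReal (sidePow x σ j s) ∂μ ≤ ENNReal.ofReal e) :
    |(n : ℝ)⁻¹ * ∑ k, sidePow x σ j (X k) - ∫ s, sidePow x σ j s ∂μ| ≤ 2 * D * (1 / g ^ j) + e := by
  have := isProbabilityMeasure_empiricalMeasure hn X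
  have h1 := abs_integral_sub_le_of_ordConnected hD (measurable_trunc_sidePow (x := x) (σ := σ)
    (g := g) (j := j)) trunc_sidePow_nonneg (trunc_sidePow_le hg)
    fun t ht => ordConnected_sidePow hg ht j
  -- No starting point lies within `g` of `x`, so the truncation is invisible to the empirical
  -- measure; for `μ` it costs at most `e`.
  have h2 : ∫ s, (if g < σ * (s - x) then sidePow x σ j s else 0) ∂(empiricalMeasure X)
      = (n : ℝ)⁻¹ * ∑ k, sidePow x σ j (X k) := by
    rw [integral_empiricalMeasure, smul_eq_mul]
    congr 1
    refine Finset.sum_congr rfl fun k _ => ?_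
    have h3 := hX k
    rw [← abs_side hσ] at h3
    by_cases h4 : g < σ * (X k - x)
    · rw [if_pos h4]
    · rw [if_neg h4, sidePow, if_neg]
      have := (lt_abs.1 h3).resolve_left h4
      linarith
  have h3 : ∫ s, sidePow x σ j s ∂μ = ∫ s, (if g < σ * (s - x) then sidePow x σ j s else 0) ∂μ
      + ∫ s, (sideNhd x σ g).indicator (sidePow x σ j) s ∂μ := by
    rw [← integral_add (integrable_trunc_sidePow hg) (integrable_indicator_sidePow h),
      ← sidePow_eq_add_indicator]
  have h4 := integral_indicator_sidePow_le he h
  have h5 : 0 ≤ ∫ s, (sideNhd x σ g).indicator (sidePow x σ j) s ∂μ :=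
    integral_nonneg fun s => indicator_nonneg (fun s _ => sidePow_nonneg x σ j s) s
  rw [h2] at h1
  rw [h3]
  rw [abs_le] at h1 ⊢
  constructor <;> linarith

end

/-- The radius `g = m n^{-1/(κ+1)}` of the gap balances the two errors: rigidity gives `n⁻¹ g^{-j}`
and the density gives `g^{κ+1-j}`, both of order `n^{-1+j/(κ+1)}`. The case `j = 3` is where `κ > 2`
enters. -/
theorem exists_abs_mean_sidePow_sub_le {X : (n : ℕ) → Fin n → ℝ} {μ : Measure ℝ}
    [IsProbabilityMeasure μ] {x κ : ℝ} (h : HasVanishingLimitDensity X μ x κ) (hr : IsRigid X μ)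
    (hgap : HasInitialGap X x κ) :
    (∀ σ : ℝ, (σ = 1 ∨ σ = -1) → ∀ j : ℕ, j ≤ 3 → Integrable (sidePow x σ j) μ) ∧
    ∃ C > 0, ∃ N : ℕ, ∀ n ≥ N, 0 < n → ∀ σ : ℝ, (σ = 1 ∨ σ = -1) → ∀ j : ℕ, j ≤ 3 →
      |(n : ℝ)⁻¹ * ∑ k, sidePow x σ j (X n k) - ∫ s, sidePow x σ j s ∂μ|
        ≤ C * (n : ℝ) ^ (-1 + j / (κ + 1) : ℝ) := by
  obtain ⟨ψ, hm, hμ, c, hc, δ, hδ, hb⟩ := h.exists_density_le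
  obtain ⟨M, hM, n₁, hr⟩ := hr
  obtain ⟨m, hm0, n₂, hgap⟩ := hgap
  have hκ := h.two_lt
  have hjκ : ∀ j : ℕ, j ≤ 3 → (j : ℝ) < κ + 1 := fun j hj => by
    have : (j : ℝ) ≤ 3 := by exact_mod_cast hj
    linarith
  have hlint : ∀ σ : ℝ, (σ = 1 ∨ σ = -1) → ∀ j : ℕ, j ≤ 3 → ∀ g, 0 ≤ g → g ≤ δ →
      ∫⁻ s in sideNhd x σ g, ENNReal.ofReal (sidePow x σ j s) ∂μ
      ≤ ENNReal.ofReal (c * g ^ (κ + 1 - j) / (κ + 1 - j)) := fun σ hσ j hj g hg hgδ => by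
    rw [hμ]
    exact lintegral_sidePow_le hm hc hb hσ (hjκ j hj) hg hgδ
  refine ⟨fun σ hσ j hj => integrable_sidePow hδ (hlint σ hσ j hj δ hδ.le le_rfl), ?_⟩
  have hlim : Tendsto (fun n : ℕ => m * (n : ℝ) ^ (-(1 / (κ + 1)))) atTop (𝓝 0) := by
    have := ((tendsto_rpow_neg_atTop (y := 1 / (κ + 1)) (by
      have : 0 < κ + 1 := by linarith
      positivity)).comp tendsto_natCast_atTop_atTop).const_mul m
    simpa using this
  obtain ⟨n₃, hn₃⟩ := eventually_atTop.1 (hlim.eventually (ge_mem_nhds hδ))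
  set a : ℕ → ℝ := fun j => 2 * M * (1 / m ^ j) + c * m ^ (κ + 1 - j) / (κ + 1 - j) with ha
  have ha0 : ∀ j : ℕ, j ≤ 3 → 0 ≤ a j := fun j hj => by
    have := sub_pos.2 (hjκ j hj)
    simp only [ha]
    positivity
  refine ⟨1 + ∑ j ∈ Finset.range 4, a j, ?_, max (max n₁ n₂) n₃, fun n hn hn0 σ hσ j hj => ?_⟩
  · have : 0 ≤ ∑ j ∈ Finset.range 4, a j := Finset.sum_nonneg fun j hj => ha0 j (by
      rw [Finset.mem_range] at hj; omega)
    linarith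
  have hn' : (0 : ℝ) < n := by exact_mod_cast hn0
  set g := m * (n : ℝ) ^ (-(1 / (κ + 1))) with hg
  have hg0 : 0 < g := by positivity
  have hgδ : g ≤ δ := hn₃ n ((le_max_right _ _).trans hn)
  have hsub := sub_pos.2 (hjκ j hj)
  have hX : ∀ k, g < |X n k - x| := fun k => by
    have := hgap n (((le_max_right _ _).trans (le_max_left _ _)).trans hn) hn0 k
    rw [mem_Icc, not_and_or, not_le, not_le, ← hg] at this
    rcases this with h | h
    · exact lt_abs.2 (Or.inr (by linarith))
    · exact lt_abs.2 (Or.inl (by linarith))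
  have h1 := abs_mean_sidePow_sub_integral_le (j := j) hn0.ne'
    (hr n (((le_max_left _ _).trans (le_max_left _ _)).trans hn) hn0) hσ hg0 hX
    (by positivity) (hlint σ hσ j hj g hg0.le hgδ)
  refine h1.trans ?_
  have hκ1 : κ + 1 ≠ 0 := by linarith
  have e1 : M / n * (1 / g ^ j) = M * (1 / m ^ j) * (n : ℝ) ^ (-1 + j / (κ + 1) : ℝ) := by
    rw [hg, mul_pow, ← Real.rpow_natCast ((n : ℝ) ^ (-(1 / (κ + 1)))), ← Real.rpow_mul hn'.le,
      Real.rpow_add hn', Real.rpow_neg_one, show (j : ℝ) / (κ + 1) = -(-(1 / (κ + 1)) * j) by ring,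
      Real.rpow_neg hn'.le]
    field_simp
  have e2 : g ^ (κ + 1 - j) = m ^ (κ + 1 - j) * (n : ℝ) ^ (-1 + j / (κ + 1) : ℝ) := by
    rw [hg, Real.mul_rpow hm0.le (by positivity), ← Real.rpow_mul hn'.le]
    congr 2
    field_simp
    ring
  have e3 : 2 * (M / n) * (1 / g ^ j) + c * g ^ (κ + 1 - j) / (κ + 1 - j)
      = a j * (n : ℝ) ^ (-1 + j / (κ + 1) : ℝ) := by
    rw [e2, mul_assoc 2, e1, ha]; ring
  rw [e3]
  have := Finset.single_le_sum (f := a) (fun j hj => ha0 j (by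
    rw [Finset.mem_range] at hj; omega)) (Finset.mem_range.2 (by omega : j < 4))
  gcongr
  linarith


/-! ### From inverse moments to the cubic approximation. -/

theorem abs_log_le {y d : ℝ} (hy : 0 < y) (h1 : |1 - y| ≤ d) (h2 : |1 - y⁻¹| ≤ d) :
    |Real.log y| ≤ d := by
  have e1 := Real.log_le_sub_one_of_pos hy
  have e2 := Real.one_sub_inv_le_log_of_pos hy
  rw [abs_le] at *
  constructor <;> linarith

/-- The constant in the approximation by the cubic exponential. -/
def approxConst (A c c₁ tc S₃ T : ℝ) : ℝ :=
  (A / (c ^ 2 * tc) + 4 / (tc * c ^ 2) * T) + (A / c₁ + A * (4 / (tc * c ^ 2) * T))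
    + (T * (4 / (tc * c ^ 2) * T) + A / (2 * c₁ ^ 2)) + A / S₃ + A ^ 2 / (c₁ * S₃) + A / c₁

/-- The `j`-th power sum of the `b_k` is `n (c₁ q)^{-j}` times the `j`-th empirical inverse moment,
with `n = q³`. The centre `x* + s G` cancels the first moment, leaving `-u tc/s` by `c c₁ tc = 1`.
At second order `S₂ = 1/tc` cancels and the shift `s - tc` produces `-τ tc/s`. The third power sum
tends to one by `c₁³ = S₃`. The hypothesis on `k₀` admits either sign of the half logarithm, as the
two integrands need opposite ones. -/
theorem cubicApprox_of_moments {n : ℕ} {X : Fin n → ℝ} {x q c c₁ tc S₁ S₂ S₃ s τ u A T p k₀ : ℝ}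
    (hq3 : (n : ℝ) = q ^ 3) (hq : 0 < q) (hc : 0 < c) (hc₁ : 0 < c₁) (htc : 0 < tc)
    (hcc : c * c₁ * tc = 1) (hc₁3 : c₁ ^ 3 = S₃) (hS₂ : S₂ = tc⁻¹)
    (hs : s = tc + 2 * τ / (c ^ 2 * q)) (hs2 : tc / 2 ≤ s) (hτ : |τ| ≤ T) (hA : 0 ≤ A)
    (hp : 0 ≤ p)
    (h1 : q ^ 2 * |(n : ℝ)⁻¹ * ∑ k, 1 / (x - X k) ^ 1 - S₁| ≤ A * p)
    (h2 : q * |(n : ℝ)⁻¹ * ∑ k, 1 / (x - X k) ^ 2 - S₂| ≤ A * p)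
    (h3 : |(n : ℝ)⁻¹ * ∑ k, 1 / (x - X k) ^ 3 - S₃| ≤ A * p)
    (h3' : (n : ℝ)⁻¹ * ∑ k, 1 / |x - X k| ^ 3 ≤ A)
    (hgap : ∀ k, 1 / (q * |x - X k|) ≤ A * p)
    (hqp : 1 / q ≤ p) (hu : |u| / q ≤ A * p) (hu2 : u ^ 2 / q ≤ A * p)
    (hk₀ : |k₀ - n / (2 * s) * (u / (c * q ^ 2)) ^ 2| ≤ |Real.log (tc / s)| / 2) :
    CubicApprox k₀ (2 * (n / (2 * s)) * -(s * S₁ + u / (c * q ^ 2)) / (c₁ * q))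
      (n / (2 * s) / (c₁ * q) ^ 2) (fun k => -(c₁ * q * (X k - x))⁻¹) τ u
      (approxConst A c c₁ tc S₃ T * p) := by
  have hT : 0 ≤ T := (abs_nonneg _).trans hτ
  have hs0 : 0 < s := by linarith
  have hS₃ : 0 < S₃ := hc₁3 ▸ pow_pos hc₁ 3
  have hn0 : (0 : ℝ) < n := by rw [hq3]; positivity
  set W : ℝ := 4 / (tc * c ^ 2) * T with hW
  have hW0 : 0 ≤ W := by positivity
  have hst : |s - tc| ≤ 2 * T / (c ^ 2 * q) := by
    rw [hs, add_sub_cancel_left, abs_div, abs_mul, abs_of_pos (by positivity : 0 < c ^ 2 * q),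
      abs_two]
    gcongr
  have hr1 : |1 - tc / s| ≤ W * (1 / q) := by
    rw [one_sub_div hs0.ne', abs_div, abs_of_pos hs0, div_le_iff₀ hs0]
    refine hst.trans ?_
    have : W * (1 / q) * (tc / 2) ≤ W * (1 / q) * s := by gcongr
    refine le_trans (le_of_eq ?_) this
    rw [hW]; field_simp; ring
  have hr2 : |1 - (tc / s)⁻¹| ≤ W * (1 / q) := by
    rw [inv_div, one_sub_div htc.ne', abs_div, abs_of_pos htc, div_le_iff₀ htc, abs_sub_comm]
    refine hst.trans ?_
    rw [hW]
    have : 2 * T / (c ^ 2 * q) ≤ 4 * T / (c ^ 2 * q) := by gcongr; norm_num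
    refine this.trans (le_of_eq ?_)
    field_simp
  have hlog : |Real.log (tc / s)| ≤ W * (1 / q) := abs_log_le (by positivity) hr1 hr2
  have hWp : W * (1 / q) ≤ W * p := by gcongr
  have hp1 : 0 ≤ A / (c ^ 2 * tc) + W := by positivity
  have hp2 : 0 ≤ A / c₁ + A * W := by positivity
  have hp3 : 0 ≤ T * W + A / (2 * c₁ ^ 2) := by positivity
  have hp4 : 0 ≤ A / S₃ := by positivity
  have hp5 : 0 ≤ A ^ 2 / (c₁ * S₃) := by positivity
  have hp6 : 0 ≤ A / c₁ := by positivity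
  have up : ∀ {y z : ℝ}, z ≤ approxConst A c c₁ tc S₃ T → y ≤ z * p →
      y ≤ approxConst A c c₁ tc S₃ T * p := fun hz hy =>
    hy.trans (mul_le_mul_of_nonneg_right hz hp)
  have hb : ∀ k, -(c₁ * q * (X k - x))⁻¹ = (c₁ * q)⁻¹ * (1 / (x - X k)) := fun k => by
    rw [mul_inv, one_div, ← mul_neg, ← inv_neg, neg_sub]
  have hbj : ∀ j : ℕ, ∑ k, (-(c₁ * q * (X k - x))⁻¹) ^ j
      = n * ((c₁ * q)⁻¹) ^ j * ((n : ℝ)⁻¹ * ∑ k, 1 / (x - X k) ^ j) := fun j => by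
    simp only [hb, mul_pow, one_div, inv_pow]
    rw [← Finset.mul_sum]
    field_simp
  have hc1c : (c * c₁) * tc = 1 := hcc
  have hbabs : ∀ k, |-(c₁ * q * (X k - x))⁻¹| ≤ A / c₁ * p := fun k => by
    rw [hb, abs_mul, abs_of_pos (by positivity : 0 < (c₁ * q)⁻¹), abs_div, abs_one]
    have := hgap k
    calc (c₁ * q)⁻¹ * (1 / |x - X k|) = c₁⁻¹ * (1 / (q * |x - X k|)) := by
          rw [mul_inv, one_div, one_div, mul_inv]; ring
      _ ≤ c₁⁻¹ * (A * p) := by gcongr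
      _ = _ := by ring
  refine ⟨up (z := A / (c ^ 2 * tc) + W) ?_ ?_, up (z := A / c₁ + A * W) ?_ ?_,
    up (z := T * W + A / (2 * c₁ ^ 2)) ?_ ?_, up (z := A / S₃) ?_ ?_,
    up (z := A ^ 2 / (c₁ * S₃)) ?_ ?_, fun k => up (z := A / c₁) ?_ (hbabs k)⟩
  · rw [approxConst]; linarith
  · have e : n / (2 * s) * (u / (c * q ^ 2)) ^ 2 = u ^ 2 / q * (1 / (c ^ 2 * (2 * s))) := by
      rw [hq3]; field_simp
    have e2 : u ^ 2 / q * (1 / (c ^ 2 * (2 * s))) ≤ A * p * (1 / (c ^ 2 * tc)) := by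
      gcongr
      linarith
    have e3 : |k₀| ≤ |k₀ - n / (2 * s) * (u / (c * q ^ 2)) ^ 2|
        + n / (2 * s) * (u / (c * q ^ 2)) ^ 2 := by
      have h0 : 0 ≤ n / (2 * s) * (u / (c * q ^ 2)) ^ 2 := by positivity
      have := abs_add_le (k₀ - n / (2 * s) * (u / (c * q ^ 2)) ^ 2)
        (n / (2 * s) * (u / (c * q ^ 2)) ^ 2)
      rwa [sub_add_cancel, abs_of_nonneg h0] at this
    have e4 : A * p * (1 / (c ^ 2 * tc)) = A / (c ^ 2 * tc) * p := by ring
    have := abs_nonneg (Real.log (tc / s))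
    rw [e] at e3
    rw [e] at hk₀
    linarith
  · rw [approxConst]; linarith
  · have e : 2 * (n / (2 * s)) * -(s * S₁ + u / (c * q ^ 2)) / (c₁ * q)
        + ∑ k, -(c₁ * q * (X k - x))⁻¹ + u
        = c₁⁻¹ * (q ^ 2 * ((n : ℝ)⁻¹ * ∑ k, 1 / (x - X k) ^ 1 - S₁)) + u * (1 - tc / s) := by
      have := hbj 1
      simp only [pow_one] at this ⊢
      rw [this]
      generalize (n : ℝ)⁻¹ * ∑ k, 1 / (x - X k) = m₁
      rw [hq3]
      have htc' : tc = 1 / (c * c₁) := by rw [eq_div_iff (by positivity)]; linarith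
      rw [htc']
      field_simp
      ring
    rw [e]
    refine (abs_add_le _ _).trans ?_
    rw [abs_mul, abs_mul, abs_mul, abs_of_pos (by positivity : 0 < c₁⁻¹),
      abs_of_pos (by positivity : 0 < q ^ 2)]
    have t1 : c₁⁻¹ * (q ^ 2 * |(n : ℝ)⁻¹ * ∑ k, 1 / (x - X k) ^ 1 - S₁|) ≤ c₁⁻¹ * (A * p) := by
      gcongr
    have t2 : |u| * |1 - tc / s| ≤ A * p * W := by
      calc |u| * |1 - tc / s| ≤ |u| * (W * (1 / q)) := by gcongr
        _ = |u| / q * W := by ring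
        _ ≤ A * p * W := by gcongr
    refine (add_le_add t1 t2).trans (le_of_eq ?_)
    ring
  · rw [approxConst]; linarith
  · have e : n / (2 * s) / (c₁ * q) ^ 2 - (∑ k, (-(c₁ * q * (X k - x))⁻¹) ^ 2) / 2 + τ
        = τ * (1 - tc / s)
          - (2 * c₁ ^ 2)⁻¹ * (q * ((n : ℝ)⁻¹ * ∑ k, 1 / (x - X k) ^ 2 - S₂)) := by
      rw [hbj 2]
      generalize (n : ℝ)⁻¹ * ∑ k, 1 / (x - X k) ^ 2 = m₂
      have hτ' : τ = (s - tc) * (c ^ 2 * q) / 2 := by rw [hs]; field_simp; ring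
      have htc' : tc = 1 / (c * c₁) := by rw [eq_div_iff (by positivity)]; linarith
      rw [hτ', hS₂, hq3, htc']
      field_simp
      ring
    rw [e]
    refine (abs_sub _ _).trans ?_
    rw [abs_mul, abs_mul, abs_mul, abs_of_pos (by positivity : 0 < (2 * c₁ ^ 2)⁻¹), abs_of_pos hq]
    have t1 : |τ| * |1 - tc / s| ≤ T * (W * p) :=
      mul_le_mul hτ (hr1.trans hWp) (abs_nonneg _) hT
    have t2 : (2 * c₁ ^ 2)⁻¹ * (q * |(n : ℝ)⁻¹ * ∑ k, 1 / (x - X k) ^ 2 - S₂|)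
        ≤ (2 * c₁ ^ 2)⁻¹ * (A * p) := by gcongr
    refine (add_le_add t1 t2).trans (le_of_eq ?_)
    ring
  · rw [approxConst]; linarith
  · have e : ∑ k, (-(c₁ * q * (X k - x))⁻¹) ^ 3 - 1
        = S₃⁻¹ * ((n : ℝ)⁻¹ * ∑ k, 1 / (x - X k) ^ 3 - S₃) := by
      rw [hbj 3, inv_pow, mul_pow, hc₁3, ← hq3]
      field_simp
    rw [e, abs_mul, abs_of_pos (by positivity : 0 < S₃⁻¹)]
    calc S₃⁻¹ * |(n : ℝ)⁻¹ * ∑ k, 1 / (x - X k) ^ 3 - S₃| ≤ S₃⁻¹ * (A * p) := by gcongr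
      _ = _ := by ring
  · rw [approxConst]; linarith
  · have hterm : ∀ k, (-(c₁ * q * (X k - x))⁻¹) ^ 4
        ≤ A / c₁ * p * ((c₁ * q)⁻¹ ^ 3 * (1 / |x - X k| ^ 3)) := fun k => by
      have e : (-(c₁ * q * (X k - x))⁻¹) ^ 4
          = |-(c₁ * q * (X k - x))⁻¹| * |-(c₁ * q * (X k - x))⁻¹| ^ 3 := by
        rw [← pow_succ', ← abs_pow, abs_of_nonneg ((by decide : Even 4).pow_nonneg _)]
      rw [e]
      refine mul_le_mul (hbabs k) (le_of_eq ?_) (by positivity) (by positivity)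
      rw [hb, abs_mul, abs_of_pos (by positivity : 0 < (c₁ * q)⁻¹), abs_div, abs_one, mul_pow,
        div_pow, one_pow]
    refine (Finset.sum_le_sum fun k _ => hterm k).trans ?_
    rw [← Finset.mul_sum, ← Finset.mul_sum]
    have e : (c₁ * q)⁻¹ ^ 3 * ∑ k, 1 / |x - X k| ^ 3
        = S₃⁻¹ * ((n : ℝ)⁻¹ * ∑ k, 1 / |x - X k| ^ 3) := by
      rw [inv_pow, mul_pow, hc₁3, ← hq3, mul_inv]; ring
    rw [e]
    calc A / c₁ * p * (S₃⁻¹ * ((n : ℝ)⁻¹ * ∑ k, 1 / |x - X k| ^ 3))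
        ≤ A / c₁ * p * (S₃⁻¹ * A) := by gcongr
      _ = _ := by field_simp
  · rw [approxConst]; linarith


theorem CubicApprox.mono {n : ℕ} {k₀ k₁ k₂ : ℝ} {b : Fin n → ℝ} {τ v K K' : ℝ}
    (h : CubicApprox k₀ k₁ k₂ b τ v K) (hK : K ≤ K') : CubicApprox k₀ k₁ k₂ b τ v K' :=
  ⟨h.zero.trans hK, h.one.trans hK, h.two.trans hK, h.three.trans hK, h.four.trans hK,
    fun j => (h.le j).trans hK⟩

theorem kernelConst_nonneg (R T : ℝ) : 0 ≤ kernelConst R T := by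
  have := contourConst_pos R T
  have := diffConst_pos R T
  unfold kernelConst
  positivity

theorem integrable_one_div_sub_pow {μ : Measure ℝ} {x : ℝ} {j : ℕ} (hj : j ≠ 0)
    (h : ∀ σ : ℝ, (σ = 1 ∨ σ = -1) → Integrable (sidePow x σ j) μ) :
    Integrable (fun s => 1 / (x - s) ^ j) μ ∧
      ∫ s, 1 / (x - s) ^ j ∂μ
        = ∫ s, sidePow x (-1) j s ∂μ + (-1) ^ j * ∫ s, sidePow x 1 j s ∂μ := by
  simp only [one_div_sub_pow_eq hj]
  have i1 := h (-1) (Or.inr rfl)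
  have i2 := (h 1 (Or.inl rfl)).const_mul ((-1) ^ j)
  refine ⟨i1.add i2, ?_⟩
  rw [integral_add i1 i2, integral_const_mul]

/-- Convergence rates for the inverse moments of the empirical measures. -/
theorem exists_moment_bounds {X : (n : ℕ) → Fin n → ℝ} {μ : Measure ℝ}
    [IsProbabilityMeasure μ] {x κ ε : ℝ} (h : HasVanishingLimitDensity X μ x κ)
    (hr : IsRigid X μ) (hgap : HasInitialGap X x κ) (hε₀ : 0 < ε)
    (hε : ε < (κ - 2) / (6 * (κ + 1))) :
    ∃ A > 0, ∃ N : ℕ, ∀ n ≥ N, 0 < n →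
      ((n : ℝ) ^ (1 / 3 : ℝ)) ^ 2 * |(n : ℝ)⁻¹ * ∑ k, 1 / (x - X n k) ^ 1 - ∫ s, 1 / (x - s) ^ 1 ∂μ|
        ≤ A * (n : ℝ) ^ (-(2 * ε)) ∧
      (n : ℝ) ^ (1 / 3 : ℝ) * |(n : ℝ)⁻¹ * ∑ k, 1 / (x - X n k) ^ 2 - ∫ s, 1 / (x - s) ^ 2 ∂μ|
        ≤ A * (n : ℝ) ^ (-(2 * ε)) ∧
      |(n : ℝ)⁻¹ * ∑ k, 1 / (x - X n k) ^ 3 - ∫ s, 1 / (x - s) ^ 3 ∂μ|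
        ≤ A * (n : ℝ) ^ (-(2 * ε)) ∧
      (n : ℝ)⁻¹ * ∑ k, 1 / |x - X n k| ^ 3 ≤ A ∧
      ∀ k, X n k ≠ x ∧ 1 / ((n : ℝ) ^ (1 / 3 : ℝ) * |x - X n k|) ≤ A * (n : ℝ) ^ (-(2 * ε)) := by
  obtain ⟨hint, C, hC, N, hCN⟩ := exists_abs_mean_sidePow_sub_le h hr hgap
  obtain ⟨m, hm, N', hgap⟩ := hgap
  have hκ := h.two_lt
  -- Since `1/(κ+1) = 1/3 - d`, the rescaled moment errors are of order `n^{-jd}` for `j = 1, 2, 3`,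
  -- and the gap gives `n^{-d}`. The slowest rate `n^{-d}` is below `n^{-2ε}` because the bound on
  -- `ε` is `d/2`.
  set d := (κ - 2) / (3 * (κ + 1)) with hd
  have hεd : 2 * ε < d := by
    have : d = 2 * ((κ - 2) / (6 * (κ + 1))) := by rw [hd]; field_simp; ring
    linarith
  have hdκ : 1 / (κ + 1) = 1 / 3 - d := by
    have : κ + 1 ≠ 0 := by linarith
    rw [hd]; field_simp; ring
  set P := ∫ s, sidePow x (-1) 3 s ∂μ + ∫ s, sidePow x 1 3 s ∂μ with hP
  have hP0 : 0 ≤ P := add_nonneg (integral_nonneg fun s => sidePow_nonneg _ _ _ _)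
    (integral_nonneg fun s => sidePow_nonneg _ _ _ _)
  -- `2C` accounts for the errors on the two sides of `x`, `P` is the absolute third inverse moment
  -- of `μ`, and `1/m` comes from the gap.
  refine ⟨2 * C + P + 1 / m, by positivity, max N N', fun n hn hn0 => ?_⟩
  have hn1 : (1 : ℝ) ≤ n := by exact_mod_cast hn0
  have hn' : (0 : ℝ) < n := by linarith
  set p := (n : ℝ) ^ (-(2 * ε)) with hp
  have hp0 : 0 ≤ p := by positivity
  have hrp : ∀ {a : ℝ}, a ≤ -(2 * ε) → (n : ℝ) ^ a ≤ p := fun ha =>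
    Real.rpow_le_rpow_of_exponent_le hn1 ha
  have hmom : ∀ j : ℕ, j ≠ 0 → j ≤ 3 →
      |(n : ℝ)⁻¹ * ∑ k, 1 / (x - X n k) ^ j - ∫ s, 1 / (x - s) ^ j ∂μ|
        ≤ 2 * C * (n : ℝ) ^ (-1 + j / (κ + 1) : ℝ) := fun j hj0 hj => by
    have e1 := hCN n ((le_max_left _ _).trans hn) hn0 (-1) (Or.inr rfl) j hj
    have e2 := hCN n ((le_max_left _ _).trans hn) hn0 1 (Or.inl rfl) j hj
    rw [(integrable_one_div_sub_pow hj0 fun σ hσ => hint σ hσ j hj).2]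
    simp only [one_div_sub_pow_eq hj0 x (X n _), Finset.sum_add_distrib, ← Finset.mul_sum]
    rw [mul_add, mul_left_comm, add_sub_add_comm, ← mul_sub]
    refine (abs_add_le _ _).trans ?_
    rw [abs_mul ((-1) ^ j), abs_pow, abs_neg, abs_one, one_pow, one_mul]
    linarith
  have hA : ∀ {y a : ℝ}, y ≤ 2 * C * a → a ≤ p → y ≤ (2 * C + P + 1 / m) * p := fun h1 h2 => by
    have : 0 ≤ 1 / m := by positivity
    exact (h1.trans (mul_le_mul_of_nonneg_left h2 (by positivity))).trans
      (mul_le_mul_of_nonneg_right (by linarith) hp0)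
  have hexp : ∀ j : ℕ, (j : ℝ) / (κ + 1) = j * (1 / 3 - d) := fun j => by
    rw [← hdκ]; ring
  refine ⟨?_, ?_, ?_, ?_, fun k => ?_⟩
  · refine hA (a := ((n : ℝ) ^ (1 / 3 : ℝ)) ^ 2 * (n : ℝ) ^ (-1 + (1 : ℕ) / (κ + 1) : ℝ)) ?_ ?_
    · have := mul_le_mul_of_nonneg_left (hmom 1 (by norm_num) (by norm_num))
        (by positivity : 0 ≤ ((n : ℝ) ^ (1 / 3 : ℝ)) ^ 2)
      linarith
    · rw [← Real.rpow_natCast, ← Real.rpow_mul hn'.le, ← Real.rpow_add hn', hexp]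
      refine hrp ?_
      push_cast
      linarith
  · refine hA (a := (n : ℝ) ^ (1 / 3 : ℝ) * (n : ℝ) ^ (-1 + (2 : ℕ) / (κ + 1) : ℝ)) ?_ ?_
    · have := mul_le_mul_of_nonneg_left (hmom 2 (by norm_num) (by norm_num))
        (by positivity : 0 ≤ (n : ℝ) ^ (1 / 3 : ℝ))
      linarith
    · rw [← Real.rpow_add hn', hexp]
      refine hrp ?_
      push_cast
      linarith
  · refine hA (hmom 3 (by norm_num) (by norm_num)) ?_
    rw [hexp]
    refine hrp ?_
    push_cast
    linarith
  · have e1 := (abs_le.1 (hCN n ((le_max_left _ _).trans hn) hn0 (-1) (Or.inr rfl) 3 le_rfl)).2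
    have e2 := (abs_le.1 (hCN n ((le_max_left _ _).trans hn) hn0 1 (Or.inl rfl) 3 le_rfl)).2
    have e3 : C * (n : ℝ) ^ (-1 + (3 : ℕ) / (κ + 1) : ℝ) ≤ C * 1 := by
      refine mul_le_mul_of_nonneg_left (Real.rpow_le_one_of_one_le_of_nonpos hn1 ?_) hC.le
      rw [hexp]; push_cast; linarith
    simp only [one_div_abs_sub_pow_eq three_ne_zero x (X n _), Finset.sum_add_distrib]
    rw [mul_add]
    have : 0 ≤ 1 / m := by positivity
    linarith
  · have h1 := hgap n ((le_max_right _ _).trans hn) hn0 k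
    set g := m * (n : ℝ) ^ (-(1 / (κ + 1))) with hg
    have hg0 : 0 < g := by positivity
    have h2 : g < |x - X n k| := by
      rw [mem_Icc, not_and_or, not_le, not_le] at h1
      rcases h1 with h | h
      · exact lt_abs.2 (Or.inl (by linarith))
      · exact lt_abs.2 (Or.inr (by linarith))
    refine ⟨fun h0 => by rw [h0, sub_self, abs_zero] at h2; linarith, ?_⟩
    calc 1 / ((n : ℝ) ^ (1 / 3 : ℝ) * |x - X n k|) ≤ 1 / ((n : ℝ) ^ (1 / 3 : ℝ) * g) := by gcongr
      _ = 1 / m * (n : ℝ) ^ (-d) := by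
          rw [hg, hdκ, mul_left_comm, ← Real.rpow_add hn',
            show (1 / 3 : ℝ) + -(1 / 3 - d) = d by ring, Real.rpow_neg hn'.le]
          field_simp
      _ ≤ (2 * C + P + 1 / m) * p := by
          have := hrp (a := -d) (by linarith)
          gcongr
          linarith

/-- Guarantees that the critical time is a genuine inverse. If the integral vanished, almost every
`s` would equal `x`, and then the third moment would vanish as well by the convention `1/0 = 0`. -/
theorem integral_one_div_sub_sq_pos {μ : Measure ℝ} {x : ℝ}
    (h2 : Integrable (fun s => 1 / (x - s) ^ 2) μ) (h3 : 0 < ∫ s, 1 / (x - s) ^ 3 ∂μ) :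
    0 < ∫ s, 1 / (x - s) ^ 2 ∂μ := by
  have hnn : 0 ≤ᵐ[μ] fun s => 1 / (x - s) ^ 2 := Eventually.of_forall fun s => by
    simp only [Pi.zero_apply]; positivity
  refine (integral_nonneg_of_ae hnn).lt_of_ne fun h0 => h3.ne' ?_
  have h := (integral_eq_zero_iff_of_nonneg_ae hnn h2).1 h0.symm
  refine integral_eq_zero_of_ae (h.mono fun s hs => ?_)
  have hs : 1 / (x - s) ^ 2 = 0 := hs
  have : x - s = 0 := by simpa using hs
  simp [this]

/-- With `K = B r⁻²` every smallness condition on the contours holds once `r` is large, and each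
summand in `hr` pays for one of them. The critical one is `K (1+r)⁴ ≲ r³`, whose left side grows
only like `r²`; there `38400 = 12 · 200 · 16`. -/
theorem conditions_of_le {r B R M T u : ℝ} (hB : 1 ≤ B) (hR : 0 ≤ R) (hM : 0 ≤ M) (hT : 0 ≤ T)
    (hr : 1 + 12 * (M + T + 1) + (R + 2) + 38400 * B + 200 * B * (1 + 2 * R) ^ 4 + 6 *
        (2 + R * M) ≤ r)
    (hu : u ≤ M * r) :
    200 * (B * (r ^ 2)⁻¹) * (1 + 2 * R) ^ 4 ≤ 1 ∧ 12 * (M + T + 1) ≤ r ∧ R + 2 ≤ r ∧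
      16 * ((B * (r ^ 2)⁻¹) * r) ≤ 1 ∧ 200 * (B * (r ^ 2)⁻¹) * (1 + r) ^ 4 ≤ r ^ 3 / 12 ∧
      Real.exp (-(r ^ 3 / 6)) ≤ B * (r ^ 2)⁻¹ * Real.exp (-R * u) := by
  have p1 : 0 ≤ R * M := mul_nonneg hR hM
  have p2 : 0 ≤ 200 * B * (1 + 2 * R) ^ 4 := by positivity
  have hr1 : 1 ≤ r := by linarith
  have hr0 : 0 < r := by linarith
  have hrr : r ≤ r ^ 2 := le_self_pow₀ hr1 two_ne_zero
  refine ⟨?_, by linarith, by linarith, ?_, ?_, ?_⟩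
  · rw [show 200 * (B * (r ^ 2)⁻¹) * (1 + 2 * R) ^ 4 = 200 * B * (1 + 2 * R) ^ 4 / r ^ 2 by ring,
      div_le_one (by positivity)]
    linarith
  · rw [show 16 * (B * (r ^ 2)⁻¹ * r) = 16 * B / r by field_simp, div_le_one hr0]
    linarith
  · have h1 : (1 + r) ^ 4 ≤ (2 * r) ^ 4 := by gcongr; linarith
    calc 200 * (B * (r ^ 2)⁻¹) * (1 + r) ^ 4 ≤ 200 * (B * (r ^ 2)⁻¹) * (2 * r) ^ 4 := by gcongr
      _ = 3200 * B * r ^ 2 := by field_simp; norm_num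
      _ ≤ r / 12 * r ^ 2 := by gcongr; linarith
      _ = r ^ 3 / 12 := by ring
  · have h1 : Real.exp (-R * (M * r)) ≤ Real.exp (-R * u) :=
      Real.exp_le_exp.2 (by nlinarith)
    have h2 : r ^ 2 ≤ Real.exp (2 * r) := by
      have : r ≤ Real.exp r := by linarith [Real.add_one_le_exp r]
      calc r ^ 2 ≤ Real.exp r ^ 2 := by gcongr
        _ = Real.exp (2 * r) := by rw [← Real.exp_nat_mul]; norm_num
    have h3 : Real.exp (-(2 * r)) ≤ (r ^ 2)⁻¹ := by
      rw [Real.exp_neg]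
      exact inv_anti₀ (by positivity) h2
    calc Real.exp (-(r ^ 3 / 6)) ≤ Real.exp (-(2 * r) + -R * (M * r)) := by
          refine Real.exp_le_exp.2 ?_
          have : 6 * (2 + R * M) ≤ r ^ 2 := by linarith
          nlinarith
      _ = 1 * Real.exp (-(2 * r)) * Real.exp (-R * (M * r)) := by rw [Real.exp_add, one_mul]
      _ ≤ _ := by gcongr


theorem approxConst_nonneg {A c c₁ tc S₃ T : ℝ} (hA : 0 ≤ A) (hc₁ : 0 < c₁) (htc : 0 < tc)
    (hS₃ : 0 < S₃) (hT : 0 ≤ T) : 0 ≤ approxConst A c c₁ tc S₃ T := by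
  unfold approxConst
  positivity

/-- The strictest requirement is the quadratic one, `2ε - 1/3 ≤ -2ε`, which the bound `1/15`
satisfies. -/
theorem div_rpow_third_le {x ε M u : ℝ} (hx : 1 ≤ x) (hε₀ : 0 ≤ ε) (hε : ε ≤ 1 / 15)
    (hM : 0 ≤ M) (hu : u ∈ Icc (-M) (M * x ^ ε)) :
    1 / x ^ (1 / 3 : ℝ) ≤ x ^ (-(2 * ε)) ∧ |u| / x ^ (1 / 3 : ℝ) ≤ M * x ^ (-(2 * ε)) ∧
      u ^ 2 / x ^ (1 / 3 : ℝ) ≤ M ^ 2 * x ^ (-(2 * ε)) := by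
  have hx0 : 0 < x := by linarith
  have h1 : 1 ≤ x ^ ε := Real.one_le_rpow hx hε₀
  have hau : |u| ≤ M * x ^ ε := abs_le.2 ⟨by nlinarith [hu.1], hu.2⟩
  have hle : ∀ a : ℝ, a - 1 / 3 ≤ -(2 * ε) → x ^ a / x ^ (1 / 3 : ℝ) ≤ x ^
      (-(2 * ε)) := fun a ha => by
    rw [← Real.rpow_sub hx0]
    exact Real.rpow_le_rpow_of_exponent_le hx ha
  refine ⟨?_, ?_, ?_⟩
  · simpa using hle 0 (by linarith)
  · calc |u| / x ^ (1 / 3 : ℝ) ≤ M * x ^ ε / x ^ (1 / 3 : ℝ) := by gcongr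
      _ = M * (x ^ ε / x ^ (1 / 3 : ℝ)) := mul_div_assoc _ _ _
      _ ≤ _ := mul_le_mul_of_nonneg_left (hle _ (by linarith)) hM
  · calc u ^ 2 / x ^ (1 / 3 : ℝ) = |u| ^ 2 / x ^ (1 / 3 : ℝ) := by rw [sq_abs]
      _ ≤ (M * x ^ ε) ^ 2 / x ^ (1 / 3 : ℝ) := by gcongr
      _ = M ^ 2 * (x ^ (2 * ε) / x ^ (1 / 3 : ℝ)) := by
          rw [mul_pow, ← Real.rpow_natCast (x ^ ε), ← Real.rpow_mul hx0.le, mul_div_assoc]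
          norm_num [mul_comm]
      _ ≤ _ := mul_le_mul_of_nonneg_left (hle _ (by linarith)) (sq_nonneg M)

theorem half_le_add_div {tc a q τ T : ℝ} (htc : 0 < tc) (ha : 0 < a) (hτ : |τ| ≤ T)
    (hq0 : 0 < q) (hq : 4 * T / (a * tc) ≤ q) : tc / 2 ≤ tc + 2 * τ / (a * q) := by
  have h : 4 * T ≤ q * (a * tc) := (div_le_iff₀ (by positivity)).1 hq
  have : -(tc / 2) ≤ 2 * τ / (a * q) := by
    rw [le_div_iff₀ (by positivity)]
    have := (abs_le.1 hτ).1
    nlinarith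
  linarith

end

end NIBM

/-! ### Choice of the parameters and conclusion. -/

theorem theorem1p2
    (X : (n : ℕ) → Fin n → ℝ) (μ : MeasureTheory.Measure ℝ)
    [MeasureTheory.IsProbabilityMeasure μ] (xstar κ : ℝ)
    (h_density : NIBM.HasVanishingLimitDensity X μ xstar κ)
    (h_rigid : NIBM.IsRigid X μ)
    (h_gap : NIBM.HasInitialGap X xstar κ)
    (h_pos : 0 < NIBM.stieltjesDeriv μ 2 xstar)
    (σ : ℝ) (hσ : 0 < σ)
    (ε : ℝ) (hε₀ : 0 < ε) (hε : ε < min ((κ - 2) / (6 * (κ + 1))) (1 / 15))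
    (T : Set ℝ) (hT : IsCompact T) (M : ℝ) (hM : 0 < M) :
    ∃ (C : ℝ) (N : ℕ), ∀ n : ℕ, N ≤ n →
      ∀ (x₀ : ℝ) (m : ℕ) (Γ : Fin m → ℝ → ℂ), NIBM.IsAdmissible (X n) x₀ Γ →
      ∀ τ₁ ∈ T, ∀ τ₂ ∈ T,
      ∀ u ∈ Set.Icc (-M) (M * (n : ℝ) ^ ε), ∀ v ∈ Set.Icc (-M) (M * (n : ℝ) ^ ε),
        ‖(1 / (NIBM.airyScale μ xstar * (n : ℝ) ^ (2 / 3 : ℝ)) : ℝ) *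
            NIBM.gaugedKernel μ xstar (X n) x₀ Γ
              (NIBM.airyTime μ xstar n τ₁) (NIBM.airyTime μ xstar n τ₂)
              (NIBM.airyCentre μ xstar n τ₁
                + u / (NIBM.airyScale μ xstar * (n : ℝ) ^ (2 / 3 : ℝ)))
              (NIBM.airyCentre μ xstar n τ₂
                + v / (NIBM.airyScale μ xstar * (n : ℝ) ^ (2 / 3 : ℝ)))
          - NIBM.airyKernel τ₁ τ₂ u v‖
        ≤ C * (Real.exp (-σ * (u + v)) / (n : ℝ) ^ ε) := by
  have hε1 := hε.trans_le (min_le_left _ _)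
  have hε2 := (hε.trans_le (min_le_right _ _)).le
  obtain ⟨T₀, hT₀⟩ : ∃ T₀ : ℝ, ∀ τ ∈ T, |τ| ≤ T₀ := hT.isBounded.exists_norm_le
  set T₁ := max T₀ 0 with hT₁
  have hτT : ∀ τ ∈ T, |τ| ≤ T₁ := fun τ hτ => (hT₀ τ hτ).trans (le_max_left _ _)
  have hT₁0 : 0 ≤ T₁ := le_max_right _ _
  -- the constants of the limit measure
  set S₁ := ∫ s, 1 / (xstar - s) ^ 1 ∂μ with hS₁
  set S₂ := ∫ s, 1 / (xstar - s) ^ 2 ∂μ with hS₂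
  set S₃ := ∫ s, 1 / (xstar - s) ^ 3 ∂μ with hS₃
  have hG : NIBM.stieltjesDeriv μ 0 xstar = S₁ := by simp [NIBM.stieltjesDeriv, hS₁]
  have hG2 : NIBM.stieltjesDeriv μ 2 xstar = 2 * S₃ := by
    simp [NIBM.stieltjesDeriv, hS₃, Nat.factorial]
  have hS₃0 : 0 < S₃ := by rw [hG2] at h_pos; linarith
  have hS₂0 : 0 < S₂ := by
    obtain ⟨hint, -⟩ := NIBM.exists_abs_mean_sidePow_sub_le h_density h_rigid h_gap
    exact NIBM.integral_one_div_sub_sq_pos (NIBM.integrable_one_div_sub_pow two_ne_zero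
      fun ρ hρ => hint ρ hρ 2 (by norm_num)).1 hS₃0
  set tc := S₂⁻¹ with htc
  have htc0 : 0 < tc := inv_pos.2 hS₂0
  have hcrit : NIBM.criticalTime μ xstar = tc := rfl
  set c₁ := S₃ ^ (1 / 3 : ℝ) with hc₁
  have hc₁0 : 0 < c₁ := Real.rpow_pos_of_pos hS₃0 _
  have hc₁3 : c₁ ^ 3 = S₃ := by
    rw [hc₁, ← Real.rpow_natCast, ← Real.rpow_mul hS₃0.le]; norm_num
  set c := (c₁ * tc)⁻¹ with hc
  have hc0 : 0 < c := by positivity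
  have hcc : c * c₁ * tc = 1 := by rw [hc]; field_simp
  -- The factor `2^{1/3}` disappears because the second derivative of the Stieltjes transform is
  -- twice the third inverse moment.
  have hscale : NIBM.airyScale μ xstar = c := by
    have : (0 : ℝ) < 2 ^ (1 / 3 : ℝ) := by positivity
    rw [NIBM.airyScale, hG2, hcrit, Real.mul_rpow zero_le_two hS₃0.le, ← hc₁, hc]
    field_simp
  -- the parameters of the estimate
  obtain ⟨A, hA, N₁, hmom⟩ := NIBM.exists_moment_bounds h_density h_rigid h_gap hε₀ hε1
  set A' := A + M + M ^ 2 with hA'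
  have hA'0 : 0 ≤ A' := by positivity
  have hAA' : A ≤ A' := by linarith [sq_nonneg M]
  set B := NIBM.approxConst A' c c₁ tc S₃ T₁ + 1 with hB
  have hB1 : 1 ≤ B := by
    have := NIBM.approxConst_nonneg (c := c) hA'0 hc₁0 htc0 hS₃0 hT₁0
    linarith
  -- The contours need `R ≥ M + 2T₁ + 2`; adding `σ` makes `R - σ` nonnegative, so that `exp (-R
  -- (u+v))` can be traded for `exp (-σ (u+v))`.
  set R := M + 2 * T₁ + 2 + σ with hR
  have hR0 : 0 ≤ R := by positivity
  have hlim : ∀ {a : ℝ}, 0 < a → ∀ y : ℝ, ∀ᶠ n : ℕ in Filter.atTop, y ≤ (n : ℝ) ^ a :=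
    fun ha y => ((tendsto_rpow_atTop ha).comp tendsto_natCast_atTop_atTop).eventually_ge_atTop y
  obtain ⟨N, hN⟩ := Filter.eventually_atTop.1 <| (Filter.eventually_ge_atTop (max N₁ 1)).and <|
    (hlim (by norm_num : (0 : ℝ) < 1 / 3) (4 * T₁ / (c ^ 2 * tc))).and <|
    hlim hε₀ (1 + 12 * (M + T₁ + 1) + (R + 2) + 38400 * B + 200 * B * (1 + 2 * R) ^ 4
      + 6 * (2 + R * M))
  refine ⟨NIBM.kernelConst R T₁ * B * Real.exp (2 * (R - σ) * M), N,
    fun n hn x₀ m Γ hΓ τ₁ hτ₁ τ₂ hτ₂ u hu v hv => ?_⟩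
  obtain ⟨hn1, hnq, hnr⟩ := hN n hn
  have hn0 : 0 < n := (le_max_right _ _).trans hn1
  have hn1' : (1 : ℝ) ≤ n := by exact_mod_cast hn0
  have hnpos : (0 : ℝ) < n := by linarith
  obtain ⟨m1, m2, m3, m4, m5⟩ := hmom n ((le_max_left _ _).trans hn1) hn0
  set q := (n : ℝ) ^ (1 / 3 : ℝ) with hq
  have hq0 : 0 < q := by positivity
  have hq3 : (n : ℝ) = q ^ 3 := by
    rw [hq, ← Real.rpow_natCast, ← Real.rpow_mul hnpos.le]; norm_num
  set p := (n : ℝ) ^ (-(2 * ε)) with hp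
  have hp0 : 0 ≤ p := by positivity
  -- The right contour crosses the axis at `n^ε`, matching the range `u ≤ M n^ε`; the approximation
  -- error is then `K = B r⁻²`.
  set r := (n : ℝ) ^ ε with hr
  have hr1 : 1 ≤ r := Real.one_le_rpow hn1' hε₀.le
  have hr0 : 0 < r := by linarith
  have hpr : p = (r ^ 2)⁻¹ := by
    rw [hp, hr, Real.rpow_neg hnpos.le, ← Real.rpow_natCast, ← Real.rpow_mul hnpos.le]
    norm_num [mul_comm]
  have hmono : ∀ {y : ℝ}, y ≤ A * p → y ≤ A' * p := fun h =>
    h.trans (mul_le_mul_of_nonneg_right hAA' hp0)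
  have htime : ∀ τ, NIBM.airyTime μ xstar n τ = tc + 2 * τ / (c ^ 2 * q) := fun τ => by
    rw [NIBM.airyTime, hcrit, hscale]
  have hhalf : ∀ τ ∈ T, tc / 2 ≤ tc + 2 * τ / (c ^ 2 * q) := fun τ hτ =>
    NIBM.half_le_add_div htc0 (by positivity) (hτT τ hτ) hq0 hnq
  have happrox : ∀ τ ∈ T, ∀ w ∈ Set.Icc (-M) (M * r), ∀ s k₀ : ℝ, s = tc + 2 * τ / (c ^ 2 * q) →
      |k₀ - n / (2 * s) * (w / (c * q ^ 2)) ^ 2| ≤ |Real.log (tc / s)| / 2 →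
      NIBM.CubicApprox k₀ (2 * (n / (2 * s)) * -(s * S₁ + w / (c * q ^ 2)) / (c₁ * q))
        (n / (2 * s) / (c₁ * q) ^ 2) (fun k => -(c₁ * q * (X n k - xstar))⁻¹) τ w
        (B * (r ^ 2)⁻¹) := fun τ hτ w hw s k₀ hs hk₀ => by
    obtain ⟨b1, b2, b3⟩ := NIBM.div_rpow_third_le hn1' hε₀.le hε2 hM.le hw
    refine (NIBM.cubicApprox_of_moments hq3 hq0 hc0 hc₁0 htc0 hcc hc₁3 (inv_inv S₂).symm hs
      (hs ▸ hhalf τ hτ) (hτT τ hτ) hA'0 hp0 (hmono m1) (hmono m2) (hmono m3) (m4.trans hAA')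
      (fun k => hmono (m5 k).2) b1 (b2.trans ?_) (b3.trans ?_) hk₀).mono ?_
    · exact mul_le_mul_of_nonneg_right (by linarith [sq_nonneg M]) hp0
    · exact mul_le_mul_of_nonneg_right (by linarith) hp0
    · rw [← hpr]
      exact mul_le_mul_of_nonneg_right (by linarith) hp0
  obtain ⟨c1, c2, c3, c4, c5, c6⟩ := NIBM.conditions_of_le hB1 hR0 hM.le hT₁0 hnr hu.2
  have hmain := NIBM.CubicApprox.norm_gaugedKernel_sub_airyKernel_le hn0.ne' hΓ hscale hcrit hG
    hq.symm (l := c₁ * q) (by rw [hc]; field_simp) hc0 htc0 (htime τ₁) (htime τ₂)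
    ((half_pos htc0).trans_le (hhalf τ₁ hτ₁)) ((half_pos htc0).trans_le (hhalf τ₂ hτ₂))
    (fun _ => rfl) (fun j => (m5 j).1)
    (happrox τ₁ hτ₁ u hu _ _ rfl (by rw [sub_sub_cancel_left, abs_neg, abs_div, abs_two]))
    (happrox τ₂ hτ₂ v hv _ _ rfl (by rw [add_sub_cancel_left, abs_div, abs_two]))
    (hτT τ₁ hτ₁) (hτT τ₂ hτ₂) hM.le (by linarith) c1 c2 c3 c4 c5 hu.1 hu.2 c6
  refine hmain.trans ?_
  -- Since `u + v ≥ -2M`, the surplus `R - σ` in the exponent costs at most the constant factor `exp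
  -- (2(R-σ)M)`.
  have hexp : Real.exp (-R * (u + v))
      ≤ Real.exp (2 * (R - σ) * M) * Real.exp (-σ * (u + v)) := by
    rw [← Real.exp_add]
    refine Real.exp_le_exp.2 ?_
    have : 0 ≤ (R - σ) * (u + v + 2 * M) :=
      mul_nonneg (by linarith) (by linarith [hu.1, hv.1])
    linarith
  have hrr : (r ^ 2)⁻¹ ≤ r⁻¹ := inv_anti₀ hr0 (le_self_pow₀ hr1 two_ne_zero)
  have hk := NIBM.kernelConst_nonneg R T₁
  calc NIBM.kernelConst R T₁ * (B * (r ^ 2)⁻¹) * Real.exp (-R * (u + v))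
      ≤ NIBM.kernelConst R T₁ * (B * r⁻¹)
        * (Real.exp (2 * (R - σ) * M) * Real.exp (-σ * (u + v))) := by gcongr
    _ = _ := by ring
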